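/- \textbf{Setting.} Let $d\ge 1$ and $\widehat f(\xi)=\int_{\mathbb R^d}f(x)e^{-2\pi i\langle x,\xi\rangle}\,dx$, with inverse transform $f^\vee$. Fix a smooth $\varphi:\mathbb R^d\to[0,1]$ with $\varphi=1$ on $\{1/2\le|\xi|\le 2\}$ and support in $\{1/4\le|\xi|\le 4\}$. Fix a Schwartz function $\phi$ such that $\widehat\phi$ is supported in $\{1/2\le|\xi|\le2\}$ and $\sum_{k\in\mathbb Z}\widehat{\phi_k}(\xi)=1$ for $\xi\neq0$, where $\phi_k=2^{kd}\phi(2^k\cdot)$. Put $\Pi_kf=\phi_k*f$. Let $B_0=\{|x|\le2\}$ and $B_k=\{2^k<|x|\le2^{k+1}\}$ for $k\ge1$. For $0<u,t\le\infty$ and $s\in\mathbb R$ let $$\|g\|_{K_u^{s,t}}=\Big(\sum_{k\ge0}2^{skt}\|g\|_{L^u(B_k)}^t\Big)^{1/t}$$ (a supremum if $t=\infty$), and for $m\in L^\infty(\mathbb R^d)$ let $$\mathcal K_u^{s,t}[m]=\sup_{k\in\mathbb Z}\big\|\big(m(2^k\cdot)\varphi\big)^\vee\big\|_{K_u^{s,t}}.$$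 For a tempered distribution $f$ and $1\le p,q\le\infty$ let $\|f\|_{\dot F_p^{0,q}}=\|\{\Pi_kf\}_{k\in\mathbb Z}\|_{L^p(\ell^q)}$ if $p<\infty$ or $p=q=\infty$. If $p=\infty$ and $q<\infty$, let $$\|f\|_{\dot F_\infty^{0,q}}=\sup_P\Big(\frac1{|P|}\int_P\sum_{k\ge-\log_2 l(P)}|\Pi_kf(x)|^q\,dx\Big)^{1/q},$$ where $P$ runs over all dyadic cubes and $l(P)$ is the side length of $P$. For $m\in L^\infty$ let $T_mf=(m\widehat f)^\vee$. Let $S_\infty$ be the space of Schwartz functions all of whose moments vanish. We say that $T_m$ is bounded on $\dot F_p^{0,q}$ if there is a finite $C$ with $\|T_mf\|_{\dot F_p^{0,q}}\le C\|f\|_{\dot F_p^{0,q}}$ for all $f\in S_\infty$. \textbf{Theorem.} Let $1\le p,q\le\infty$ with $(p,q)\ne(2,2)$, let $1<u\le\infty$, $0<t\le\infty$, $s\in\mathbb R$, and suppose that one of the following holds: \begin{enumerate} \item $s<d-d/u$; \item $s=d-d/u$ and $p=1<q\le\infty$; \item $s=d-d/u$ and $1\le q<p=\infty$; \item $s=d-d/u$,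 $1<p<\infty$ and $|1/p-1/q|\ge 1-1/u$; \item $s=d-d/u$ and $t>1$. \end{enumerate} Then there exists $m\in L^\infty(\mathbb R^d)$ with $\mathcal K_u^{s,t}[m]<\infty$ such that $T_m$ is not bounded on $\dot F_p^{0,q}$. -/

import Mathlib

open MeasureTheory
open scoped SchwartzMap FourierTransform ENNReal NNReal

namespace HerzMultiplier

/-- Euclidean space `ℝ^d`. -/
abbrev E (d : ℕ) : Type := EuclideanSpace ℝ (Fin d)

variable {d : ℕ}

/-! ### Herz spaces and the multiplier condition -/

/-- The set `B_0 = {|x| ≤ 2}` and, for `k ≥ 1`, the annulus `B_k = {2^k < |x| ≤ 2^(k+1)}`. -/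
def annulus (d : ℕ) : ℕ → Set (E d)
  | 0 => {x | ‖x‖ ≤ 2}
  | k + 1 => {x | (2 : ℝ) ^ (k + 1) < ‖x‖ ∧ ‖x‖ ≤ (2 : ℝ) ^ (k + 2)}

/-- The `ℓ^q` (quasi-)norm of a family of nonnegative extended numbers, `0 < q ≤ ∞`. -/
noncomputable def seqNorm {ι : Type} (q : ℝ≥0∞) (a : ι → ℝ≥0∞) : ℝ≥0∞ :=
  if q = ∞ then ⨆ i, a i else (∑' i, a i ^ q.toReal) ^ (1 / q.toReal)

/-- The Herz (quasi-)norm `‖g‖_{K_u^{s,t}} = ‖(2^{sk} ‖g‖_{L^u(B_k)})_{k ≥ 0}‖_{ℓ^t}`. -/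
noncomputable def herzNorm (u : ℝ≥0∞) (s : ℝ) (t : ℝ≥0∞) (g : E d → ℂ) : ℝ≥0∞ :=
  seqNorm t fun k : ℕ =>
    ENNReal.ofReal ((2 : ℝ) ^ (s * k)) * eLpNorm g u (volume.restrict (annulus d k))

/-- `φ` is a smooth cutoff with `0 ≤ φ ≤ 1`, `φ = 1` on `1/2 ≤ |ξ| ≤ 2` and support in
`1/4 ≤ |ξ| ≤ 4`. -/
structure IsAnnularCutoff (φ : E d → ℝ) : Prop where
  contDiff : ContDiff ℝ (⊤ : ℕ∞) φ
  nonneg : ∀ ξ, 0 ≤ φ ξ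
  le_one : ∀ ξ, φ ξ ≤ 1
  eq_one : ∀ ξ, 1 / 2 ≤ ‖ξ‖ → ‖ξ‖ ≤ 2 → φ ξ = 1
  tsupport_subset : tsupport φ ⊆ {ξ | 1 / 4 ≤ ‖ξ‖ ∧ ‖ξ‖ ≤ 4}

/-- `𝒦_u^{s,t}[m] = sup_{k ∈ ℤ} ‖(m(2^k ·) φ)^∨‖_{K_u^{s,t}}`. -/
noncomputable def herzMultiplierNorm (φ : E d → ℝ) (u : ℝ≥0∞) (s : ℝ) (t : ℝ≥0∞)
    (m : Lp ℂ ∞ (volume : Measure (E d))) : ℝ≥0∞ :=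
  ⨆ k : ℤ, herzNorm u s t (𝓕⁻ fun ξ : E d => m ((2 : ℝ) ^ k • ξ) * (φ ξ : ℂ))

/-! ### Homogeneous Triebel-Lizorkin spaces -/

/-- Multiplication by a nonzero real number, as a linear automorphism of `ℝ^d`. -/
noncomputable def scaling (d : ℕ) (c : ℝ) (hc : c ≠ 0) : E d ≃L[ℝ] E d :=
  ContinuousLinearEquiv.smulLeft (Units.mk0 c hc)

/-- `ϕ_k = 2^{kd} ϕ(2^k ·)`. -/
noncomputable def dilate (ϕ : 𝓢(E d, ℂ)) (k : ℤ) : 𝓢(E d, ℂ) :=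
  ((2 : ℂ) ^ (k * (d : ℤ))) • SchwartzMap.compCLMOfContinuousLinearEquiv ℂ
    (scaling d ((2 : ℝ) ^ k) (zpow_ne_zero k two_ne_zero)) ϕ

theorem dilate_apply (ϕ : 𝓢(E d, ℂ)) (k : ℤ) (x : E d) :
    dilate ϕ k x = (2 : ℂ) ^ (k * (d : ℤ)) * ϕ ((2 : ℝ) ^ k • x) := rfl

/-- The Schwartz function `y ↦ ψ (x - y)`. -/
noncomputable def reflectTranslate (ψ : 𝓢(E d, ℂ)) (x : E d) : 𝓢(E d, ℂ) :=
  (SchwartzMap.compCLMOfContinuousLinearEquiv ℂ (ContinuousLinearEquiv.neg ℝ) ψ).compSubConstCLM ℂ x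

theorem reflectTranslate_apply (ψ : 𝓢(E d, ℂ)) (x y : E d) :
    reflectTranslate ψ x y = ψ (x - y) := by
  simp [reflectTranslate]

/-- `ϕ` generates a homogeneous dyadic resolution of unity: `ϕ̂` is supported in
`1/2 ≤ |ξ| ≤ 2` and `∑_{k ∈ ℤ} ϕ̂_k(ξ) = 1` for `ξ ≠ 0`. -/
structure IsLittlewoodPaley (ϕ : 𝓢(E d, ℂ)) : Prop where
  tsupport_subset : tsupport (𝓕 ϕ : 𝓢(E d, ℂ)) ⊆ {ξ | 1 / 2 ≤ ‖ξ‖ ∧ ‖ξ‖ ≤ 2}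
  hasSum : ∀ ξ : E d, ξ ≠ 0 → HasSum (fun k : ℤ => (𝓕 (dilate ϕ k) : 𝓢(E d, ℂ)) ξ) 1

/-- The Littlewood-Paley piece `Π_k f = ϕ_k * f` of a tempered distribution, as a function:
`(ϕ_k * f)(x) = ⟨f, ϕ_k(x - ·)⟩`. -/
noncomputable def lpPiece (ϕ : 𝓢(E d, ℂ)) (k : ℤ) (f : 𝓢'(E d, ℂ)) (x : E d) : ℂ :=
  f (reflectTranslate (dilate ϕ k) x)

/-- The dyadic cube with side length `2^{-j}` and lower left corner `2^{-j} n`. -/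
def dyadicCube (j : ℤ) (n : Fin d → ℤ) : Set (E d) :=
  {x | ∀ i, (2 : ℝ) ^ (-j) * n i ≤ x i ∧ x i < (2 : ℝ) ^ (-j) * (n i + 1)}

/-- The (quasi-)norm of the homogeneous Triebel-Lizorkin space with smoothness index `0` and
exponents `p`, `q`.  If `p < ∞` or `p = q = ∞` this is `‖{Π_k f}‖_{L^p(ℓ^q)}`.  If `p = ∞` and
`q < ∞` it is the supremum over all dyadic cubes `P` of
`(|P|⁻¹ ∫_P ∑_{k ≥ -log₂ l(P)} |Π_k f|^q)^{1/q}`; for a cube of side length `2^{-j}` the sum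
runs over `k = j + i`, `i ∈ ℕ`. -/
noncomputable def tlNorm (ϕ : 𝓢(E d, ℂ)) (p q : ℝ≥0∞) (f : 𝓢'(E d, ℂ)) : ℝ≥0∞ :=
  if p = ∞ ∧ q ≠ ∞ then
    ⨆ (j : ℤ) (n : Fin d → ℤ),
      (⨍⁻ x in dyadicCube j n, (∑' i : ℕ, ‖lpPiece ϕ (j + i) f x‖ₑ ^ q.toReal) ∂volume) ^ (1 / q.toReal)
  else
    eLpNorm (fun x : E d => seqNorm q fun k : ℤ => ‖lpPiece ϕ k f x‖ₑ) p volume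

/-! ### Multiplier operators -/

/-- The multiplier operator `T_m f = (m f̂)^∨` on Schwartz functions.  The product `m f̂` is an
`L²` function, and the inverse Fourier transform is that of tempered distributions. -/
noncomputable def multiplierOp (m : Lp ℂ ∞ (volume : Measure (E d))) (f : 𝓢(E d, ℂ)) :
    𝓢'(E d, ℂ) :=
  𝓕⁻ (Lp.toTemperedDistribution
    (m • (𝓕 f : 𝓢(E d, ℂ)).toLp 2 volume : Lp ℂ 2 (volume : Measure (E d))))

/-- The space `S_∞` of Schwartz functions all of whose moments vanish. -/
def HasVanishingMoments (f : 𝓢(E d, ℂ)) : Prop :=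
  ∀ γ : Fin d → ℕ, ∫ x : E d, ((∏ i, x i ^ γ i : ℝ) : ℂ) * f x = 0

/-- `T_m` is bounded on the homogeneous Triebel-Lizorkin space with smoothness index `0`:
`‖T_m f‖ ≤ C ‖f‖` for all `f ∈ S_∞`. -/
def IsBoundedMultiplier (ϕ : 𝓢(E d, ℂ)) (p q : ℝ≥0∞)
    (m : Lp ℂ ∞ (volume : Measure (E d))) : Prop :=
  ∃ C : ℝ≥0, ∀ f : 𝓢(E d, ℂ), HasVanishingMoments f →
    tlNorm ϕ p q (multiplierOp m f) ≤
      C * tlNorm ϕ p q (SchwartzMap.toTemperedDistributionCLM (E d) ℂ volume f)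

end HerzMultiplier

namespace HerzMultiplier

variable {d : ℕ}

/-! ### Mixed sequence norms -/

section SeqNorm

variable {ι κ : Type}

/-! The problem is transferred to convolutions on the lattice. Take frequency blocks centred at `c_j
= 2^{b_j} e` with widely separated exponents `b_j`, and let a wave packet carry on block `j` the
function `∑ₙ a_j(n) X^∨(x - n)` modulated by `c_j`, where `X` has compact support. Only boundedly
many Littlewood-Paley pieces see a given block. Since `X^∨` is bounded below near the origin, while
its values near the nonzero lattice points are summably small, the Triebel-Lizorkin norm of the
packet is comparable to the norm of `(a_j)` in `ℓ^p(ℤ^d; ℓ^q)`, also for `p = ∞`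
(`IsTransferWindow.tlNorm_le`, `IsTransferWindow.le_tlNorm`). A symbol `∑_j κ̂_j(ξ - c_j) Z(ξ -
c_j)`, with `Z = 1` on the support of `X`, acts by `a_j ↦ κ_j * a_j`.

On the Herz side, each `m(2^k ·) φ` meets at most one block. If `κ` lives on lattice points of size
about `2^l`, is bounded by `a` and has at most `v` nonzero values, then at the critical `s = d -
d/u` its Herz entries are at most a constant times `a v^{1/u} 2^{ls}`, with geometric decay away
from the annulus of index `k + l` (`exists_herzEntry_le`). The decay rate is positive because `u >
1`. It therefore suffices to find, for every `N`, lattice kernels with uniformly bounded symbols and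
Herz norms, and finitely supported inputs whose mixed norm grows by a factor exceeding `N`. Placing
the families for all `N` on disjoint blocks of one symbol yields a single `m` that defeats every
constant (`exists_multiplier_of_blocks`).

Three constructions supply the kernels. For `p = 1 < q` and for `q < p = ∞`, averages over shells
work: applied to `L` copies of a point mass they produce disjoint outputs, and applied to disjoint
reflected shells they produce outputs that all equal one at the origin. For `|1/p - 1/q| ≥ 1 - 1/u`,
translations weighted by a power of the density `2^{-ld}` work: they either gather separated point
masses at one site or spread point masses from one site, exchanging `L^{1/p}` and `L^{1/q}`. For `t
> 1`, a kernel of Rudin-Shapiro signs is spread over `L` shells with amplitude `2^μ / L` per shell.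
Its symbol is at most `2` because the signs have square-root cancellation, its Herz norm is
controlled by `2^μ L^{1/t - 1}`, hence harmless for large `L`, and on functions periodic modulo `Q =
2^{2μ}` in one coordinate it acts as a matrix with entries `±Q^{-1/2}`. Such a matrix spreads point
masses and concentrates modulated ones, which rules out uniform bounds on `ℓ^p(ℓ^q)` unless `p = q =
2`. The subcritical case `s < d - d/u` follows from this last construction with `t = ∞`. -/

theorem seqNorm_top (a : ι → ℝ≥0∞) : seqNorm ∞ a = ⨆ i, a i := by simp [seqNorm]

theorem seqNorm_of_ne_top {q : ℝ≥0∞} (hq : q ≠ ∞) (a : ι → ℝ≥0∞) :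
    seqNorm q a = (∑' i, a i ^ q.toReal) ^ (1 / q.toReal) := by simp [seqNorm, hq]

theorem seqNorm_le_iff {q : ℝ≥0∞} (h0 : q ≠ 0) (hq : q ≠ ∞) (a : ι → ℝ≥0∞) (c : ℝ≥0∞) :
    seqNorm q a ≤ c ↔ ∀ V : Finset ι, ∑ i ∈ V, a i ^ q.toReal ≤ c ^ q.toReal := by
  have hpos : 0 < q.toReal := ENNReal.toReal_pos h0 hq
  rw [seqNorm_of_ne_top hq, one_div, ENNReal.rpow_inv_le_iff hpos, ENNReal.tsum_eq_iSup_sum, iSup_le_iff]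

theorem seqNorm_eq_eLpNorm [MeasurableSpace ι] [MeasurableSingletonClass ι] {q : ℝ≥0∞}
    (h0 : q ≠ 0) (a : ι → ℝ≥0∞) : seqNorm q a = eLpNorm a q Measure.count := by
  by_cases hq : q = ∞
  · subst hq
    simp [seqNorm_top, eLpNormEssSup_count]
  · rw [seqNorm_of_ne_top hq, eLpNorm_eq_lintegral_rpow_enorm_toReal h0 hq, lintegral_count]
    simp

theorem seqNorm_mono {q : ℝ≥0∞} {a b : ι → ℝ≥0∞} (h : ∀ i, a i ≤ b i) :
    seqNorm q a ≤ seqNorm q b := by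
  unfold seqNorm
  split_ifs with hq
  · exact iSup_mono h
  · gcongr with i
    exact h i

theorem le_seqNorm {q : ℝ≥0∞} (h0 : q ≠ 0) (a : ι → ℝ≥0∞) (i : ι) : a i ≤ seqNorm q a := by
  by_cases hq : q = ∞
  · subst hq
    rw [seqNorm_top]
    exact le_iSup a i
  · have := (seqNorm_le_iff h0 hq a _).1 le_rfl {i}
    rw [Finset.sum_singleton] at this
    exact (ENNReal.rpow_le_rpow_iff (ENNReal.toReal_pos h0 hq)).1 this

theorem seqNorm_const_mul {q : ℝ≥0∞} (h0 : q ≠ 0) (c : ℝ≥0∞) (a : ι → ℝ≥0∞) :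
    seqNorm q (fun i => c * a i) = c * seqNorm q a := by
  by_cases hq : q = ∞
  · subst hq
    simp only [seqNorm_top, ENNReal.mul_iSup]
  · have hpos : 0 < q.toReal := ENNReal.toReal_pos h0 hq
    simp only [seqNorm_of_ne_top hq]
    simp_rw [ENNReal.mul_rpow_of_nonneg _ _ hpos.le]
    rw [ENNReal.tsum_mul_left, ENNReal.mul_rpow_of_nonneg _ _ (by positivity), ← ENNReal.rpow_mul,
      mul_one_div_cancel hpos.ne', ENNReal.rpow_one]

theorem seqNorm_zero {q : ℝ≥0∞} (h0 : q ≠ 0) : seqNorm q (fun _ : ι => (0 : ℝ≥0∞)) = 0 := by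
  simpa using seqNorm_const_mul h0 0 (fun _ : ι => (0 : ℝ≥0∞))

/-- Minkowski's inequality for two sequences. -/
theorem seqNorm_add_le {q : ℝ≥0∞} (h1 : 1 ≤ q) (a b : ι → ℝ≥0∞) :
    seqNorm q (fun i => a i + b i) ≤ seqNorm q a + seqNorm q b := by
  have h0 : q ≠ 0 := (zero_lt_one.trans_le h1).ne'
  let _ : MeasurableSpace ι := ⊤
  simp only [seqNorm_eq_eLpNorm h0]
  exact eLpNorm_add_le (measurable_from_top).aestronglyMeasurable
    (measurable_from_top).aestronglyMeasurable h1

theorem seqNorm_sum_le {q : ℝ≥0∞} (h1 : 1 ≤ q) (s : Finset κ) (f : κ → ι → ℝ≥0∞) :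
    seqNorm q (fun i => ∑ r ∈ s, f r i) ≤ ∑ r ∈ s, seqNorm q (f r) := by
  classical
  have h0 : q ≠ 0 := (zero_lt_one.trans_le h1).ne'
  induction s using Finset.induction_on with
  | empty => simp [seqNorm_zero h0]
  | insert r s hr ih =>
    simp only [Finset.sum_insert hr]
    exact (seqNorm_add_le h1 _ _).trans (add_le_add le_rfl ih)

/-- Minkowski's inequality for infinitely many sequences. -/
theorem seqNorm_tsum_le {q : ℝ≥0∞} (h1 : 1 ≤ q) (f : κ → ι → ℝ≥0∞) :
    seqNorm q (fun i => ∑' r, f r i) ≤ ∑' r, seqNorm q (f r) := by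
  have h0 : q ≠ 0 := (zero_lt_one.trans_le h1).ne'
  by_cases hq : q = ∞
  · subst hq
    simp only [seqNorm_top]
    exact iSup_le fun i => ENNReal.tsum_le_tsum fun r => le_iSup (f r) i
  · rw [seqNorm_le_iff h0 hq]
    intro V
    -- On a finite set of indices `i` the partial sums over `r` may be passed to the limit termwise,
    -- so the finite Minkowski inequality suffices.
    have hlim : Filter.Tendsto (fun s : Finset κ => ∑ i ∈ V, (∑ r ∈ s, f r i) ^ q.toReal)
        Filter.atTop (nhds (∑ i ∈ V, (∑' r, f r i) ^ q.toReal)) := by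
      refine tendsto_finsetSum _ fun i _ => ?_
      exact (ENNReal.continuous_rpow_const.tendsto _).comp (ENNReal.summable.hasSum)
    refine le_of_tendsto hlim (Filter.Eventually.of_forall fun s => ?_)
    refine (seqNorm_le_iff h0 hq (fun i => ∑ r ∈ s, f r i) _).1 ?_ V
    exact (seqNorm_sum_le h1 s f).trans (ENNReal.sum_le_tsum s)

theorem seqNorm_comp_injective_le {q : ℝ≥0∞} (a : ι → ℝ≥0∞) {σ : κ → ι}
    (hσ : Function.Injective σ) : seqNorm q (fun j => a (σ j)) ≤ seqNorm q a := by
  unfold seqNorm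
  split_ifs with hq
  · exact iSup_le fun j => le_iSup a (σ j)
  · gcongr
    exact ENNReal.tsum_comp_le_tsum_of_injective hσ _

theorem seqNorm_comp_equiv {q : ℝ≥0∞} (a : ι → ℝ≥0∞) (σ : κ ≃ ι) :
    seqNorm q (fun j => a (σ j)) = seqNorm q a := by
  refine le_antisymm (seqNorm_comp_injective_le a σ.injective) ?_
  simpa using seqNorm_comp_injective_le (q := q) (fun j => a (σ j)) σ.symm.injective

/-- Extending a sequence by zero along an injection does not change its norm. -/
theorem seqNorm_eq_comp_of_support {q : ℝ≥0∞} (h0 : q ≠ 0) (a : ι → ℝ≥0∞) {σ : κ → ι}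
    (hσ : Function.Injective σ) (ha : ∀ i, i ∉ Set.range σ → a i = 0) :
    seqNorm q a = seqNorm q (fun j => a (σ j)) := by
  refine le_antisymm ?_ (seqNorm_comp_injective_le a hσ)
  by_cases hq : q = ∞
  · subst hq
    simp only [seqNorm_top]
    refine iSup_le fun i => ?_
    by_cases hi : i ∈ Set.range σ
    · obtain ⟨j, rfl⟩ := hi
      exact le_iSup (fun j => a (σ j)) j
    · simp [ha i hi]
  · have hpos : 0 < q.toReal := ENNReal.toReal_pos h0 hq
    simp only [seqNorm_of_ne_top hq]
    gcongr
    rw [hσ.tsum_eq (f := fun i => a i ^ q.toReal)]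
    intro i hi
    by_contra h
    simp [ha i h, hpos] at hi

open Classical in
/-- The norm of a constant on a finite set. -/
theorem seqNorm_indicator_const {q : ℝ≥0∞} (h0 : q ≠ 0) (s : Finset ι) (hs : s.Nonempty)
    (c : ℝ≥0∞) : seqNorm q (fun i => if i ∈ s then c else 0) = c * (s.card : ℝ≥0∞) ^ (1 / q.toReal) := by
  let _ : MeasurableSpace ι := ⊤
  rw [seqNorm_eq_eLpNorm h0]
  have h := eLpNorm_indicator_const' (p := q) (μ := (Measure.count : Measure ι)) (c := c)
    (s := (s : Set ι)) (MeasurableSpace.measurableSet_top)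
    (by rw [Measure.count_apply_finset]; simpa using hs.ne_empty) h0
  rw [Measure.count_apply_finset, enorm_eq_self] at h
  rw [← h]
  congr 1
  ext i
  simp [Set.indicator_apply]

theorem seqNorm_lt_top_of_finite {q : ℝ≥0∞} (h0 : q ≠ 0) (a : ι → ℝ≥0∞) (s : Finset ι)
    (hs : ∀ i ∉ s, a i = 0) (ha : ∀ i, a i ≠ ∞) : seqNorm q a ≠ ∞ := by
  by_cases hq : q = ∞
  · subst hq
    rw [seqNorm_top]
    refine ne_top_of_le_ne_top (ENNReal.sum_ne_top.2 fun i (_ : i ∈ s) => ha i) (iSup_le fun i => ?_)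
    by_cases hi : i ∈ s
    · exact Finset.single_le_sum (f := a) (fun _ _ => zero_le) hi
    · simp [hs i hi]
  · have hpos : 0 < q.toReal := ENNReal.toReal_pos h0 hq
    rw [seqNorm_of_ne_top hq, tsum_eq_sum (s := s)]
    · refine ENNReal.rpow_ne_top_of_nonneg (by positivity) (ENNReal.sum_ne_top.2 fun i _ => ?_)
      exact ENNReal.rpow_ne_top_of_nonneg hpos.le (ha i)
    · intro i hi
      simp [hs i hi, hpos]

end SeqNorm

/-- The norm of `ℓ^p(ℤ^d; ℓ^q(ι))`. -/
noncomputable def mixedNorm {d : ℕ} {ι : Type} (p q : ℝ≥0∞) (b : ι → (Fin d → ℤ) → ℂ) : ℝ≥0∞ :=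
  seqNorm p fun n => seqNorm q fun j => ‖b j n‖ₑ

/-! ### The integer part of a vector -/

/-- The coordinatewise integer part. -/
noncomputable def floorVec (x : E d) : Fin d → ℤ := fun i => ⌊x i⌋

theorem measurable_floorVec : Measurable (floorVec : E d → Fin d → ℤ) := by
  refine measurable_pi_lambda _ fun i => Int.measurable_floor.comp ?_
  fun_prop

theorem volume_box (a b : Fin d → ℝ) :
    volume {x : E d | ∀ i, a i ≤ x i ∧ x i < b i} = ∏ i, ENNReal.ofReal (b i - a i) := by
  have h : {x : E d | ∀ i, a i ≤ x i ∧ x i < b i} =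
      (WithLp.ofLp : E d → Fin d → ℝ) ⁻¹' (Set.univ.pi fun i => Set.Ico (a i) (b i)) := by
    ext x
    simp [Set.mem_pi]
  rw [h, (PiLp.volume_preserving_ofLp (Fin d)).measure_preimage
    (MeasurableSet.univ_pi fun i => measurableSet_Ico).nullMeasurableSet, volume_pi_pi]
  simp

/-- Each unit cell meets the set in a cube of side `δ`. This turns norms over the union of these
corner cubes into sequence norms, which is how lower bounds pass from functions to lattice
sequences. -/
theorem map_floorVec_restrict {δ : ℝ} (h1 : δ ≤ 1) :
    Measure.map floorVec (volume.restrict {x : E d | ∀ i, Int.fract (x i) < δ}) =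
      ENNReal.ofReal δ ^ d • Measure.count := by
  refine Measure.ext_of_singleton fun m => ?_
  rw [Measure.map_apply measurable_floorVec (measurableSet_singleton m),
    Measure.restrict_apply (measurable_floorVec (measurableSet_singleton m))]
  have : floorVec ⁻¹' {m} ∩ {x : E d | ∀ i, Int.fract (x i) < δ} =
      {x : E d | ∀ i, (m i : ℝ) ≤ x i ∧ x i < m i + δ} := by
    ext x
    simp only [Set.mem_inter_iff, Set.mem_preimage, Set.mem_singleton_iff, Set.mem_ofPred_eq,
      floorVec, funext_iff, ← forall_and]
    refine forall_congr' fun i => ?_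
    rw [Int.floor_eq_iff]
    constructor
    · rintro ⟨⟨h2, h3⟩, h4⟩
      have : ⌊x i⌋ = m i := Int.floor_eq_iff.2 ⟨h2, h3⟩
      rw [Int.fract, this] at h4
      exact ⟨h2, by linarith⟩
    · rintro ⟨h2, h3⟩
      have : ⌊x i⌋ = m i := Int.floor_eq_iff.2 ⟨h2, by linarith⟩
      rw [Int.fract, this]
      exact ⟨⟨h2, by linarith⟩, by linarith⟩
  rw [this, volume_box]
  simp

theorem map_floorVec : Measure.map floorVec (volume : Measure (E d)) = Measure.count := by
  have h := map_floorVec_restrict (d := d) (δ := 1) le_rfl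
  have h2 : {x : E d | ∀ i, Int.fract (x i) < (1 : ℝ)} = Set.univ := by
    ext x
    simp [Int.fract_lt_one]
  simpa [h2] using h

theorem eLpNorm_comp_floorVec {p : ℝ≥0∞} (h0 : p ≠ 0) (G : (Fin d → ℤ) → ℝ≥0∞) :
    eLpNorm (fun x : E d => G (floorVec x)) p volume = seqNorm p G := by
  rw [seqNorm_eq_eLpNorm h0, ← map_floorVec,
    eLpNorm_map_measure (measurable_of_countable G).aestronglyMeasurable
      measurable_floorVec.aemeasurable]
  rfl

theorem eLpNorm_comp_floorVec_restrict {p : ℝ≥0∞} (h0 : p ≠ 0) {δ : ℝ} (hδ : 0 < δ) (h1 : δ ≤ 1)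
    (G : (Fin d → ℤ) → ℝ≥0∞) :
    eLpNorm (fun x : E d => G (floorVec x)) p
        (volume.restrict {x : E d | ∀ i, Int.fract (x i) < δ}) =
      (ENNReal.ofReal δ ^ d) ^ (1 / p).toReal * seqNorm p G := by
  have hc : ENNReal.ofReal δ ^ d ≠ 0 := by
    simp [hδ]
  rw [seqNorm_eq_eLpNorm h0, ← smul_eq_mul, ← eLpNorm_smul_measure_of_ne_zero hc,
    ← map_floorVec_restrict h1,
    eLpNorm_map_measure (measurable_of_countable G).aestronglyMeasurable
      measurable_floorVec.aemeasurable]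
  rfl

/-! ### Oscillatory kernels -/

/-- The weight `(1 + |x|)^{-M}`. -/
noncomputable def weight (M : ℕ) (x : E d) : ℝ := ((1 + ‖x‖) ^ M)⁻¹

theorem weight_pos (M : ℕ) (x : E d) : 0 < weight M x := by
  unfold weight
  positivity

theorem weight_le_one (M : ℕ) (x : E d) : weight M x ≤ 1 := by
  unfold weight
  exact inv_le_one_of_one_le₀ (one_le_pow₀ (by linarith [norm_nonneg x]))

/-- All comparisons between weights at different points reduce to comparing `1 + |x|` with `1 +
|y|`. -/
theorem weight_le_of_one_add_le {M : ℕ} {x y : E d} {C : ℝ} (hC : 0 ≤ C)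
    (h : 1 + ‖x‖ ≤ C * (1 + ‖y‖)) : weight M y ≤ C ^ M * weight M x := by
  unfold weight
  rw [← div_eq_mul_inv, inv_le_comm₀ (by positivity), inv_div]
  · rw [div_le_iff₀' ?_, ← mul_pow]
    · gcongr
    · refine pow_pos (lt_of_le_of_ne hC ?_) M
      rintro rfl
      linarith [norm_nonneg x]
  · refine div_pos (pow_pos (lt_of_le_of_ne hC ?_) M) (by positivity)
    rintro rfl
    linarith [norm_nonneg x]

theorem weight_sub_le {M : ℕ} (x y : E d) : weight M (x - y) ≤ (1 + ‖y‖) ^ M * weight M x := by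
  refine weight_le_of_one_add_le (by positivity) ?_
  have : ‖x‖ ≤ ‖x - y‖ + ‖y‖ := by simpa using norm_add_le (x - y) y
  nlinarith [norm_nonneg (x - y), norm_nonneg y]

theorem weight_add (M N : ℕ) (x : E d) : weight (M + N) x = weight M x * weight N x := by
  simp [weight, pow_add, mul_comm]

theorem continuous_weight (M : ℕ) : Continuous (weight M : E d → ℝ) := by
  unfold weight
  exact Continuous.inv₀ (by fun_prop) fun x => by positivity

theorem integrable_weight {M : ℕ} (hM : d < M) : Integrable (weight M : E d → ℝ) := by
  have h := integrable_one_add_norm (E := E d) (μ := volume) (r := M) (by simpa using hM)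
  refine h.congr (Filter.Eventually.of_forall fun x => ?_)
  simp only [weight]
  rw [Real.rpow_neg (by positivity), Real.rpow_natCast]

theorem SchwartzMap.exists_norm_le_weight (f : 𝓢(E d, ℂ)) (M : ℕ) :
    ∃ C : ℝ, 0 ≤ C ∧ ∀ x, ‖f x‖ ≤ C * weight M x := by
  have h := f.one_add_le_sup_seminorm_apply (𝕜 := ℂ) (m := (M, 0)) (k := M) (n := 0) le_rfl le_rfl
  refine ⟨_, le_trans (by positivity) (h 0), fun x => ?_⟩
  unfold weight
  rw [← div_eq_mul_inv, le_div_iff₀' (by positivity)]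
  simpa using h x

theorem SchwartzMap.exists_norm_fderiv_le_weight (f : 𝓢(E d, ℂ)) (M : ℕ) :
    ∃ C : ℝ, 0 ≤ C ∧ ∀ x, ‖fderiv ℝ f x‖ ≤ C * weight M x := by
  have h := f.one_add_le_sup_seminorm_apply (𝕜 := ℂ) (m := (M, 1)) (k := M) (n := 1) le_rfl le_rfl
  refine ⟨_, le_trans (by positivity) (h 0), fun x => ?_⟩
  unfold weight
  rw [← div_eq_mul_inv, le_div_iff₀' (by positivity)]
  simpa [norm_iteratedFDeriv_one] using h x

theorem SchwartzMap.integrable_one_add_norm_pow_mul (f : 𝓢(E d, ℂ)) (M : ℕ) :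
    Integrable fun z => (1 + ‖z‖) ^ M * ‖f z‖ := by
  obtain ⟨C, -, hC⟩ := SchwartzMap.exists_norm_le_weight f (M + (d + 1))
  refine ((integrable_weight (d := d) (Nat.lt_succ_self d)).const_mul C).mono' ?_ ?_
  · exact (by fun_prop : Continuous fun z => (1 + ‖z‖) ^ M * ‖f z‖).aestronglyMeasurable
  · refine Filter.Eventually.of_forall fun z => ?_
    have h := hC z
    rw [weight_add] at h
    rw [Real.norm_of_nonneg (by positivity)]
    have h1 : (1 + ‖z‖) ^ M * weight M z = 1 := mul_inv_cancel₀ (by positivity)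
    calc (1 + ‖z‖) ^ M * ‖f z‖ ≤ (1 + ‖z‖) ^ M * (C * (weight M z * weight (d + 1) z)) := by gcongr
      _ = C * weight (d + 1) z * ((1 + ‖z‖) ^ M * weight M z) := by ring
      _ = _ := by rw [h1, mul_one]

/-- The inverse Fourier transform of `ζ ↦ X(ζ) Y(hζ + v)`. -/
noncomputable def oscKernel (X Y : 𝓢(E d, ℂ)) (h : ℝ) (v : E d) : E d → ℂ :=
  𝓕⁻ fun ζ : E d => X ζ * Y (h • ζ + v)

theorem oscKernel_eq_zero {X Y : 𝓢(E d, ℂ)} {h : ℝ} {v : E d}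
    (H : ∀ ζ, X ζ * Y (h • ζ + v) = 0) : oscKernel X Y h v = 0 := by
  ext x
  simp [oscKernel, Real.fourierInv_eq, H]

/-- Expand `Y` as the Fourier integral of `Y^∨` and exchange the integrals. The factor `Y(hζ + v)`
becomes a superposition of translates of `X^∨` by `hz`, which makes the limit of small `h` visible.
-/
theorem oscKernel_eq (X Y : 𝓢(E d, ℂ)) (h : ℝ) (v x : E d) :
    oscKernel X Y h v x = ∫ z, (Real.fourierChar (-inner ℝ z v) : ℂ) *
      ((𝓕⁻ X : 𝓢(E d, ℂ)) (x - h • z) * (𝓕⁻ Y : 𝓢(E d, ℂ)) z) := by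
  set ρ : 𝓢(E d, ℂ) := 𝓕⁻ Y with hρ
  have hY : ∀ w, Y w = ∫ z, (Real.fourierChar (-inner ℝ z w) : ℂ) * ρ z := by
    intro w
    have : Y = 𝓕 ρ := by simp [hρ]
    rw [this, SchwartzMap.fourier_coe, Real.fourier_eq]
    simp [Circle.smul_def]
  have hX : ∀ y, (𝓕⁻ X : 𝓢(E d, ℂ)) y = ∫ ζ, (Real.fourierChar (inner ℝ ζ y) : ℂ) * X ζ := by
    intro y
    rw [SchwartzMap.fourierInv_coe, Real.fourierInv_eq]
    simp [Circle.smul_def]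
  have hint : Integrable (fun w : E d × E d => (Real.fourierChar (inner ℝ w.1 x) : ℂ) *
      (Real.fourierChar (-inner ℝ w.2 (h • w.1 + v)) : ℂ) * (X w.1 * ρ w.2))
      (volume.prod volume) := by
    refine (X.integrable.mul_prod ρ.integrable).mono ?_ ?_
    · refine Continuous.aestronglyMeasurable ?_
      have := Real.continuous_fourierChar
      fun_prop
    · exact Filter.Eventually.of_forall fun w => by simp [Circle.norm_coe]
  calc oscKernel X Y h v x
      = ∫ ζ, ∫ z, (Real.fourierChar (inner ℝ ζ x) : ℂ) *
          (Real.fourierChar (-inner ℝ z (h • ζ + v)) : ℂ) * (X ζ * ρ z) := by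
        rw [oscKernel, Real.fourierInv_eq]
        refine integral_congr_ae (Filter.Eventually.of_forall fun ζ => ?_)
        simp only [Circle.smul_def, smul_eq_mul, hY, ← integral_const_mul]
        refine integral_congr_ae (Filter.Eventually.of_forall fun z => ?_)
        ring
    _ = ∫ z, ∫ ζ, (Real.fourierChar (inner ℝ ζ x) : ℂ) *
          (Real.fourierChar (-inner ℝ z (h • ζ + v)) : ℂ) * (X ζ * ρ z) :=
        integral_integral_swap hint
    _ = _ := by
        refine integral_congr_ae (Filter.Eventually.of_forall fun z => ?_)
        simp only [hX]
        rw [mul_comm (∫ ζ, _) (ρ z), ← mul_assoc, ← integral_const_mul]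
        refine integral_congr_ae (Filter.Eventually.of_forall fun ζ => ?_)
        have : (Real.fourierChar (inner ℝ ζ x) : ℂ) *
            (Real.fourierChar (-inner ℝ z (h • ζ + v)) : ℂ) =
            (Real.fourierChar (-inner ℝ z v) : ℂ) *
              (Real.fourierChar (inner ℝ ζ (x - h • z)) : ℂ) := by
          rw [← Circle.coe_mul, ← Circle.coe_mul, ← AddChar.map_add_eq_mul,
            ← AddChar.map_add_eq_mul]
          congr 2
          rw [inner_sub_right, inner_add_right, inner_smul_right, inner_smul_right,
            real_inner_comm ζ z]
          ring
        simp only [this]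
        ring

theorem norm_one_add_smul_le {h : ℝ} (h0 : 0 ≤ h) (h1 : h ≤ 1) (z : E d) :
    1 + ‖h • z‖ ≤ 1 + ‖z‖ := by
  rw [norm_smul, Real.norm_of_nonneg h0]
  nlinarith [norm_nonneg z]

/-- For small `h` the kernel is close to `Y(v) X^∨`, with rapidly decaying error. -/
theorem exists_norm_oscKernel_sub_le (X Y : 𝓢(E d, ℂ)) (M : ℕ) :
    ∃ C : ℝ, 0 ≤ C ∧ ∀ h : ℝ, 0 ≤ h → h ≤ 1 → ∀ v x : E d,
      ‖oscKernel X Y h v x - Y v * (𝓕⁻ X : 𝓢(E d, ℂ)) x‖ ≤ C * h * weight M x := by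
  set Φ : 𝓢(E d, ℂ) := 𝓕⁻ X with hΦ
  set ρ : 𝓢(E d, ℂ) := 𝓕⁻ Y with hρ
  obtain ⟨C, hC0, hC⟩ := SchwartzMap.exists_norm_fderiv_le_weight Φ M
  have hI := SchwartzMap.integrable_one_add_norm_pow_mul ρ (M + 1)
  refine ⟨C * ∫ z, (1 + ‖z‖) ^ (M + 1) * ‖ρ z‖,
    mul_nonneg hC0 (integral_nonneg fun z => by positivity), fun h h0 h1 v x => ?_⟩
  have hY : Y v = ∫ z, (Real.fourierChar (-inner ℝ z v) : ℂ) * ρ z := by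
    have : Y = 𝓕 ρ := by simp [hρ]
    rw [this, SchwartzMap.fourier_coe, Real.fourier_eq]
    simp [Circle.smul_def]
  -- Mean value inequality along the segment from `x` to `x - hz`. Moving the weight from a point of
  -- the segment back to `x` costs `(1 + |z|)^M`, which the decay of `Y^∨` absorbs.
  have hdiff : ∀ z, ‖Φ (x - h • z) - Φ x‖ ≤ C * h * weight M x * (1 + ‖z‖) ^ (M + 1) := by
    intro z
    have hseg : ∀ y ∈ segment ℝ x (x - h • z), ‖fderiv ℝ Φ y‖ ≤ C * ((1 + ‖z‖) ^ M * weight M x) := by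
      intro y hy
      rw [segment_eq_image'] at hy
      obtain ⟨θ, ⟨hθ0, hθ1⟩, rfl⟩ := hy
      refine (hC _).trans (mul_le_mul_of_nonneg_left ?_ hC0)
      have e : x + θ • (x - h • z - x) = x - (θ * h) • z := by
        rw [mul_smul]; simp [sub_eq_add_neg]
      simp only [e]
      refine (weight_sub_le _ _).trans ?_
      have := norm_one_add_smul_le (mul_nonneg hθ0 h0) (mul_le_one₀ hθ1 h0 h1) z
      have := weight_pos M x
      gcongr ?_ ^ M * _
    have := (convex_segment x (x - h • z)).norm_image_sub_le_of_norm_fderiv_le (𝕜 := ℝ)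
      (f := Φ) (fun y _ => Φ.differentiableAt) hseg
      (left_mem_segment ℝ _ _) (right_mem_segment ℝ _ _)
    refine this.trans ?_
    have e : ‖x - h • z - x‖ = h * ‖z‖ := by
      rw [show x - h • z - x = -(h • z) by abel, norm_neg, norm_smul, Real.norm_of_nonneg h0]
    rw [e, pow_succ]
    have := weight_pos M x
    calc C * ((1 + ‖z‖) ^ M * weight M x) * (h * ‖z‖)
        ≤ C * ((1 + ‖z‖) ^ M * weight M x) * (h * (1 + ‖z‖)) := by gcongr; linarith
      _ = _ := by ring
  have hmeas : Continuous fun z : E d => (Real.fourierChar (-inner ℝ z v) : ℂ) *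
      ((Φ (x - h • z) - Φ x) * ρ z) := by
    have := Real.continuous_fourierChar
    fun_prop
  have hbound : ∀ z, ‖(Real.fourierChar (-inner ℝ z v) : ℂ) * ((Φ (x - h • z) - Φ x) * ρ z)‖ ≤
      C * h * weight M x * ((1 + ‖z‖) ^ (M + 1) * ‖ρ z‖) := by
    intro z
    rw [norm_mul, norm_mul, Circle.norm_coe, one_mul, ← mul_assoc]
    gcongr
    exact hdiff z
  have hint : Integrable fun z : E d => (Real.fourierChar (-inner ℝ z v) : ℂ) *
      ((Φ (x - h • z) - Φ x) * ρ z) :=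
    (hI.const_mul (C * h * weight M x)).mono' hmeas.aestronglyMeasurable
      (Filter.Eventually.of_forall hbound)
  have hint2 : Integrable fun z : E d => (Real.fourierChar (-inner ℝ z v) : ℂ) * ρ z := by
    refine ρ.integrable.mono ?_ (Filter.Eventually.of_forall fun z => by simp [Circle.norm_coe])
    have := Real.continuous_fourierChar
    exact (by fun_prop : Continuous fun z : E d => (Real.fourierChar (-inner ℝ z v) : ℂ) * ρ z).aestronglyMeasurable
  have key : oscKernel X Y h v x - Y v * Φ x = ∫ z, (Real.fourierChar (-inner ℝ z v) : ℂ) *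
      ((Φ (x - h • z) - Φ x) * ρ z) := by
    rw [oscKernel_eq, hY, mul_comm (∫ z, _) (Φ x), sub_eq_iff_eq_add, ← integral_const_mul,
      ← integral_add hint (hint2.const_mul _)]
    refine integral_congr_ae (Filter.Eventually.of_forall fun z => ?_)
    ring
  rw [key]
  calc _ ≤ ∫ z, C * h * weight M x * ((1 + ‖z‖) ^ (M + 1) * ‖ρ z‖) :=
        norm_integral_le_of_norm_le (hI.const_mul _) (Filter.Eventually.of_forall hbound)
    _ = _ := by rw [integral_const_mul]; ring

/-- The kernels decay rapidly, uniformly in the parameters. -/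
theorem exists_norm_oscKernel_le (X Y : 𝓢(E d, ℂ)) (M : ℕ) :
    ∃ C : ℝ, 0 ≤ C ∧ ∀ h : ℝ, 0 ≤ h → h ≤ 1 → ∀ v x : E d,
      ‖oscKernel X Y h v x‖ ≤ C * weight M x := by
  obtain ⟨C, hC0, hC⟩ := exists_norm_oscKernel_sub_le X Y M
  obtain ⟨A, hA0, hA⟩ := SchwartzMap.exists_norm_le_weight Y 0
  obtain ⟨B, hB0, hB⟩ := SchwartzMap.exists_norm_le_weight (𝓕⁻ X : 𝓢(E d, ℂ)) M
  refine ⟨C + A * B, by positivity, fun h h0 h1 v x => ?_⟩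
  have hw := weight_pos M x
  have h2 : ‖Y v * (𝓕⁻ X : 𝓢(E d, ℂ)) x‖ ≤ A * (B * weight M x) := by
    rw [norm_mul]
    have := hA v
    simp only [weight, pow_zero, inv_one, mul_one] at this
    gcongr
    exact hB x
  have h3 : C * h * weight M x ≤ C * weight M x := by
    gcongr
    nlinarith
  have := norm_le_norm_sub_add (oscKernel X Y h v x) (Y v * (𝓕⁻ X : 𝓢(E d, ℂ)) x)
  linarith [hC h h0 h1 v x]

/-! ### Wave packets -/

/-- A lattice point as a vector. -/
noncomputable def latticePoint (n : Fin d → ℤ) : E d := WithLp.toLp 2 fun i => (n i : ℝ)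

@[simp]
theorem latticePoint_apply (n : Fin d → ℤ) (i : Fin d) : latticePoint n i = n i := rfl

theorem latticePoint_add (m n : Fin d → ℤ) :
    latticePoint (m + n) = latticePoint m + latticePoint n := by
  ext i
  simp

theorem latticePoint_sub (m n : Fin d → ℤ) :
    latticePoint (m - n) = latticePoint m - latticePoint n := by
  ext i
  simp

/-- The trigonometric sum `∑ a(n) e(-⟨n, ζ⟩)`. -/
noncomputable def trigSum (a : (Fin d → ℤ) →₀ ℂ) (ζ : E d) : ℂ :=
  Finsupp.linearCombination ℂ
    (fun n : Fin d → ℤ => (Real.fourierChar (-inner ℝ (latticePoint n) ζ) : ℂ)) a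

theorem trigSum_eq_sum (a : (Fin d → ℤ) →₀ ℂ) (ζ : E d) :
    trigSum a ζ =
      ∑ n ∈ a.support, a n * (Real.fourierChar (-inner ℝ (latticePoint n) ζ) : ℂ) := by
  simp [trigSum, Finsupp.linearCombination_apply, Finsupp.sum]

theorem continuous_trigSum (a : (Fin d → ℤ) →₀ ℂ) : Continuous (trigSum a : E d → ℂ) := by
  simp only [funext (trigSum_eq_sum a)]
  have := Real.continuous_fourierChar
  fun_prop

/-- Convolution on the lattice. -/
noncomputable def latticeConv (κ a : (Fin d → ℤ) →₀ ℂ) : (Fin d → ℤ) →₀ ℂ :=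
  κ.sum fun r c => c • a.mapDomain (r + ·)

theorem latticeConv_apply (κ a : (Fin d → ℤ) →₀ ℂ) (n : Fin d → ℤ) :
    latticeConv κ a n = ∑ r ∈ κ.support, κ r * a (n - r) := by
  rw [latticeConv, Finsupp.sum, Finsupp.finsetSum_apply]
  refine Finset.sum_congr rfl fun r _ => ?_
  rw [Finsupp.smul_apply, smul_eq_mul]
  congr 1
  have h := Finsupp.mapDomain_apply (add_right_injective r) a (n - r)
  rwa [add_sub_cancel] at h

@[simp]
theorem latticeConv_zero_right (κ : (Fin d → ℤ) →₀ ℂ) : latticeConv κ 0 = 0 := by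
  simp [latticeConv]

theorem trigSum_latticeConv (κ a : (Fin d → ℤ) →₀ ℂ) (ζ : E d) :
    trigSum (latticeConv κ a) ζ = trigSum κ ζ * trigSum a ζ := by
  rw [trigSum_eq_sum κ, Finset.sum_mul, latticeConv, Finsupp.sum, trigSum, map_sum]
  refine Finset.sum_congr rfl fun r _ => ?_
  rw [map_smul, Finsupp.linearCombination_mapDomain, smul_eq_mul, mul_assoc, trigSum,
    Finsupp.linearCombination_apply, Finsupp.linearCombination_apply, Finsupp.sum, Finsupp.sum]
  congr 1
  rw [Finset.mul_sum]
  refine Finset.sum_congr rfl fun n _ => ?_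
  simp only [Function.comp_apply, smul_eq_mul]
  rw [latticePoint_add, inner_add_left, neg_add, AddChar.map_add_eq_mul, Circle.coe_mul]
  ring

/-- The function `ξ ↦ e(-⟨n, ξ - c⟩) X(ξ - c)`. -/
noncomputable def atomHat (X : 𝓢(E d, ℂ)) (c : E d) (n : Fin d → ℤ) : 𝓢(E d, ℂ) :=
  (𝓕 ((𝓕⁻ X : 𝓢(E d, ℂ)).compSubConstCLM ℂ (latticePoint n)) : 𝓢(E d, ℂ)).compSubConstCLM ℂ c

theorem atomHat_apply (X : 𝓢(E d, ℂ)) (c : E d) (n : Fin d → ℤ) (ξ : E d) :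
    atomHat X c n ξ =
      (Real.fourierChar (-inner ℝ (latticePoint n) (ξ - c)) : ℂ) * X (ξ - c) := by
  rw [atomHat, SchwartzMap.compSubConstCLM_apply, SchwartzMap.fourier_coe, Real.fourier_eq]
  simp only [SchwartzMap.compSubConstCLM_apply]
  rw [← integral_add_right_eq_self _ (latticePoint n)]
  simp only [add_sub_cancel_right, inner_add_left, neg_add, AddChar.map_add_eq_mul]
  have h : X (ξ - c) = ∫ y, Real.fourierChar (-inner ℝ y (ξ - c)) • (𝓕⁻ X : 𝓢(E d, ℂ)) y := by
    have h1 : X = 𝓕 (𝓕⁻ X : 𝓢(E d, ℂ)) := by simp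
    conv_lhs => rw [h1]
    rw [SchwartzMap.fourier_coe, Real.fourier_eq]
  rw [h, ← integral_const_mul]
  refine integral_congr_ae (Filter.Eventually.of_forall fun y => ?_)
  simp only [Circle.smul_def, Circle.coe_mul, smul_eq_mul]
  ring

/-- The Schwartz function with values `∑_{j ∈ s} â_j(ξ - c_j) X(ξ - c_j)`, where `â_j` is the
trigonometric sum with coefficients `a_j`. -/
noncomputable def packetHat {ι : Type} (X : 𝓢(E d, ℂ)) (c : ι → E d) (s : Finset ι)
    (a : ι → (Fin d → ℤ) →₀ ℂ) : 𝓢(E d, ℂ) :=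
  ∑ j ∈ s, ∑ n ∈ (a j).support, a j n • atomHat X (c j) n

theorem packetHat_apply {ι : Type} (X : 𝓢(E d, ℂ)) (c : ι → E d) (s : Finset ι)
    (a : ι → (Fin d → ℤ) →₀ ℂ) (ξ : E d) :
    packetHat X c s a ξ = ∑ j ∈ s, trigSum (a j) (ξ - c j) * X (ξ - c j) := by
  simp only [packetHat, sum_apply, smul_apply, atomHat_apply,
    trigSum_eq_sum, Finset.sum_mul, smul_eq_mul, mul_assoc]

/-! ### Littlewood-Paley pieces of wave packets -/

theorem fourier_dilate (ϕ : 𝓢(E d, ℂ)) (k : ℤ) (ξ : E d) :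
    (𝓕 (dilate ϕ k) : 𝓢(E d, ℂ)) ξ = (𝓕 ϕ : 𝓢(E d, ℂ)) ((2 : ℝ) ^ (-k) • ξ) := by
  rw [SchwartzMap.fourier_coe, SchwartzMap.fourier_coe, Real.fourier_eq, Real.fourier_eq]
  have h2 : ((2 : ℝ) ^ k) ≠ 0 := zpow_ne_zero _ two_ne_zero
  have h := Measure.integral_comp_smul (volume : Measure (E d))
    (fun z : E d => Real.fourierChar (-inner ℝ z ((2 : ℝ) ^ (-k) • ξ)) • ϕ z) ((2 : ℝ) ^ k)
  have h3 : ∀ z : E d, inner ℝ ((2 : ℝ) ^ k • z) ((2 : ℝ) ^ (-k) • ξ) = inner ℝ z ξ := by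
    intro z
    rw [inner_smul_left, inner_smul_right, zpow_neg]
    simp [h2]
  simp only [h3] at h
  simp only [dilate_apply, Circle.smul_def, smul_eq_mul] at h ⊢
  simp only [mul_left_comm _ ((2 : ℂ) ^ (k * (d : ℤ)))]
  rw [integral_const_mul, h]
  rw [finrank_euclideanSpace_fin, abs_of_nonneg (by positivity), Complex.real_smul, ← mul_assoc]
  have : (2 : ℂ) ^ (k * (d : ℤ)) * (((((2 : ℝ) ^ k) ^ d)⁻¹ : ℝ) : ℂ) = 1 := by
    rw [zpow_mul]
    push_cast
    rw [zpow_natCast]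
    exact mul_inv_cancel₀ (pow_ne_zero _ (zpow_ne_zero _ two_ne_zero))
  rw [this, one_mul]

theorem lpPiece_schwartz (ϕ g : 𝓢(E d, ℂ)) (k : ℤ) (x : E d) :
    lpPiece ϕ k (SchwartzMap.toTemperedDistributionCLM (E d) ℂ volume g) x =
      ∫ y, reflectTranslate (dilate ϕ k) x y * g y :=
  SchwartzMap.toTemperedDistributionCLM_apply_apply volume g _

theorem lpPiece_fourierInv (ϕ G : 𝓢(E d, ℂ)) (k : ℤ) (x : E d) :
    lpPiece ϕ k (SchwartzMap.toTemperedDistributionCLM (E d) ℂ volume (𝓕⁻ G : 𝓢(E d, ℂ))) x =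
      ∫ ξ, (Real.fourierChar (inner ℝ ξ x) : ℂ) *
        ((𝓕 ϕ : 𝓢(E d, ℂ)) ((2 : ℝ) ^ (-k) • ξ) * G ξ) := by
  rw [lpPiece_schwartz, ← SchwartzMap.integral_fourierInv_mul_eq]
  refine integral_congr_ae (Filter.Eventually.of_forall fun ξ => ?_)
  simp only
  rw [← mul_assoc]
  congr 1
  rw [← fourier_dilate, SchwartzMap.fourierInv_coe, Real.fourierInv_eq, SchwartzMap.fourier_coe,
    Real.fourier_eq, ← integral_const_mul, ← integral_sub_left_eq_self _ volume x]
  refine integral_congr_ae (Filter.Eventually.of_forall fun y => ?_)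
  simp only [reflectTranslate_apply, sub_sub_cancel, Circle.smul_def, smul_eq_mul]
  rw [← mul_assoc, ← Circle.coe_mul, ← AddChar.map_add_eq_mul, inner_sub_left,
    real_inner_comm x ξ]
  rfl

/-- Recentring the frequency integral at `c` extracts the unimodular factor `e(⟨c, x⟩)`. The
character of the atom becomes translation by the lattice point. -/
theorem lpPiece_atom (ϕ X : 𝓢(E d, ℂ)) (c : E d) (n : Fin d → ℤ) (k : ℤ) (x : E d) :
    lpPiece ϕ k (SchwartzMap.toTemperedDistributionCLM (E d) ℂ volume
        (𝓕⁻ (atomHat X c n) : 𝓢(E d, ℂ))) x =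
      (Real.fourierChar (inner ℝ c x) : ℂ) *
        oscKernel X (𝓕 ϕ) ((2 : ℝ) ^ (-k)) ((2 : ℝ) ^ (-k) • c) (x - latticePoint n) := by
  rw [lpPiece_fourierInv, ← integral_add_right_eq_self _ c, oscKernel, Real.fourierInv_eq,
    ← integral_const_mul]
  refine integral_congr_ae (Filter.Eventually.of_forall fun ζ => ?_)
  simp only [atomHat_apply, add_sub_cancel_right, smul_add, Circle.smul_def, smul_eq_mul]
  have : (Real.fourierChar (inner ℝ (ζ + c) x) : ℂ) *
      (Real.fourierChar (-inner ℝ (latticePoint n) ζ) : ℂ) =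
      (Real.fourierChar (inner ℝ c x) : ℂ) *
        (Real.fourierChar (inner ℝ ζ (x - latticePoint n)) : ℂ) := by
    rw [← Circle.coe_mul, ← Circle.coe_mul, ← AddChar.map_add_eq_mul,
      ← AddChar.map_add_eq_mul, inner_add_left, inner_sub_right, real_inner_comm ζ]
    congr 2
    ring
  linear_combination X ζ * (𝓕 ϕ : 𝓢(E d, ℂ)) ((2 : ℝ) ^ (-k) • ζ + (2 : ℝ) ^ (-k) • c) * this

theorem lpPiece_packet {ι : Type} (ϕ X : 𝓢(E d, ℂ)) (c : ι → E d) (s : Finset ι)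
    (a : ι → (Fin d → ℤ) →₀ ℂ) (k : ℤ) (x : E d) :
    lpPiece ϕ k (SchwartzMap.toTemperedDistributionCLM (E d) ℂ volume
        (𝓕⁻ (packetHat X c s a) : 𝓢(E d, ℂ))) x =
      ∑ j ∈ s, ∑ n ∈ (a j).support, a j n * ((Real.fourierChar (inner ℝ (c j) x) : ℂ) *
        oscKernel X (𝓕 ϕ) ((2 : ℝ) ^ (-k)) ((2 : ℝ) ^ (-k) • c j) (x - latticePoint n)) := by
  have hlin : ∀ G : 𝓢(E d, ℂ), lpPiece ϕ k (SchwartzMap.toTemperedDistributionCLM (E d) ℂ volume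
      (𝓕⁻ G : 𝓢(E d, ℂ))) x = ((SchwartzMap.integralCLM ℂ volume) ∘L
        (SchwartzMap.pairing (ContinuousLinearMap.mul ℂ ℂ)
          (reflectTranslate (dilate ϕ k) x))) ((FourierTransform.fourierInvCLM ℂ 𝓢(E d, ℂ)) G) := by
    intro G
    rw [lpPiece_schwartz]
    simp
  rw [hlin, packetHat]
  simp only [map_sum, map_smul]
  simp only [← hlin, lpPiece_atom, smul_eq_mul]

/-! ### Multiplier operators on wave packets -/

theorem multiplierOp_eq {m : Lp ℂ ∞ (volume : Measure (E d))} {f G : 𝓢(E d, ℂ)}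
    (h : ∀ᵐ ξ : E d, m ξ * (𝓕 f : 𝓢(E d, ℂ)) ξ = G ξ) :
    multiplierOp m f =
      SchwartzMap.toTemperedDistributionCLM (E d) ℂ volume (𝓕⁻ G : 𝓢(E d, ℂ)) := by
  have h1 : (m • (𝓕 f : 𝓢(E d, ℂ)).toLp 2 volume : Lp ℂ 2 (volume : Measure (E d))) =
      G.toLp 2 volume := by
    refine Lp.ext ?_
    filter_upwards [h, Lp.coeFn_lpSMul m ((𝓕 f : 𝓢(E d, ℂ)).toLp 2 volume) (r := 2),
      (𝓕 f : 𝓢(E d, ℂ)).coeFn_toLp 2 volume, G.coeFn_toLp 2 volume] with ξ h1 h2 h3 h4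
    rw [h2, h4, Pi.smul_apply', h3, smul_eq_mul, h1]
  rw [multiplierOp, h1, Lp.toTemperedDistribution_toLp_eq,
    TemperedDistribution.fourierInv_toTemperedDistributionCLM_eq]

/-- Multiplication by a coordinate is, up to a nonzero constant, a derivative on the Fourier side,
and derivatives preserve vanishing near the origin. -/
theorem exists_coord_mul {f : 𝓢(E d, ℂ)} (h : (𝓕 f : 𝓢(E d, ℂ)) =ᶠ[nhds 0] 0) (i : Fin d) :
    ∃ g : 𝓢(E d, ℂ), (𝓕 g : 𝓢(E d, ℂ)) =ᶠ[nhds 0] 0 ∧ ∀ x, g x = (x i : ℂ) * f x := by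
  set e : E d := EuclideanSpace.single i 1
  have hg : ∀ x, SchwartzMap.smulLeftCLM ℂ (inner ℝ · e) f x = (x i : ℂ) * f x := by
    intro x
    rw [SchwartzMap.smulLeftCLM_apply_apply (by fun_prop)]
    simp [e, EuclideanSpace.inner_single_right]
  refine ⟨SchwartzMap.smulLeftCLM ℂ (inner ℝ · e) f, ?_, hg⟩
  have h1 := SchwartzMap.lineDerivOp_fourier_eq f e
  have hc : -(2 * Real.pi * Complex.I) ≠ 0 := by simp [Real.pi_ne_zero]
  have h2 : ⇑(LineDeriv.lineDerivOp e (𝓕 f : 𝓢(E d, ℂ)) : 𝓢(E d, ℂ)) =ᶠ[nhds (0 : E d)] 0 := by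
    filter_upwards [h.fderiv (𝕜 := ℝ)] with x hx
    rw [SchwartzMap.lineDerivOp_apply_eq_fderiv, hx]
    simp
  rw [h1] at h2
  filter_upwards [h2] with x hx
  rw [FourierTransform.fourier_smul, smul_apply] at hx
  simpa [Real.pi_ne_zero] using hx

theorem exists_coord_pow_mul {f : 𝓢(E d, ℂ)} (h : (𝓕 f : 𝓢(E d, ℂ)) =ᶠ[nhds 0] 0) (i : Fin d)
    (n : ℕ) :
    ∃ g : 𝓢(E d, ℂ), (𝓕 g : 𝓢(E d, ℂ)) =ᶠ[nhds 0] 0 ∧ ∀ x, g x = (x i : ℂ) ^ n * f x := by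
  induction n with
  | zero => exact ⟨f, h, by simp⟩
  | succ n ih =>
    obtain ⟨g, hg, hgf⟩ := ih
    obtain ⟨g', hg', hgf'⟩ := exists_coord_mul hg i
    exact ⟨g', hg', fun x => by rw [hgf', hgf]; ring⟩

/-- A Schwartz function whose Fourier transform vanishes near the origin has vanishing moments. -/
theorem hasVanishingMoments_of_fourier_eventually_eq_zero {f : 𝓢(E d, ℂ)}
    (h : (𝓕 f : 𝓢(E d, ℂ)) =ᶠ[nhds 0] 0) : HasVanishingMoments f := by
  classical
  intro γ
  have key : ∀ s : Finset (Fin d), ∃ g : 𝓢(E d, ℂ), (𝓕 g : 𝓢(E d, ℂ)) =ᶠ[nhds 0] 0 ∧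
      ∀ x, g x = (∏ i ∈ s, (x i : ℂ) ^ γ i) * f x := by
    intro s
    induction s using Finset.induction_on with
    | empty => exact ⟨f, h, by simp⟩
    | insert i s hi ih =>
      obtain ⟨g, hg, hgf⟩ := ih
      obtain ⟨g', hg', hgf'⟩ := exists_coord_pow_mul hg i (γ i)
      exact ⟨g', hg', fun x => by rw [hgf', hgf, Finset.prod_insert hi, mul_assoc]⟩
  obtain ⟨g, hg, hgf⟩ := key Finset.univ
  have h0 := hg.self_of_nhds
  rw [SchwartzMap.fourier_coe, Real.fourier_eq] at h0
  simp only [inner_zero_right, neg_zero, AddChar.map_zero_eq_one, one_smul, hgf] at h0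
  simpa using h0

/-! ### Lattice sums -/

theorem norm_le_of_forall_abs_le {x : E d} {δ : ℝ} (h0 : 0 ≤ δ) (h : ∀ i, |x i| ≤ δ) :
    ‖x‖ ≤ d * δ := by
  rw [EuclideanSpace.norm_eq, Real.sqrt_le_left (by positivity)]
  calc ∑ i, ‖x i‖ ^ 2 ≤ ∑ _i : Fin d, δ ^ 2 := by
        gcongr with i
        exact h i
    _ = d * δ ^ 2 := by simp
    _ ≤ (d * δ) ^ 2 := by
        rw [mul_pow]
        gcongr
        rcases Nat.eq_zero_or_pos d with rfl | hd
        · simp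
        · exact_mod_cast Nat.le_self_pow two_ne_zero d

theorem norm_sub_floorVec_le (x : E d) : ‖x - latticePoint (floorVec x)‖ ≤ d := by
  have := norm_le_of_forall_abs_le (x := x - latticePoint (floorVec x)) zero_le_one fun i => by
    simp only [PiLp.sub_apply, latticePoint_apply, floorVec]
    rw [abs_of_nonneg (by linarith [Int.floor_le (x i)])]
    linarith [Int.lt_floor_add_one (x i)]
  simpa using this

/-- Rounding to the lattice moves a point by at most `d`, so weights are constant on unit cells up
to a fixed factor. -/
theorem weight_sub_floorVec_le (M : ℕ) (x y : E d) :
    weight M (x - y) ≤ (1 + d) ^ M * weight M (latticePoint (floorVec x) - y) := by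
  refine weight_le_of_one_add_le (by positivity) ?_
  have h := norm_sub_floorVec_le x
  have h2 : ‖latticePoint (floorVec x) - y‖ ≤ ‖x - y‖ + ‖x - latticePoint (floorVec x)‖ := by
    rw [show latticePoint (floorVec x) - y = (x - y) - (x - latticePoint (floorVec x)) by abel]
    exact norm_sub_le _ _
  nlinarith [norm_nonneg (x - y), (Nat.cast_nonneg d : (0 : ℝ) ≤ d)]

theorem weight_floorVec_sub_le (M : ℕ) (x y : E d) :
    weight M (latticePoint (floorVec x) - y) ≤ (1 + d) ^ M * weight M (x - y) := by
  refine weight_le_of_one_add_le (by positivity) ?_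
  have h := norm_sub_floorVec_le x
  have h2 : ‖x - y‖ ≤ ‖latticePoint (floorVec x) - y‖ + ‖x - latticePoint (floorVec x)‖ := by
    rw [show x - y = (latticePoint (floorVec x) - y) + (x - latticePoint (floorVec x)) by abel]
    exact norm_add_le _ _
  nlinarith [norm_nonneg (latticePoint (floorVec x) - y), (Nat.cast_nonneg d : (0 : ℝ) ≤ d)]

/-- The sum is the integral of a step function, constant on unit cells, which is dominated by a
multiple of the integrable weight. -/
theorem tsum_weight_latticePoint_ne_top {M : ℕ} (hM : d < M) :
    ∑' n : Fin d → ℤ, ENNReal.ofReal (weight M (latticePoint n)) ≠ ∞ := by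
  have h := eLpNorm_comp_floorVec (d := d) one_ne_zero
    fun n => ENNReal.ofReal (weight M (latticePoint n))
  rw [seqNorm_of_ne_top ENNReal.one_ne_top, eLpNorm_one_eq_lintegral_enorm] at h
  simp only [enorm_eq_self, ENNReal.toReal_one, ENNReal.rpow_one, div_one] at h
  rw [← h]
  refine ne_top_of_le_ne_top ?_ (lintegral_mono fun x => ENNReal.ofReal_le_ofReal
    (by simpa using weight_floorVec_sub_le M x 0))
  exact ((integrable_weight hM).const_mul _).lintegral_lt_top.ne

/-- Convolution with a summable lattice kernel is bounded on sequence spaces. -/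
theorem seqNorm_lattice_conv_le {p : ℝ≥0∞} (h1 : 1 ≤ p) (W B : (Fin d → ℤ) → ℝ≥0∞) :
    seqNorm p (fun m => ∑' n, W (m - n) * B n) ≤ (∑' r, W r) * seqNorm p B := by
  have h0 : p ≠ 0 := (zero_lt_one.trans_le h1).ne'
  have h : ∀ m, ∑' n, W (m - n) * B n = ∑' r, W r * B (m - r) := by
    intro m
    rw [← (Equiv.subLeft m).tsum_eq]
    simp
  simp only [h]
  refine (seqNorm_tsum_le h1 _).trans ?_
  rw [← ENNReal.tsum_mul_right]
  refine ENNReal.tsum_le_tsum fun r => ?_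
  rw [seqNorm_const_mul h0]
  exact mul_le_mul_right (seqNorm_comp_equiv B (Equiv.subRight r)).le _

/-- Injectivity of `σ` leaves at most one term for each `k`. It is applied to `σ j = b_j + i`, the
index of a Littlewood-Paley piece at fixed offset `i` from block `j`. -/
theorem seqNorm_sum_ite_le {ι κ : Type} [DecidableEq κ] {q : ℝ≥0∞} (h0 : q ≠ 0) {σ : ι → κ}
    (hσ : Function.Injective σ) (s : Finset ι) (x : ι → ℝ≥0∞) :
    seqNorm q (fun k => ∑ j ∈ s, if k = σ j then x j else 0) ≤ seqNorm q x := by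
  classical
  rw [seqNorm_eq_comp_of_support h0 _ hσ]
  · refine seqNorm_mono fun j => ?_
    simp only [hσ.eq_iff]
    rw [Finset.sum_ite_eq]
    split_ifs <;> simp
  · intro k hk
    refine Finset.sum_eq_zero fun j _ => if_neg ?_
    rintro rfl
    exact hk ⟨j, rfl⟩

/-! ### A well localized window -/

theorem one_le_norm_latticePoint {r : Fin d → ℤ} (hr : r ≠ 0) : 1 ≤ ‖latticePoint r‖ := by
  obtain ⟨i, hi⟩ := Function.ne_iff.1 hr
  calc (1 : ℝ) ≤ |(r i : ℝ)| := by exact_mod_cast Int.one_le_abs hi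
    _ ≤ _ := PiLp.norm_apply_le (latticePoint r) i

/-- A smooth cutoff function at scale `R`, as a Schwartz function. -/
theorem exists_schwartz_cutoff {R : ℝ} (hR : 0 < R) :
    ∃ X : 𝓢(E d, ℂ), (∀ ζ, ‖ζ‖ ≤ R → X ζ = 1) ∧ (∀ ζ, X ζ ≠ 0 → ‖ζ‖ < 2 * R) ∧
      (∀ ζ, ‖X ζ‖ ≤ 1) ∧ (𝓕⁻ X : 𝓢(E d, ℂ)) 0 ≠ 0 := by
  let χ : ContDiffBump (0 : E d) := ⟨R, 2 * R, hR, by linarith⟩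
  have hc : HasCompactSupport fun ζ => (χ ζ : ℂ) := χ.hasCompactSupport.comp_left Complex.ofReal_zero
  have hs : ContDiff ℝ (⊤ : ℕ∞) fun ζ => (χ ζ : ℂ) := Complex.ofRealCLM.contDiff.comp χ.contDiff
  refine ⟨hc.toSchwartzMap hs, fun ζ hζ => ?_, fun ζ hζ => ?_, fun ζ => ?_, ?_⟩
  · have : χ ζ = 1 := χ.one_of_mem_closedBall (by simpa using hζ)
    simp [this]
  · by_contra h
    refine hζ ?_
    have : χ ζ = 0 := χ.zero_of_le_dist (by simpa using not_lt.1 h)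
    simp [this]
  · simp only [HasCompactSupport.toSchwartzMap_toFun, Complex.norm_real,
      Real.norm_of_nonneg χ.nonneg]
    exact χ.le_one
  · rw [SchwartzMap.fourierInv_coe, Real.fourierInv_eq]
    simp only [inner_zero_right, AddChar.map_zero_eq_one, one_smul,
      HasCompactSupport.toSchwartzMap_toFun]
    rw [integral_complex_ofReal]
    exact_mod_cast (χ.integral_pos (μ := volume)).ne'

/-- There is a band-limited Schwartz function which is bounded below near the origin and whose
translates by nonzero lattice points are small there. -/
theorem exists_window {η : ℝ} (hη : 0 < η) (M : ℕ) (hM : 1 ≤ M) :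
    ∃ (X : 𝓢(E d, ℂ)) (R δ : ℝ), 0 < R ∧ 0 < δ ∧ δ * d ≤ 1 / 2 ∧ (∀ ζ, X ζ ≠ 0 → ‖ζ‖ ≤ R) ∧
      ∀ y : E d, (∀ i, 0 ≤ y i ∧ y i < δ) → 1 ≤ ‖(𝓕⁻ X : 𝓢(E d, ℂ)) y‖ ∧
        ∀ r : Fin d → ℤ, r ≠ 0 →
          ‖(𝓕⁻ X : 𝓢(E d, ℂ)) (y + latticePoint r)‖ ≤ η * weight M (latticePoint r) := by
  obtain ⟨X₁, -, hX₁, -, hA⟩ := exists_schwartz_cutoff (d := d) zero_lt_one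
  set Φ₁ : 𝓢(E d, ℂ) := 𝓕⁻ X₁ with hΦ₁
  set A := Φ₁ 0
  obtain ⟨C, hC0, hC⟩ := SchwartzMap.exists_norm_le_weight Φ₁ M
  -- Compressing `X₁^∨` by `2^k` leaves its value at the origin in place and shrinks it near the
  -- nonzero lattice points; this `k` makes the gain beat `η`.
  obtain ⟨k, hk⟩ : ∃ k : ℕ, 2 * ‖A‖⁻¹ * C * 4 ^ M / 2 ^ k ≤ η := by
    obtain ⟨k, hk⟩ := pow_unbounded_of_one_lt (2 * ‖A‖⁻¹ * C * 4 ^ M / η) (one_lt_two)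
    refine ⟨k, ?_⟩
    rw [div_le_iff₀ (by positivity), mul_comm]
    rw [div_lt_iff₀ hη] at hk
    linarith
  -- The normalization undoes the factor `2^{kd}` of the dilation and makes the value at the origin
  -- have modulus `2`, leaving room for the bound `1` nearby.
  set w : ℂ := 2 * A⁻¹ * (2 ^ ((k : ℤ) * d))⁻¹ with hw
  set Φ : 𝓢(E d, ℂ) := w • dilate Φ₁ k with hΦ
  have h2 : (2 : ℂ) ^ ((k : ℤ) * (d : ℤ)) ≠ 0 := zpow_ne_zero _ two_ne_zero
  have hΦx : ∀ x, Φ x = 2 * A⁻¹ * Φ₁ ((2 : ℝ) ^ k • x) := by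
    intro x
    rw [hΦ, smul_apply, dilate_apply, hw, smul_eq_mul, zpow_natCast]
    field_simp
  have hΦ0 : ‖Φ 0‖ = 2 := by
    rw [hΦx, smul_zero]
    simp [A, hA]
  have hcont := (continuous_norm.comp Φ.continuous).tendsto 0
  obtain ⟨ε, hε, hball⟩ := Metric.eventually_nhds_iff_ball.1
    (hcont.eventually (lt_mem_nhds (show (1 : ℝ) < ‖Φ 0‖ by rw [hΦ0]; norm_num)))
  set δ : ℝ := min (ε / (2 * (d + 1))) (1 / (2 * (d + 1))) with hδ
  have hδ0 : 0 < δ := lt_min (by positivity) (by positivity)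
  have hδd : δ * d ≤ 1 / 2 := by
    have : δ ≤ 1 / (2 * (d + 1)) := min_le_right _ _
    rw [le_div_iff₀ (by positivity)] at this
    nlinarith
  have hδε : d * δ < ε := by
    have : δ ≤ ε / (2 * (d + 1)) := min_le_left _ _
    rw [le_div_iff₀ (by positivity)] at this
    nlinarith
  refine ⟨𝓕 Φ, 2 ^ k * 2, δ, by positivity, hδ0, hδd, ?_, ?_⟩
  · intro ζ hζ
    have : (𝓕 Φ : 𝓢(E d, ℂ)) ζ = w * X₁ ((2 : ℝ) ^ (-(k : ℤ)) • ζ) := by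
      rw [hΦ, FourierTransform.fourier_smul, smul_apply, fourier_dilate, smul_eq_mul]
      simp [hΦ₁]
    rw [this] at hζ
    have h3 := hX₁ _ (right_ne_zero_of_mul hζ)
    rw [norm_smul, Real.norm_of_nonneg (by positivity), zpow_neg, zpow_natCast, mul_one,
      inv_mul_lt_iff₀ (by positivity)] at h3
    exact h3.le
  · intro y hy
    have hyn : ‖y‖ ≤ d * δ := norm_le_of_forall_abs_le hδ0.le fun i => by
      rw [abs_of_nonneg (hy i).1]
      exact (hy i).2.le
    rw [FourierTransform.fourierInv_fourier_eq]
    refine ⟨(hball y (by simpa using hyn.trans_lt hδε)).le, fun r hr => ?_⟩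
    have hr1 := one_le_norm_latticePoint hr
    have hyr : ‖latticePoint r‖ / 2 ≤ ‖y + latticePoint r‖ := by
      have : ‖latticePoint r‖ ≤ ‖y + latticePoint r‖ + ‖y‖ := by
        simpa using norm_sub_le (y + latticePoint r) y
      nlinarith
    have hwt : weight M ((2 : ℝ) ^ k • (y + latticePoint r)) ≤
        4 ^ M / 2 ^ k * weight M (latticePoint r) := by
      have h3 : weight M ((2 : ℝ) ^ k • (y + latticePoint r)) ≤
          (4 / 2 ^ k) ^ M * weight M (latticePoint r) := by
        refine weight_le_of_one_add_le (by positivity) ?_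
        rw [norm_smul, Real.norm_of_nonneg (by positivity), div_mul_eq_mul_div,
          le_div_iff₀ (by positivity)]
        have : (0 : ℝ) < 2 ^ k := by positivity
        nlinarith
      refine h3.trans ?_
      have := weight_pos M (latticePoint r)
      rw [div_pow]
      gcongr
      -- Only one of the `M` factors `2^{-k}` is kept, which is where `M ≥ 1` enters.
      exact le_self_pow₀ (one_le_pow₀ one_le_two) (by lia)
    rw [hΦx, norm_mul, norm_mul, norm_inv, Complex.norm_ofNat]
    calc 2 * ‖A‖⁻¹ * ‖Φ₁ ((2 : ℝ) ^ k • (y + latticePoint r))‖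
        ≤ 2 * ‖A‖⁻¹ * (C * (4 ^ M / 2 ^ k * weight M (latticePoint r))) := by
          gcongr
          exact (hC _).trans (by gcongr)
      _ = 2 * ‖A‖⁻¹ * C * 4 ^ M / 2 ^ k * weight M (latticePoint r) := by ring
      _ ≤ _ := mul_le_mul_of_nonneg_right hk (weight_pos _ _).le

/-! ### Triebel-Lizorkin norms of wave packets -/

/-- The exponent of the `j`-th frequency block. -/
def blockExp {ι : Type} (K : ℕ) (code : ι → ℕ) (j : ι) : ℕ := 8 * code j + K

/-- The centre of the `j`-th frequency block. -/
noncomputable def blockCentre {ι : Type} (e : E d) (K : ℕ) (code : ι → ℕ) (j : ι) : E d :=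
  (2 : ℝ) ^ blockExp K code j • e

theorem blockExp_injective {ι : Type} (K : ℕ) {code : ι → ℕ} (hc : Function.Injective code) :
    Function.Injective (blockExp K code) := fun i j h => hc (by unfold blockExp at h; lia)

/-- A point within distance `2^b / 8` of `2^b e` is, up to constants, of size `2^b`. -/
theorem norm_near_blockCentre {e ζ : E d} {b : ℕ} (he1 : 1 / 2 ≤ ‖e‖) (he2 : ‖e‖ ≤ 2)
    (hζ : 8 * ‖ζ‖ ≤ 2 ^ b) :
    (3 / 8 : ℝ) * 2 ^ b ≤ ‖ζ + (2 : ℝ) ^ b • e‖ ∧ ‖ζ + (2 : ℝ) ^ b • e‖ ≤ 17 / 8 * 2 ^ b := by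
  have h2 : (0 : ℝ) < 2 ^ b := by positivity
  have h3 : ‖(2 : ℝ) ^ b • e‖ = 2 ^ b * ‖e‖ := by
    rw [norm_smul, Real.norm_of_nonneg h2.le]
  have h4 := norm_add_le ζ ((2 : ℝ) ^ b • e)
  have h5 := norm_sub_le (ζ + (2 : ℝ) ^ b • e) ζ
  rw [add_sub_cancel_left] at h5
  constructor <;> nlinarith

/-- Dyadic localization of the frequency from two-sided bounds. -/
theorem zpow_window {x : ℝ} {b : ℕ} {k : ℤ} {A B : ℤ} (hx1 : (3 / 8 : ℝ) * 2 ^ b ≤ x)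
    (hx2 : x ≤ 17 / 8 * 2 ^ b) (hA : (2 : ℝ) ^ A ≤ (2 : ℝ) ^ (-k) * x)
    (hB : (2 : ℝ) ^ (-k) * x ≤ (2 : ℝ) ^ B) : A - 1 ≤ b - k ∧ (b : ℤ) - k ≤ B + 1 := by
  have hk : (0 : ℝ) < 2 ^ (-k) := by positivity
  have e1 : (2 : ℝ) ^ ((b : ℤ) - k) = 2 ^ (-k) * 2 ^ b := by
    rw [sub_eq_neg_add, zpow_add₀ two_ne_zero, zpow_natCast]
  have h1 : (2 : ℝ) ^ A < 2 ^ ((b : ℤ) - k + 2) := by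
    rw [zpow_add₀ two_ne_zero, e1]
    have : (2 : ℝ) ^ (-k) * x ≤ 2 ^ (-k) * (17 / 8 * 2 ^ b) := by gcongr
    have h3 : (0 : ℝ) < 2 ^ (-k) * 2 ^ b := by positivity
    rw [show (2 : ℝ) ^ (2 : ℤ) = 4 by norm_num]
    linarith
  have h2 : (2 : ℝ) ^ ((b : ℤ) - k) < 2 ^ (B + 2) := by
    rw [zpow_add₀ two_ne_zero B, e1]
    have : (2 : ℝ) ^ (-k) * (3 / 8 * 2 ^ b) ≤ 2 ^ (-k) * x := by gcongr
    have h3 : (0 : ℝ) < 2 ^ (-k) * 2 ^ b := by positivity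
    rw [show (2 : ℝ) ^ (2 : ℤ) = 4 by norm_num]
    linarith
  rw [zpow_lt_zpow_iff_right₀ one_lt_two] at h1 h2
  lia

/-- The data needed to transfer bounds from lattice sequences to functions. -/
structure IsTransferWindow (ϕ : 𝓢(E d, ℂ)) (e : E d) (X : 𝓢(E d, ℂ)) (K : ℕ) (C c : ℝ)
    (V : (Fin d → ℤ) → ℝ≥0∞) : Prop where
  two_le : 2 ≤ K
  le_norm : 1 / 2 ≤ ‖e‖
  norm_le : ‖e‖ ≤ 2
  norm_support : ∀ ζ, X ζ ≠ 0 → 8 * ‖ζ‖ ≤ 2 ^ K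
  kernel_le : ∀ h : ℝ, 0 ≤ h → h ≤ 1 → ∀ v x : E d,
    ‖oscKernel X (𝓕 ϕ) h v x‖ ≤ C * weight (d + 1) x
  const_pos : 0 < c
  const_nonneg : 0 ≤ C
  le_kernel : ∀ h : ℝ, 0 ≤ h → h ≤ 2⁻¹ ^ K → ∀ y : E d, (∀ i, 0 ≤ y i ∧ y i < 2⁻¹ ^ K) →
    c ≤ ‖oscKernel X (𝓕 ϕ) h e y‖
  kernel_off_le : ∀ h : ℝ, 0 ≤ h → h ≤ 2⁻¹ ^ K → ∀ y : E d, (∀ i, 0 ≤ y i ∧ y i < 2⁻¹ ^ K) →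
    ∀ r : Fin d → ℤ, r ≠ 0 → ‖oscKernel X (𝓕 ϕ) h e (y + latticePoint r)‖ₑ ≤ V r
  tsum_le : ∑' r, V r ≤ ENNReal.ofReal (c / 2)

/-- Fix `e` with `ϕ̂(e) ≠ 0`. For small `h` the kernel is nearly `ϕ̂(e) X^∨`, so it inherits the
properties of the window. The bound `R` on the support is fixed before `K`, so that a cutoff adapted
to `R` can be chosen first and `K` taken large enough for it as well. -/
theorem exists_transferWindow (hd : 1 ≤ d) {ϕ : 𝓢(E d, ℂ)} (hϕ : IsLittlewoodPaley ϕ) :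
    ∃ (e : E d) (X : 𝓢(E d, ℂ)) (R : ℝ), 0 < R ∧ (∀ ζ, X ζ ≠ 0 → ‖ζ‖ ≤ R) ∧
      ∀ K₀ : ℕ, ∃ K ≥ K₀, ∃ (C c : ℝ) (V : (Fin d → ℤ) → ℝ≥0∞), IsTransferWindow ϕ e X K C c V := by
  set Y : 𝓢(E d, ℂ) := 𝓕 ϕ with hY
  obtain ⟨e, he⟩ : ∃ e, Y e ≠ 0 := by
    by_contra! h
    have := hϕ.hasSum (EuclideanSpace.single ⟨0, hd⟩ 1) (by simp)
    simp only [fourier_dilate, ← hY, h] at this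
    exact zero_ne_one (hasSum_zero.unique this)
  have hes : e ∈ tsupport Y := subset_tsupport _ he
  obtain ⟨he1, he2⟩ := hϕ.tsupport_subset hes
  set a : ℝ := ‖Y e‖ with ha
  have ha0 : 0 < a := norm_pos_iff.2 he
  have hS := tsum_weight_latticePoint_ne_top (d := d) (M := d + 1) (Nat.lt_succ_self d)
  set S : ℝ := (∑' n : Fin d → ℤ, ENNReal.ofReal (weight (d + 1) (latticePoint n))).toReal with hSdef
  have hS0 : 0 ≤ S := ENNReal.toReal_nonneg
  -- With `a = |ϕ̂(e)|` and `S` the lattice sum of the weight, this `η` bounds the total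
  -- off-diagonal main term by `a / 8`.
  obtain ⟨X, R, δ, hR, hδ, hδd, hXR, hX⟩ :=
    exists_window (d := d) (η := 1 / (8 * (S + 1))) (by positivity) (d + 1) (by lia)
  refine ⟨e, X, R, hR, hXR, fun K₀ => ?_⟩
  obtain ⟨C, hC0, hC⟩ := exists_norm_oscKernel_le X Y (d + 1)
  obtain ⟨D, hD0, hD⟩ := exists_norm_oscKernel_sub_le X Y (d + 1)
  -- The last condition bounds the replacement error by `a / 8`, both for the diagonal kernel and
  -- for the sum of the others. Hence the diagonal is at least `c = a / 2` and the off-diagonal sum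
  -- is at most `a / 4 = c / 2`.
  obtain ⟨K, hKge, hKδ, hKR, hKD⟩ : ∃ K ≥ max K₀ 2, (2⁻¹ : ℝ) ^ K ≤ δ ∧ 8 * R ≤ 2 ^ K ∧
      D * 2⁻¹ ^ K * (1 + 2 ^ (d + 1) * S) ≤ a / 8 := by
    have t1 : Filter.Tendsto (fun K : ℕ => (2⁻¹ : ℝ) ^ K) Filter.atTop (nhds 0) :=
      tendsto_pow_atTop_nhds_zero_of_lt_one (by norm_num) (by norm_num)
    have t2 : Filter.Tendsto (fun K : ℕ => (2 : ℝ) ^ K) Filter.atTop Filter.atTop :=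
      tendsto_pow_atTop_atTop_of_one_lt one_lt_two
    have t3 : Filter.Tendsto (fun K : ℕ => D * 2⁻¹ ^ K * (1 + 2 ^ (d + 1) * S)) Filter.atTop
        (nhds 0) := by simpa using (t1.const_mul D).mul_const (1 + 2 ^ (d + 1) * S)
    obtain ⟨K, h1, h2, h3, h4⟩ := ((Filter.eventually_ge_atTop (max K₀ 2)).and
      ((t1.eventually (Iic_mem_nhds hδ)).and ((t2.eventually_ge_atTop (8 * R)).and
        (t3.eventually (Iic_mem_nhds (show (0 : ℝ) < a / 8 by positivity)))))).exists
    exact ⟨K, h1, h2, h3, h4⟩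
  have hp : (0 : ℝ) < 2⁻¹ ^ K := by positivity
  have h11 : (2⁻¹ : ℝ) ^ K ≤ 1 := pow_le_one₀ (by norm_num) (by norm_num)
  refine ⟨K, (le_max_left _ _).trans hKge, C, a / 2, fun r => ENNReal.ofReal
    ((a * (1 / (8 * (S + 1))) + D * 2⁻¹ ^ K * 2 ^ (d + 1)) * weight (d + 1) (latticePoint r)),
    (le_max_right _ _).trans hKge, he1, he2, fun ζ hζ => ?_, hC, by positivity, hC0, ?_, ?_, ?_⟩
  · linarith [hXR ζ hζ]
  · intro h h0 h1 y hy
    obtain ⟨h2, -⟩ := hX y fun i => ⟨(hy i).1, (hy i).2.trans_le hKδ⟩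
    have h3 := hD h h0 (h1.trans h11) e y
    have h4 := norm_sub_norm_le (Y e * (𝓕⁻ X : 𝓢(E d, ℂ)) y) (oscKernel X Y h e y)
    rw [norm_sub_rev, norm_mul] at h4
    have h5 : D * h * weight (d + 1) y ≤ D * 2⁻¹ ^ K * 1 := by
      have := weight_le_one (d + 1) y
      have := weight_pos (d + 1) y
      gcongr
    have h6 : 0 ≤ D * 2⁻¹ ^ K * (2 ^ (d + 1) * S) := by positivity
    have h7 : a * 1 ≤ a * ‖(𝓕⁻ X : 𝓢(E d, ℂ)) y‖ := by gcongr
    linarith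
  · intro h h0 h1 y hy r hr
    obtain ⟨-, h2⟩ := hX y fun i => ⟨(hy i).1, (hy i).2.trans_le hKδ⟩
    have h2 := h2 r hr
    have h3 := hD h h0 (h1.trans h11) e (y + latticePoint r)
    have h4 := norm_le_norm_sub_add (oscKernel X Y h e (y + latticePoint r))
      (Y e * (𝓕⁻ X : 𝓢(E d, ℂ)) (y + latticePoint r))
    rw [norm_mul] at h4
    have hyn : ‖y‖ ≤ 1 := by
      have := norm_le_of_forall_abs_le hδ.le fun i => by
        rw [abs_of_nonneg (hy i).1]
        exact (hy i).2.le.trans hKδ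
      linarith
    have h5 : weight (d + 1) (y + latticePoint r) ≤ 2 ^ (d + 1) * weight (d + 1) (latticePoint r) := by
      refine weight_le_of_one_add_le zero_le_two ?_
      have : ‖latticePoint r‖ ≤ ‖y + latticePoint r‖ + ‖y‖ := by
        simpa using norm_sub_le (y + latticePoint r) y
      linarith [norm_nonneg (y + latticePoint r)]
    have hw := weight_pos (d + 1) (latticePoint r)
    have hw' := weight_pos (d + 1) (y + latticePoint r)
    rw [← ofReal_norm]
    refine ENNReal.ofReal_le_ofReal (h4.trans ?_)
    rw [add_mul]
    have h6 : D * h * weight (d + 1) (y + latticePoint r) ≤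
        D * 2⁻¹ ^ K * (2 ^ (d + 1) * weight (d + 1) (latticePoint r)) := by gcongr
    have h7 : a * ‖(𝓕⁻ X : 𝓢(E d, ℂ)) (y + latticePoint r)‖ ≤
        a * (1 / (8 * (S + 1)) * weight (d + 1) (latticePoint r)) := by gcongr
    linarith
  · simp_rw [ENNReal.ofReal_mul (show 0 ≤ a * (1 / (8 * (S + 1))) + D * 2⁻¹ ^ K * 2 ^ (d + 1)
      by positivity)]
    rw [ENNReal.tsum_mul_left, ← ENNReal.ofReal_toReal hS, ← hSdef, ← ENNReal.ofReal_mul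
      (by positivity)]
    refine ENNReal.ofReal_le_ofReal ?_
    have h1 : a * (1 / (8 * (S + 1))) * S ≤ a / 8 := by
      rw [mul_one_div, div_mul_eq_mul_div, div_le_div_iff₀ (by positivity) (by norm_num)]
      nlinarith
    have h2 : 0 ≤ D * 2⁻¹ ^ K := by positivity
    nlinarith

/-- The tempered distribution whose Fourier transform is a sum of wave packets. -/
noncomputable def packet {ι : Type} (X : 𝓢(E d, ℂ)) (c : ι → E d) (s : Finset ι)
    (a : ι → (Fin d → ℤ) →₀ ℂ) : 𝓢'(E d, ℂ) :=
  SchwartzMap.toTemperedDistributionCLM (E d) ℂ volume (𝓕⁻ (packetHat X c s a) : 𝓢(E d, ℂ))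

section

variable {ϕ : 𝓢(E d, ℂ)} {e : E d} {X : 𝓢(E d, ℂ)} {K : ℕ} {C c : ℝ} {V : (Fin d → ℤ) → ℝ≥0∞}
  {ι : Type} {code : ι → ℕ}

theorem smul_blockCentre (e : E d) (K : ℕ) (code : ι → ℕ) (j : ι) (k : ℤ) :
    (2 : ℝ) ^ (-k) • blockCentre e K code j = (2 : ℝ) ^ ((blockExp K code j : ℤ) - k) • e := by
  rw [blockCentre, smul_smul, sub_eq_neg_add, zpow_add₀ two_ne_zero, zpow_natCast]

/-- Block `j` lies where `|ξ|` is between `3/8` and `17/8` times `2^{b_j}`, and `ϕ̂(2^{-k} ·)` lives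
where `|ξ|` is between `2^{k-1}` and `2^{k+1}`. These sets are disjoint when `|k - b_j| > 2`. -/
theorem IsTransferWindow.oscKernel_eq_zero (H : IsTransferWindow ϕ e X K C c V)
    (hϕ : IsLittlewoodPaley ϕ) (j : ι) (k : ℤ)
    (hk : ¬ (-2 ≤ k - blockExp K code j ∧ k - blockExp K code j ≤ 2)) :
    oscKernel X (𝓕 ϕ) ((2 : ℝ) ^ (-k)) ((2 : ℝ) ^ (-k) • blockCentre e K code j) = 0 := by
  refine HerzMultiplier.oscKernel_eq_zero fun ζ => ?_
  by_contra h
  have h1 := H.norm_support ζ (left_ne_zero_of_mul h)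
  have h2 := hϕ.tsupport_subset (subset_tsupport _ (right_ne_zero_of_mul h))
  rw [← smul_add] at h2
  obtain ⟨h3, h4⟩ := norm_near_blockCentre H.le_norm H.norm_le
    (h1.trans (pow_le_pow_right₀ one_le_two (show K ≤ blockExp K code j by unfold blockExp; lia)))
  obtain ⟨h5, h6⟩ := h2
  rw [norm_smul, Real.norm_of_nonneg (by positivity), blockCentre] at h5 h6
  have := zpow_window (A := -1) (B := 1) h3 h4 (by simpa using h5) (by simpa using h6)
  refine hk ?_
  lia

theorem IsTransferWindow.enorm_lpPiece_le (H : IsTransferWindow ϕ e X K C c V)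
    (hϕ : IsLittlewoodPaley ϕ) (s : Finset ι) (b : ι → (Fin d → ℤ) →₀ ℂ) (k : ℤ) (y : E d) :
    ‖lpPiece ϕ k (packet X (blockCentre e K code) s b) y‖ₑ ≤
      ∑ i ∈ Finset.Icc (-2 : ℤ) 2, ∑' n, ENNReal.ofReal (C * weight (d + 1) (y - latticePoint n)) *
        ∑ j ∈ s, if k = blockExp K code j + i then ‖b j n‖ₑ else 0 := by
  classical
  have hterm : ∀ j n, ‖b j n * ((Real.fourierChar (inner ℝ (blockCentre e K code j) y) : ℂ) *
      oscKernel X (𝓕 ϕ) ((2 : ℝ) ^ (-k)) ((2 : ℝ) ^ (-k) • blockCentre e K code j)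
        (y - latticePoint n))‖ₑ ≤ ∑ i ∈ Finset.Icc (-2 : ℤ) 2,
        ENNReal.ofReal (C * weight (d + 1) (y - latticePoint n)) *
          if k = blockExp K code j + i then ‖b j n‖ₑ else 0 := by
    intro j n
    by_cases hk : -2 ≤ k - blockExp K code j ∧ k - blockExp K code j ≤ 2
    · refine le_trans ?_ (Finset.single_le_sum (fun _ _ => zero_le)
        (Finset.mem_Icc.2 hk))
      rw [if_pos (by lia), mul_comm, enorm_mul, enorm_mul]
      gcongr
      rw [← ofReal_norm, Circle.norm_coe, ENNReal.ofReal_one, one_mul, ← ofReal_norm]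
      -- The kernel bound needs `2^{-k} ≤ 1`. Here `k ≥ b_j - 2 ≥ K - 2 ≥ 0`, which is the purpose
      -- of `2 ≤ K`.
      refine ENNReal.ofReal_le_ofReal (H.kernel_le _ (by positivity) ?_ _ _)
      refine zpow_le_one_of_nonpos₀ one_le_two ?_
      have := H.two_le
      unfold blockExp at hk
      lia
    · rw [H.oscKernel_eq_zero hϕ j k hk]
      simp
  rw [packet, lpPiece_packet]
  refine (enorm_sum_le _ _).trans ?_
  calc ∑ j ∈ s, ‖_‖ₑ ≤ ∑ j ∈ s, ∑' n, ∑ i ∈ Finset.Icc (-2 : ℤ) 2,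
        ENNReal.ofReal (C * weight (d + 1) (y - latticePoint n)) *
          if k = blockExp K code j + i then ‖b j n‖ₑ else 0 := by
        refine Finset.sum_le_sum fun j _ => ?_
        refine (enorm_sum_le _ _).trans ?_
        exact (Finset.sum_le_sum fun n _ => hterm j n).trans (ENNReal.sum_le_tsum _)
    _ = _ := by
        simp_rw [Finset.mul_sum]
        simp_rw [Summable.tsum_finsetSum fun _ _ => ENNReal.summable]
        exact Finset.sum_comm

/-- The constant in the upper bound for the norm of a wave packet. -/
noncomputable def upperConst (d : ℕ) (C : ℝ) : ℝ≥0∞ :=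
  5 * ∑' r : Fin d → ℤ, ENNReal.ofReal (C * ((1 + d) ^ (d + 1) * weight (d + 1) (latticePoint r)))

theorem upperConst_ne_top (hC : 0 ≤ C) : upperConst d C ≠ ∞ := by
  unfold upperConst
  simp_rw [ENNReal.ofReal_mul hC, ENNReal.ofReal_mul (show (0 : ℝ) ≤ (1 + d) ^ (d + 1) by positivity)]
  rw [ENNReal.tsum_mul_left, ENNReal.tsum_mul_left]
  have := tsum_weight_latticePoint_ne_top (d := d) (M := d + 1) (Nat.lt_succ_self d)
  finiteness

/-- There are five possible offsets between the index of a piece and a block exponent. For each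
offset, Minkowski's inequality moves the `ℓ^q` norm inside the convolution with the weight, and only
the integer part of `y` matters. -/
theorem IsTransferWindow.seqNorm_lpPiece_le (H : IsTransferWindow ϕ e X K C c V)
    (hϕ : IsLittlewoodPaley ϕ) (hc : Function.Injective code) {q : ℝ≥0∞} (hq : 1 ≤ q)
    (s : Finset ι) (b : ι → (Fin d → ℤ) →₀ ℂ) (y : E d) :
    seqNorm q (fun k : ℤ => ‖lpPiece ϕ k (packet X (blockCentre e K code) s b) y‖ₑ) ≤
      5 * ∑' n, ENNReal.ofReal (C * ((1 + d) ^ (d + 1) *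
        weight (d + 1) (latticePoint (floorVec y - n)))) * seqNorm q fun j => ‖b j n‖ₑ := by
  have h0 : q ≠ 0 := (zero_lt_one.trans_le hq).ne'
  refine (seqNorm_mono fun k => H.enorm_lpPiece_le hϕ s b k y).trans ?_
  refine (seqNorm_sum_le hq _ _).trans ?_
  have hcard : (5 : ℝ≥0∞) = ((Finset.Icc (-2 : ℤ) 2).card : ℝ≥0∞) := by simp
  rw [hcard, ← nsmul_eq_mul]
  refine Finset.sum_le_card_nsmul _ _ _ fun i _ => ?_
  refine (seqNorm_tsum_le hq _).trans (ENNReal.tsum_le_tsum fun n => ?_)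
  rw [seqNorm_const_mul h0]
  gcongr
  · exact H.const_nonneg
  · rw [latticePoint_sub]
    exact weight_sub_floorVec_le _ _ _
  · refine seqNorm_sum_ite_le h0 (σ := fun j => (blockExp K code j : ℤ) + i) ?_ s _
    intro j j' hj
    refine blockExp_injective K hc ?_
    simpa using hj

theorem IsTransferWindow.tlNorm_le (H : IsTransferWindow ϕ e X K C c V)
    (hϕ : IsLittlewoodPaley ϕ) (hc : Function.Injective code) {p q : ℝ≥0∞} (hp : 1 ≤ p)
    (hq : 1 ≤ q) (s : Finset ι) (b : ι → (Fin d → ℤ) →₀ ℂ) :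
    tlNorm ϕ p q (packet X (blockCentre e K code) s b) ≤
      upperConst d C * mixedNorm p q fun j => b j := by
  have h0 : p ≠ 0 := (zero_lt_one.trans_le hp).ne'
  have h0q : q ≠ 0 := (zero_lt_one.trans_le hq).ne'
  set G : (Fin d → ℤ) → ℝ≥0∞ := fun m => 5 * ∑' n, ENNReal.ofReal (C * ((1 + d) ^ (d + 1) *
        weight (d + 1) (latticePoint (m - n)))) * seqNorm q fun j => ‖b j n‖ₑ with hG
  have hGn : seqNorm p G ≤ upperConst d C * mixedNorm p q fun j => b j := by
    rw [hG, seqNorm_const_mul h0, upperConst, mul_assoc]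
    gcongr
    exact seqNorm_lattice_conv_le hp (fun r => ENNReal.ofReal (C * ((1 + d) ^ (d + 1) *
      weight (d + 1) (latticePoint r)))) fun n => seqNorm q fun j => ‖b j n‖ₑ
  refine le_trans ?_ hGn
  have hpt := H.seqNorm_lpPiece_le hϕ hc hq s b
  unfold tlNorm
  split_ifs with h
  · obtain ⟨rfl, hq'⟩ := h
    have hqpos : 0 < q.toReal := ENNReal.toReal_pos h0q hq'
    refine iSup_le fun j => iSup_le fun n => ?_
    rw [one_div, ENNReal.rpow_inv_le_iff hqpos]
    -- For `p = ∞` the pointwise bound is uniform in `x` and in the starting index, so it survives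
    -- averaging over every cube.
    calc _ ≤ ⨍⁻ _x in dyadicCube j n, seqNorm ∞ G ^ q.toReal ∂volume := by
          refine lintegral_mono fun x => ?_
          have h2 : seqNorm q (fun i : ℕ =>
              ‖lpPiece ϕ (j + i) (packet X (blockCentre e K code) s b) x‖ₑ) ≤ seqNorm ∞ G := by
            refine (seqNorm_comp_injective_le
              (fun k : ℤ => ‖lpPiece ϕ k (packet X (blockCentre e K code) s b) x‖ₑ)
              (σ := fun i : ℕ => j + (i : ℤ)) ?_).trans ((hpt x).trans ?_)
            · intro i i' hi
              simpa using hi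
            · rw [seqNorm_top]
              exact le_iSup G (floorVec x)
          rwa [seqNorm_of_ne_top hq', one_div, ENNReal.rpow_inv_le_iff hqpos] at h2
      _ ≤ _ := by
          rw [setLAverage_eq, setLIntegral_const]
          exact ENNReal.div_le_of_le_mul le_rfl
  · rw [← eLpNorm_comp_floorVec h0]
    exact eLpNorm_mono_enorm fun y => by simpa using hpt y

/-- The piece of index `b_j` sees only block `j`, at the base point `2^{-b_j} c_j = e`. In the
corner of the cell of `m` the term `n = m` dominates, and the other terms form a convolution error
of small total mass. -/
theorem IsTransferWindow.le_enorm_lpPiece (H : IsTransferWindow ϕ e X K C c V)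
    (hϕ : IsLittlewoodPaley ϕ) (hc : Function.Injective code) {s : Finset ι}
    {b : ι → (Fin d → ℤ) →₀ ℂ} (hb : ∀ j ∉ s, b j = 0) {y : E d}
    (hy : ∀ i, Int.fract (y i) < 2⁻¹ ^ K) (j : ι) :
    ENNReal.ofReal c * ‖b j (floorVec y)‖ₑ ≤
      ‖lpPiece ϕ (blockExp K code j) (packet X (blockCentre e K code) s b) y‖ₑ +
        ∑' n, V (floorVec y - n) * ‖b j n‖ₑ := by
  classical
  set m := floorVec y with hm
  by_cases hjm : b j m = 0
  · simp [hjm]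
  have hjs : j ∈ s := by
    by_contra h
    exact hjm (by simp [hb j h])
  have hyb : ∀ i, 0 ≤ (y - latticePoint m) i ∧ (y - latticePoint m) i < 2⁻¹ ^ K := fun i =>
    ⟨Int.fract_nonneg (y i), hy i⟩
  set h : ℝ := 2 ^ (-(blockExp K code j : ℤ)) with hh
  have hh0 : 0 ≤ h := by positivity
  have hh1 : h ≤ 2⁻¹ ^ K := by
    rw [hh, zpow_neg, zpow_natCast, inv_pow]
    exact inv_anti₀ (by positivity) (pow_le_pow_right₀ one_le_two (by unfold blockExp; lia))
  set u : ℂ := (Real.fourierChar (inner ℝ (blockCentre e K code j) y) : ℂ)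
  have hu : ‖u‖ₑ = 1 := by rw [← ofReal_norm, Circle.norm_coe, ENNReal.ofReal_one]
  set T : (Fin d → ℤ) → ℂ := fun n => b j n * (u * oscKernel X (𝓕 ϕ) h e (y - latticePoint n))
  have hlp : lpPiece ϕ (blockExp K code j) (packet X (blockCentre e K code) s b) y =
      ∑ n ∈ (b j).support, T n := by
    rw [packet, lpPiece_packet, Finset.sum_eq_single_of_mem j hjs]
    · refine Finset.sum_congr rfl fun n _ => ?_
      rw [smul_blockCentre, sub_self, zpow_zero, one_smul]
    · intro j' _ hj'
      refine Finset.sum_eq_zero fun n _ => ?_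
      rw [H.oscKernel_eq_zero hϕ j']
      · simp
      · have := hc.ne hj'
        unfold blockExp
        lia
  have hsplit : T m = (∑ n ∈ (b j).support, T n) - ∑ n ∈ (b j).support.erase m, T n := by
    rw [← Finset.add_sum_erase _ _ (Finsupp.mem_support_iff.2 hjm)]
    ring
  have hTm : ENNReal.ofReal c * ‖b j m‖ₑ ≤ ‖T m‖ₑ := by
    rw [enorm_mul, enorm_mul, hu, one_mul, mul_comm]
    gcongr
    rw [← ofReal_norm]
    exact ENNReal.ofReal_le_ofReal (H.le_kernel h hh0 hh1 _ hyb)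
  have hrest : ‖∑ n ∈ (b j).support.erase m, T n‖ₑ ≤ ∑' n, V (m - n) * ‖b j n‖ₑ := by
    refine (enorm_sum_le _ _).trans ((Finset.sum_le_sum fun n hn => ?_).trans
      (ENNReal.sum_le_tsum ((b j).support.erase m)))
    rw [enorm_mul, enorm_mul, hu, one_mul, mul_comm]
    gcongr
    have := H.kernel_off_le h hh0 hh1 _ hyb (m - n)
      (sub_ne_zero.2 (Finset.ne_of_mem_erase hn).symm)
    rwa [latticePoint_sub, sub_add_sub_cancel] at this
  rw [hlp]
  refine hTm.trans ?_
  rw [hsplit]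
  exact enorm_sub_le.trans (add_le_add le_rfl hrest)

theorem IsTransferWindow.le_seqNorm_lpPiece (H : IsTransferWindow ϕ e X K C c V)
    (hϕ : IsLittlewoodPaley ϕ) (hc : Function.Injective code) {q : ℝ≥0∞} (hq : 1 ≤ q)
    {s : Finset ι} {b : ι → (Fin d → ℤ) →₀ ℂ} (hb : ∀ j ∉ s, b j = 0) {y : E d}
    (hy : ∀ i, Int.fract (y i) < 2⁻¹ ^ K) :
    ENNReal.ofReal c * seqNorm q (fun j => ‖b j (floorVec y)‖ₑ) ≤
      seqNorm q (fun j => ‖lpPiece ϕ (blockExp K code j)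
        (packet X (blockCentre e K code) s b) y‖ₑ) +
        ∑' n, V (floorVec y - n) * seqNorm q fun j => ‖b j n‖ₑ := by
  have h0 : q ≠ 0 := (zero_lt_one.trans_le hq).ne'
  rw [← seqNorm_const_mul h0]
  refine (seqNorm_mono fun j => H.le_enorm_lpPiece hϕ hc hb hy j).trans ?_
  refine (seqNorm_add_le hq _ _).trans (add_le_add le_rfl ?_)
  refine (seqNorm_tsum_le hq _).trans (ENNReal.tsum_le_tsum fun n => ?_)
  rw [seqNorm_const_mul h0]

theorem continuous_lpPiece_packet (ϕ X : 𝓢(E d, ℂ)) (c : ι → E d) (s : Finset ι)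
    (a : ι → (Fin d → ℤ) →₀ ℂ) (k : ℤ) : Continuous (lpPiece ϕ k (packet X c s a)) := by
  have h : lpPiece ϕ k (packet X c s a) = fun x =>
      (𝓕⁻ fun ξ => (𝓕 ϕ : 𝓢(E d, ℂ)) ((2 : ℝ) ^ (-k) • ξ) * packetHat X c s a ξ) x := by
    ext x
    rw [packet, lpPiece_fourierInv, Real.fourierInv_eq]
    rfl
  rw [h]
  simp only [Real.fourierInv_eq_fourier_neg]
  refine Continuous.comp ?_ continuous_neg
  refine VectorFourier.fourierIntegral_continuous Real.continuous_fourierChar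
    (by exact continuous_inner) ?_
  obtain ⟨B, -, hB⟩ := SchwartzMap.exists_norm_le_weight (𝓕 ϕ : 𝓢(E d, ℂ)) 0
  refine (packetHat X c s a).integrable.bdd_mul (c := B) ?_ ?_
  · exact (by fun_prop : Continuous fun ξ =>
      (𝓕 ϕ : 𝓢(E d, ℂ)) ((2 : ℝ) ^ (-k) • ξ)).aestronglyMeasurable
  · refine Filter.Eventually.of_forall fun ξ => ?_
    simpa [weight] using hB ((2 : ℝ) ^ (-k) • ξ)

theorem measurable_seqNorm {κ Ω : Type} [Countable κ] [MeasurableSpace Ω] (q : ℝ≥0∞)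
    {F : κ → Ω → ℝ≥0∞} (hF : ∀ j, Measurable (F j)) :
    Measurable fun y => seqNorm q fun j => F j y := by
  unfold seqNorm
  split_ifs
  · exact Measurable.iSup hF
  · exact (Measurable.tsum fun j => (hF j).pow_const _).pow_const _

theorem mixedNorm_ne_top {p q : ℝ≥0∞} (hp : p ≠ 0) (hq : q ≠ 0) {s : Finset ι}
    {b : ι → (Fin d → ℤ) →₀ ℂ} (hb : ∀ j ∉ s, b j = 0) : mixedNorm p q (fun j => b j) ≠ ∞ := by
  classical
  refine seqNorm_lt_top_of_finite hp _ (s.biUnion fun j => (b j).support) (fun n hn => ?_)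
    fun n => seqNorm_lt_top_of_finite hq _ s (fun j hj => by simp [hb j hj]) fun j => enorm_ne_top
  have : ∀ j, b j n = 0 := by
    intro j
    by_cases hj : j ∈ s
    · simp only [Finset.mem_biUnion, not_exists, not_and] at hn
      simpa using hn j hj
    · simp [hb j hj]
  simp [this, seqNorm_zero hq]

/-- The constant in the lower bound for the norm of a wave packet. -/
noncomputable def lowerConst (d K : ℕ) (p : ℝ≥0∞) : ℝ≥0∞ :=
  (ENNReal.ofReal (2⁻¹ ^ K) ^ d) ^ (1 / p).toReal

/-- Absorption of the convolution error into the left-hand side; finiteness of `x` is what permits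
the cancellation. -/
theorem le_of_mul_le_add_half {c : ℝ} (hc : 0 < c) {x t : ℝ≥0∞} (hx : x ≠ ∞)
    (h : ENNReal.ofReal c * x ≤ t + ENNReal.ofReal (c / 2) * x) : ENNReal.ofReal (c / 2) * x ≤ t := by
  have h1 : ENNReal.ofReal c = ENNReal.ofReal (c / 2) + ENNReal.ofReal (c / 2) := by
    rw [← ENNReal.ofReal_add (by positivity) (by positivity), add_halves]
  rw [h1, add_mul] at h
  exact (ENNReal.add_le_add_iff_right (by finiteness)).1 h

theorem measurableSet_dyadicCube (j : ℤ) (n : Fin d → ℤ) : MeasurableSet (dyadicCube j n) := by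
  have h : dyadicCube j n = ⋂ i, {x : E d | (2 : ℝ) ^ (-j) * n i ≤ x i ∧
      x i < (2 : ℝ) ^ (-j) * (n i + 1)} := by
    ext x
    simp [dyadicCube]
  rw [h]
  refine MeasurableSet.iInter fun i => ?_
  have hm : Measurable fun x : E d => x i := by fun_prop
  exact (measurableSet_le measurable_const hm).inter (measurableSet_lt hm measurable_const)

/-- The corner of a unit cell is itself a dyadic cube, so for `p = ∞` it is admissible in the
supremum that defines the norm. -/
theorem dyadicCube_of_lattice (K : ℕ) (m : Fin d → ℤ) :
    dyadicCube K (fun i => 2 ^ K * m i) =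
      {x : E d | ∀ i, (m i : ℝ) ≤ x i ∧ x i < m i + 2⁻¹ ^ K} := by
  ext x
  simp only [dyadicCube, Set.mem_ofPred_eq, zpow_neg, zpow_natCast, inv_pow]
  refine forall_congr' fun i => ?_
  push_cast
  rw [inv_mul_cancel_left₀ (by positivity), mul_add, inv_mul_cancel_left₀ (by positivity),
    mul_one]

/-- Every block exponent is at least `K`, so a cube of side `2^{-K}` counts all the blocks. -/
theorem seqNorm_blockExp_le (hc : Function.Injective code) {q : ℝ≥0∞} (K : ℕ) (a : ℤ → ℝ≥0∞) :
    seqNorm q (fun j => a (blockExp K code j)) ≤ seqNorm q fun i : ℕ => a (K + i) := by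
  have h : (fun j => a (blockExp K code j)) = fun j => (fun i : ℕ => a (K + i)) (8 * code j) := by
    ext j
    rw [blockExp, add_comm]
    push_cast
    rfl
  rw [h]
  exact seqNorm_comp_injective_le (fun i : ℕ => a (K + i)) (σ := fun j => 8 * code j)
    fun j j' hj => hc (by simpa using hj)

theorem seqNorm_nat_le_int {q : ℝ≥0∞} (k : ℤ) (a : ℤ → ℝ≥0∞) :
    seqNorm q (fun i : ℕ => a (k + i)) ≤ seqNorm q a :=
  seqNorm_comp_injective_le a (σ := fun i : ℕ => k + (i : ℤ)) fun i i' hi => by simpa using hi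

theorem IsTransferWindow.le_iSup_laverage (H : IsTransferWindow ϕ e X K C c V)
    (hϕ : IsLittlewoodPaley ϕ) (hc : Function.Injective code) {q : ℝ≥0∞}
    (hq : 1 ≤ q) (hq' : q ≠ ∞) {s : Finset ι} {b : ι → (Fin d → ℤ) →₀ ℂ} (hb : ∀ j ∉ s, b j = 0) :
    ENNReal.ofReal (c / 2) * (mixedNorm ∞ q fun j => b j) ≤
      ⨆ (j : ℤ) (n : Fin d → ℤ), (⨍⁻ x in dyadicCube j n, (∑' i : ℕ, ‖lpPiece ϕ (j + i)
        (packet X (blockCentre e K code) s b) x‖ₑ ^ q.toReal) ∂volume) ^ (1 / q.toReal) := by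
  have h0q : q ≠ 0 := (zero_lt_one.trans_le hq).ne'
  have hfin := mixedNorm_ne_top ENNReal.top_ne_zero h0q hb
  have hK0 : (0 : ℝ) < 2⁻¹ ^ K := by positivity
  have hK1 : (2⁻¹ : ℝ) ^ K ≤ 1 := pow_le_one₀ (by norm_num) (by norm_num)
  have hqpos : 0 < q.toReal := ENNReal.toReal_pos h0q hq'
  set B : (Fin d → ℤ) → ℝ≥0∞ := fun n => seqNorm q fun j => ‖b j n‖ₑ with hB
  have hmix : (mixedNorm ∞ q fun j => b j) = seqNorm ∞ B := rfl
  rw [hmix] at hfin ⊢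
  have hconv : seqNorm ∞ (fun m => ∑' n, V (m - n) * B n) ≤ ENNReal.ofReal (c / 2) * seqNorm ∞ B :=
    (seqNorm_lattice_conv_le le_top V B).trans (mul_le_mul_left H.tsum_le _)
  refine le_of_mul_le_add_half H.const_pos hfin ?_
  conv_lhs => rw [seqNorm_top, ENNReal.mul_iSup]
  refine iSup_le fun m => ?_
  set P : Set (E d) := dyadicCube K fun i => 2 ^ K * m i with hP
  have hPbox : P = {x : E d | ∀ i, (m i : ℝ) ≤ x i ∧ x i < m i + 2⁻¹ ^ K} :=
    dyadicCube_of_lattice K m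
  have hPvol : volume P = ENNReal.ofReal (2⁻¹ ^ K) ^ d := by
    rw [hPbox, volume_box]
    simp
  have hPy : ∀ y ∈ P, floorVec y = m ∧ ∀ i, Int.fract (y i) < 2⁻¹ ^ K := by
    intro y hy
    rw [hPbox] at hy
    have hfl : ∀ i, ⌊y i⌋ = m i := fun i => Int.floor_eq_iff.2 ⟨(hy i).1, by linarith [(hy i).2]⟩
    refine ⟨funext hfl, fun i => ?_⟩
    rw [Int.fract, hfl]
    linarith [(hy i).2]
  have hvol0 : volume P ≠ 0 := by
    rw [hPvol]
    simp
  have hvolt : volume P ≠ ∞ := by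
    rw [hPvol]
    finiteness
  -- A lower bound for the square function valid throughout `P`. Truncated subtraction makes it
  -- zero, hence harmless, when the error exceeds the main term.
  set t : ℝ≥0∞ := ENNReal.ofReal c * B m - ENNReal.ofReal (c / 2) * seqNorm ∞ B with ht
  have htF : ∀ y ∈ P, t ≤ seqNorm q fun i : ℕ =>
      ‖lpPiece ϕ (K + i) (packet X (blockCentre e K code) s b) y‖ₑ := by
    intro y hy
    obtain ⟨h1, h2⟩ := hPy y hy
    have h3 := H.le_seqNorm_lpPiece hϕ hc hq hb h2
    rw [h1] at h3
    refine le_trans (tsub_le_iff_right.2 (h3.trans (add_le_add le_rfl (le_trans ?_ hconv))))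
      (seqNorm_blockExp_le hc K fun k => ‖lpPiece ϕ k (packet X (blockCentre e K code) s b) y‖ₑ)
    exact le_seqNorm ENNReal.top_ne_zero (fun m => ∑' n, V (m - n) * B n) m
  rw [← tsub_le_iff_right, ← ht]
  refine le_trans ?_ (le_iSup₂ (K : ℤ) (fun i => 2 ^ K * m i))
  rw [one_div, ENNReal.le_rpow_inv_iff hqpos, ← hP]
  calc t ^ q.toReal = ⨍⁻ _y in P, t ^ q.toReal ∂volume := (setLAverage_const hvol0 hvolt _).symm
    _ ≤ _ := by
      rw [setLAverage_eq, setLAverage_eq]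
      refine ENNReal.div_le_div_right
        (setLIntegral_mono' (measurableSet_dyadicCube _ _) fun y hy => ?_) _
      refine (ENNReal.rpow_le_rpow (htF y hy) hqpos.le).trans ?_
      rw [seqNorm_of_ne_top hq', ← ENNReal.rpow_mul, one_div_mul_cancel hqpos.ne',
        ENNReal.rpow_one]

theorem IsTransferWindow.le_eLpNorm [Countable ι] (H : IsTransferWindow ϕ e X K C c V)
    (hϕ : IsLittlewoodPaley ϕ) (hc : Function.Injective code) {p q : ℝ≥0∞} (hp : 1 ≤ p)
    (hq : 1 ≤ q) {s : Finset ι} {b : ι → (Fin d → ℤ) →₀ ℂ} (hb : ∀ j ∉ s, b j = 0) :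
    ENNReal.ofReal (c / 2) * (lowerConst d K p * mixedNorm p q fun j => b j) ≤
      eLpNorm (fun x : E d => seqNorm q fun k : ℤ =>
        ‖lpPiece ϕ k (packet X (blockCentre e K code) s b) x‖ₑ) p volume := by
  have h0 : p ≠ 0 := (zero_lt_one.trans_le hp).ne'
  have h0q : q ≠ 0 := (zero_lt_one.trans_le hq).ne'
  have hfin := mixedNorm_ne_top h0 h0q hb
  have hK0 : (0 : ℝ) < 2⁻¹ ^ K := by positivity
  have hK1 : (2⁻¹ : ℝ) ^ K ≤ 1 := pow_le_one₀ (by norm_num) (by norm_num)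
  set B : (Fin d → ℤ) → ℝ≥0∞ := fun n => seqNorm q fun j => ‖b j n‖ₑ with hB
  have hmix : (mixedNorm p q fun j => b j) = seqNorm p B := rfl
  rw [hmix] at hfin ⊢
  have hconv : seqNorm p (fun m => ∑' n, V (m - n) * B n) ≤ ENNReal.ofReal (c / 2) * seqNorm p B :=
    (seqNorm_lattice_conv_le hp V B).trans (mul_le_mul_left H.tsum_le _)
  set F : E d → ℝ≥0∞ := fun x => seqNorm q fun k : ℤ =>
    ‖lpPiece ϕ k (packet X (blockCentre e K code) s b) x‖ₑ with hF
  have hFm : Measurable F := measurable_seqNorm q fun k =>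
    (continuous_lpPiece_packet ϕ X _ s b k).measurable.enorm
  have hpt : ∀ y : E d, (∀ i, Int.fract (y i) < 2⁻¹ ^ K) →
      ENNReal.ofReal c * B (floorVec y) ≤ F y + ∑' n, V (floorVec y - n) * B n := by
    intro y hy
    refine (H.le_seqNorm_lpPiece hϕ hc hq hb hy).trans (add_le_add ?_ le_rfl)
    exact (seqNorm_blockExp_le hc K fun k =>
      ‖lpPiece ϕ k (packet X (blockCentre e K code) s b) y‖ₑ).trans (seqNorm_nat_le_int _ _)
  set D : Set (E d) := {x : E d | ∀ i, Int.fract (x i) < 2⁻¹ ^ K} with hD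
  have hDm : MeasurableSet D := by
    have : D = ⋂ i, {x : E d | Int.fract (x i) < 2⁻¹ ^ K} := by ext x; simp [hD]
    rw [this]
    refine MeasurableSet.iInter fun i => measurableSet_lt ?_ measurable_const
    exact measurable_fract.comp (by fun_prop)
  -- Discarding the complement of the corner cubes costs only the factor `lowerConst`, since integer
  -- parts push the restricted measure to a multiple of counting measure.
  refine le_trans ?_ (eLpNorm_mono_measure F (Measure.restrict_le_self (s := D)))
  have hL : lowerConst d K p ≠ ∞ := by
    unfold lowerConst
    finiteness
  refine le_of_mul_le_add_half H.const_pos (by finiteness) ?_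
  have hGm : ∀ G : (Fin d → ℤ) → ℝ≥0∞, Measurable fun y : E d => G (floorVec y) := fun G =>
    (measurable_of_countable G).comp measurable_floorVec
  have e1 : eLpNorm (fun y : E d => ENNReal.ofReal c * B (floorVec y)) p (volume.restrict D) =
      lowerConst d K p * (ENNReal.ofReal c * seqNorm p B) := by
    rw [eLpNorm_comp_floorVec_restrict h0 hK0 hK1 (fun m => ENNReal.ofReal c * B m),
      seqNorm_const_mul h0, lowerConst]
  have e2 : eLpNorm (fun y : E d => ∑' n, V (floorVec y - n) * B n) p (volume.restrict D) ≤
      lowerConst d K p * (ENNReal.ofReal (c / 2) * seqNorm p B) := by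
    rw [eLpNorm_comp_floorVec_restrict h0 hK0 hK1 (fun m => ∑' n, V (m - n) * B n)]
    exact mul_le_mul_right hconv _
  rw [mul_left_comm, ← e1, mul_left_comm (ENNReal.ofReal (c / 2))]
  refine le_trans (eLpNorm_mono_enorm_ae (g := F + fun y : E d =>
    ∑' n, V (floorVec y - n) * B n) ?_) ?_
  · filter_upwards [ae_restrict_mem hDm] with y hy
    exact hpt y hy
  · exact (eLpNorm_add_le hFm.aestronglyMeasurable
      (hGm fun m => ∑' n, V (m - n) * B n).aestronglyMeasurable hp).trans (add_le_add le_rfl e2)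

theorem IsTransferWindow.le_tlNorm [Countable ι] (H : IsTransferWindow ϕ e X K C c V)
    (hϕ : IsLittlewoodPaley ϕ) (hc : Function.Injective code) {p q : ℝ≥0∞} (hp : 1 ≤ p)
    (hq : 1 ≤ q) {s : Finset ι} {b : ι → (Fin d → ℤ) →₀ ℂ} (hb : ∀ j ∉ s, b j = 0) :
    ENNReal.ofReal (c / 2) * (lowerConst d K p * mixedNorm p q fun j => b j) ≤
      tlNorm ϕ p q (packet X (blockCentre e K code) s b) := by
  unfold tlNorm
  split_ifs with h
  · obtain ⟨rfl, hq'⟩ := h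
    have hl : lowerConst d K ∞ = 1 := by simp [lowerConst]
    rw [hl, one_mul]
    exact H.le_iSup_laverage hϕ hc hq hq' hb
  · exact H.le_eLpNorm hϕ hc hp hq hb

end

/-! ### The multiplier -/

section

variable {ι : Type} {e : E d} {K : ℕ} {code : ι → ℕ} {Z : 𝓢(E d, ℂ)} {κ : ι → (Fin d → ℤ) →₀ ℂ}

/-- The multiplier symbol `∑_j κ̂_j(ξ - c_j) Z(ξ - c_j)`. -/
noncomputable def symbol (e : E d) (K : ℕ) (code : ι → ℕ) (Z : 𝓢(E d, ℂ))
    (κ : ι → (Fin d → ℤ) →₀ ℂ) (ξ : E d) : ℂ :=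
  ∑' j, trigSum (κ j) (ξ - blockCentre e K code j) * Z (ξ - blockCentre e K code j)

theorem norm_of_cutoff_ne_zero (he1 : 1 / 2 ≤ ‖e‖) (he2 : ‖e‖ ≤ 2)
    (hZ : ∀ ζ, Z ζ ≠ 0 → 8 * ‖ζ‖ ≤ 2 ^ K) {ξ : E d} {j : ι}
    (h : Z (ξ - blockCentre e K code j) ≠ 0) :
    (3 / 8 : ℝ) * 2 ^ blockExp K code j ≤ ‖ξ‖ ∧ ‖ξ‖ ≤ 17 / 8 * 2 ^ blockExp K code j := by
  have h1 := norm_near_blockCentre (b := blockExp K code j) he1 he2 ((hZ _ h).trans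
    (pow_le_pow_right₀ one_le_two (show K ≤ blockExp K code j by unfold blockExp; lia)))
  simpa [blockCentre] using h1

theorem blockExp_sub_le (he1 : 1 / 2 ≤ ‖e‖) (he2 : ‖e‖ ≤ 2)
    (hZ : ∀ ζ, Z ζ ≠ 0 → 8 * ‖ζ‖ ≤ 2 ^ K) {ξ : E d} {k : ℤ} {j : ι}
    (h : Z ((2 : ℝ) ^ k • ξ - blockCentre e K code j) ≠ 0) (h1 : 1 / 4 ≤ ‖ξ‖) (h2 : ‖ξ‖ ≤ 4) :
    -3 ≤ (blockExp K code j : ℤ) - k ∧ (blockExp K code j : ℤ) - k ≤ 3 := by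
  obtain ⟨h3, h4⟩ := norm_of_cutoff_ne_zero he1 he2 hZ h
  have e1 : (2 : ℝ) ^ (-k) * ‖(2 : ℝ) ^ k • ξ‖ = ‖ξ‖ := by
    rw [norm_smul, Real.norm_of_nonneg (by positivity), ← mul_assoc, ← zpow_add₀ two_ne_zero]
    simp
  have := zpow_window (k := k) (A := -2) (B := 2) h3 h4 (by rw [e1]; norm_num; linarith)
    (by rw [e1]; norm_num; linarith)
  lia

/-- Overlapping cutoffs force the exponents to differ by at most `3`, whereas distinct exponents
differ by a multiple of `8`. -/
theorem cutoff_disjoint (he1 : 1 / 2 ≤ ‖e‖) (he2 : ‖e‖ ≤ 2)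
    (hZ : ∀ ζ, Z ζ ≠ 0 → 8 * ‖ζ‖ ≤ 2 ^ K) (hc : Function.Injective code) {ξ : E d} {j j' : ι}
    (h : Z (ξ - blockCentre e K code j) ≠ 0) (h' : Z (ξ - blockCentre e K code j') ≠ 0) :
    j = j' := by
  obtain ⟨h1, h2⟩ := norm_of_cutoff_ne_zero he1 he2 hZ h
  obtain ⟨h3, h4⟩ := norm_of_cutoff_ne_zero he1 he2 hZ h'
  have hp : (0 : ℝ) < 2 ^ blockExp K code j' := by positivity
  have := zpow_window (k := blockExp K code j') (A := -2) (B := 2) h1 h2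
    (by rw [zpow_neg, zpow_neg, zpow_natCast, le_inv_mul_iff₀ hp]; norm_num; linarith)
    (by rw [zpow_neg, zpow_natCast, inv_mul_le_iff₀ hp]; norm_num; linarith)
  refine hc ?_
  unfold blockExp at this
  push_cast at this
  lia

theorem symbol_eq (he1 : 1 / 2 ≤ ‖e‖) (he2 : ‖e‖ ≤ 2)
    (hZ : ∀ ζ, Z ζ ≠ 0 → 8 * ‖ζ‖ ≤ 2 ^ K) (hc : Function.Injective code) {ξ : E d} {j : ι}
    (h : Z (ξ - blockCentre e K code j) ≠ 0) :
    symbol e K code Z κ ξ =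
      trigSum (κ j) (ξ - blockCentre e K code j) * Z (ξ - blockCentre e K code j) := by
  refine tsum_eq_single j fun j' hj' => ?_
  by_contra h'
  exact hj' (cutoff_disjoint he1 he2 hZ hc (right_ne_zero_of_mul h') h)

theorem symbol_eq_zero {ξ : E d} (h : ∀ j, Z (ξ - blockCentre e K code j) = 0) :
    symbol e K code Z κ ξ = 0 := by
  simp [symbol, h]

theorem norm_symbol_le (he1 : 1 / 2 ≤ ‖e‖) (he2 : ‖e‖ ≤ 2)
    (hZ : ∀ ζ, Z ζ ≠ 0 → 8 * ‖ζ‖ ≤ 2 ^ K) (hZ1 : ∀ ζ, ‖Z ζ‖ ≤ 1) (hc : Function.Injective code)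
    {A : ℝ} (hA0 : 0 ≤ A) (hA : ∀ (j : ι) (ζ : E d), ‖trigSum (κ j) ζ‖ ≤ A) (ξ : E d) :
    ‖symbol e K code Z κ ξ‖ ≤ A := by
  by_cases h : ∃ j, Z (ξ - blockCentre e K code j) ≠ 0
  · obtain ⟨j, hj⟩ := h
    rw [symbol_eq he1 he2 hZ hc hj, norm_mul]
    exact (mul_le_mul (hA _ _) (hZ1 _) (norm_nonneg _) hA0).trans_eq (mul_one A)
  · push Not at h
    rw [symbol_eq_zero h, norm_zero]
    exact hA0

theorem measurable_symbol [Countable ι] (e : E d) (K : ℕ) (code : ι → ℕ) (Z : 𝓢(E d, ℂ))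
    (κ : ι → (Fin d → ℤ) →₀ ℂ) : Measurable (symbol e K code Z κ) := by
  unfold symbol
  refine Measurable.tsum fun j => Continuous.measurable ?_
  have := continuous_trigSum (d := d) (κ j)
  fun_prop

/-- On the support of the `j`-th packet only the `j`-th term of the symbol survives, its cutoff
equals `1` there, and products of trigonometric sums are lattice convolutions. -/
theorem symbol_mul_packetHat {X : 𝓢(E d, ℂ)} {R : ℝ} (he1 : 1 / 2 ≤ ‖e‖) (he2 : ‖e‖ ≤ 2)
    (hZ : ∀ ζ, Z ζ ≠ 0 → 8 * ‖ζ‖ ≤ 2 ^ K) (hX : ∀ ζ, X ζ ≠ 0 → ‖ζ‖ ≤ R)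
    (hZR : ∀ ζ, ‖ζ‖ ≤ R → Z ζ = 1) (hc : Function.Injective code) (s : Finset ι)
    (a : ι → (Fin d → ℤ) →₀ ℂ) (ξ : E d) :
    symbol e K code Z κ ξ * packetHat X (blockCentre e K code) s a ξ =
      packetHat X (blockCentre e K code) s (fun j => latticeConv (κ j) (a j)) ξ := by
  rw [packetHat_apply, packetHat_apply, Finset.mul_sum]
  refine Finset.sum_congr rfl fun j _ => ?_
  by_cases h : X (ξ - blockCentre e K code j) = 0
  · simp [h]
  · have h1 := hZR _ (hX _ h)
    rw [symbol_eq he1 he2 hZ hc (by rw [h1]; exact one_ne_zero), h1, trigSum_latticeConv]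
    ring

theorem hasVanishingMoments_packet {X : 𝓢(E d, ℂ)} (he1 : 1 / 2 ≤ ‖e‖) (he2 : ‖e‖ ≤ 2)
    (hX : ∀ ζ, X ζ ≠ 0 → 8 * ‖ζ‖ ≤ 2 ^ K) (s : Finset ι) (a : ι → (Fin d → ℤ) →₀ ℂ) :
    HasVanishingMoments (𝓕⁻ (packetHat X (blockCentre e K code) s a) : 𝓢(E d, ℂ)) := by
  refine hasVanishingMoments_of_fourier_eventually_eq_zero ?_
  rw [FourierTransform.fourier_fourierInv_eq]
  filter_upwards [Metric.ball_mem_nhds (0 : E d) (show (0 : ℝ) < 3 / 8 by norm_num)] with ξ hξ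
  rw [packetHat_apply]
  refine Finset.sum_eq_zero fun j _ => ?_
  by_cases h : X (ξ - blockCentre e K code j) = 0
  · simp [h]
  · have h1 := (norm_of_cutoff_ne_zero he1 he2 hX h).1
    have h2 : (1 : ℝ) ≤ 2 ^ blockExp K code j := one_le_pow₀ one_le_two
    rw [mem_ball_zero_iff] at hξ
    linarith

/-- The majorant of the kernels of a multiplier block at frequency scale `2^k`. -/
noncomputable def kernelMajorant (κ : (Fin d → ℤ) →₀ ℂ) (k : ℕ) (x : E d) : ℝ :=
  (2⁻¹ ^ k) ^ d *
    ∑ n ∈ κ.support, ‖κ n‖ * weight (2 * d + 2) ((2⁻¹ : ℝ) ^ k • x - latticePoint n)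

theorem kernelMajorant_nonneg (κ : (Fin d → ℤ) →₀ ℂ) (k : ℕ) (x : E d) :
    0 ≤ kernelMajorant κ k x :=
  mul_nonneg (by positivity) (Finset.sum_nonneg fun n _ =>
    mul_nonneg (norm_nonneg _) (weight_pos _ _).le)

/-- The substitution `ζ = 2^k ξ - c` produces the Jacobian `2^{-kd}` and the same oscillatory
kernels as for wave packets, now at scale `h = 2^{-k}`. -/
theorem fourierInv_block (a : (Fin d → ℤ) →₀ ℂ) (Z Y : 𝓢(E d, ℂ)) (c : E d) (k : ℕ) (x : E d) :
    (𝓕⁻ fun ξ : E d => trigSum a ((2 : ℝ) ^ k • ξ - c) * Z ((2 : ℝ) ^ k • ξ - c) * Y ξ) x =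
      (((2⁻¹ ^ k) ^ d : ℝ) : ℂ) * ∑ n ∈ a.support, a n *
        ((Real.fourierChar (inner ℝ ((2⁻¹ : ℝ) ^ k • c) x) : ℂ) *
          oscKernel Z Y (2⁻¹ ^ k) ((2⁻¹ : ℝ) ^ k • c) ((2⁻¹ : ℝ) ^ k • x - latticePoint n)) := by
  set h : ℝ := 2⁻¹ ^ k with hh
  have h2 : h * 2 ^ k = 1 := by
    rw [hh, ← mul_pow]
    norm_num
  have hscale : ∀ ξ : E d, h • ((2 : ℝ) ^ k • ξ) = ξ := fun ξ => by rw [smul_smul, h2, one_smul]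
  set F : E d → ℂ := fun ζ => (Real.fourierChar (inner ℝ (h • (ζ + c)) x) : ℂ) *
    (trigSum a ζ * Z ζ * Y (h • (ζ + c))) with hF
  have e1 : (𝓕⁻ fun ξ : E d => trigSum a ((2 : ℝ) ^ k • ξ - c) * Z ((2 : ℝ) ^ k • ξ - c) * Y ξ) x =
      ∫ ξ, F ((2 : ℝ) ^ k • ξ - c) := by
    rw [Real.fourierInv_eq]
    refine integral_congr_ae (Filter.Eventually.of_forall fun ξ => ?_)
    simp only [hF, sub_add_cancel, hscale, Circle.smul_def, smul_eq_mul]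
  rw [e1, Measure.integral_comp_smul volume (fun ζ => F (ζ - c)), integral_sub_right_eq_self F c,
    finrank_euclideanSpace_fin, abs_of_nonneg (by positivity), Complex.real_smul]
  have e2 : (((2 : ℝ) ^ k) ^ d)⁻¹ = h ^ d := by
    rw [hh, inv_pow, inv_pow]
  rw [e2]
  congr 1
  have e3 : ∀ ζ, F ζ = ∑ n ∈ a.support, a n *
      ((Real.fourierChar (inner ℝ (h • c) x) : ℂ) *
        ((Real.fourierChar (inner ℝ ζ (h • x - latticePoint n)) : ℂ) *
          (Z ζ * Y (h • ζ + h • c)))) := by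
    intro ζ
    simp only [hF, trigSum_eq_sum, Finset.mul_sum, Finset.sum_mul]
    refine Finset.sum_congr rfl fun n _ => ?_
    have : (Real.fourierChar (inner ℝ (h • (ζ + c)) x) : ℂ) *
        (Real.fourierChar (-inner ℝ (latticePoint n) ζ) : ℂ) =
        (Real.fourierChar (inner ℝ (h • c) x) : ℂ) *
          (Real.fourierChar (inner ℝ ζ (h • x - latticePoint n)) : ℂ) := by
      rw [← Circle.coe_mul, ← Circle.coe_mul, ← AddChar.map_add_eq_mul,
        ← AddChar.map_add_eq_mul, smul_add, inner_add_left, inner_sub_right,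
        real_inner_comm ζ (latticePoint n), inner_smul_left, inner_smul_right]
      congr 2
      simp
      ring
    rw [← smul_add h ζ c]
    linear_combination a n * Z ζ * Y (h • (ζ + c)) * this
  rw [integral_congr_ae (Filter.Eventually.of_forall e3), integral_finsetSum]
  · refine Finset.sum_congr rfl fun n _ => ?_
    rw [integral_const_mul, integral_const_mul, oscKernel, Real.fourierInv_eq]
    simp only [Circle.smul_def, smul_eq_mul]
  · intro n _
    refine Integrable.const_mul (Integrable.const_mul ?_ _) _
    obtain ⟨B, -, hB⟩ := SchwartzMap.exists_norm_le_weight Y 0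
    have hc := Real.continuous_fourierChar
    have h3 : Integrable fun ζ : E d => (Real.fourierChar (inner ℝ ζ (h • x - latticePoint n)) : ℂ) *
        Y (h • ζ + h • c) * Z ζ := by
      refine Z.integrable.bdd_mul (c := B) ?_ ?_
      · exact (by fun_prop : Continuous fun ζ : E d => (Real.fourierChar
          (inner ℝ ζ (h • x - latticePoint n)) : ℂ) * Y (h • ζ + h • c)).aestronglyMeasurable
      · refine Filter.Eventually.of_forall fun ξ => ?_
        rw [norm_mul, Circle.norm_coe, one_mul]
        simpa [weight] using hB (h • ξ + h • c)
    refine h3.congr (Filter.Eventually.of_forall fun ζ => ?_)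
    simp only
    ring

theorem IsAnnularCutoff.exists_schwartz {φ : E d → ℝ} (hφ : IsAnnularCutoff φ) :
    ∃ Y : 𝓢(E d, ℂ), ∀ ξ, Y ξ = (φ ξ : ℂ) := by
  have hc : HasCompactSupport φ :=
    HasCompactSupport.of_support_subset_isCompact (isCompact_closedBall (0 : E d) 4)
      fun ξ hξ => by simpa using (hφ.tsupport_subset (subset_tsupport _ hξ)).2
  have hc' : HasCompactSupport fun ζ => (φ ζ : ℂ) := hc.comp_left Complex.ofReal_zero
  have hs : ContDiff ℝ (⊤ : ℕ∞) fun ζ => (φ ζ : ℂ) := Complex.ofRealCLM.contDiff.comp hφ.contDiff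
  exact ⟨hc'.toSchwartzMap hs, fun ξ => rfl⟩

theorem ae_comp_smul {f g : E d → ℂ} (h : f =ᵐ[volume] g) {c : ℝ} (hc : c ≠ 0) :
    (fun ξ => f (c • ξ)) =ᵐ[volume] fun ξ => g (c • ξ) := by
  rw [Filter.EventuallyEq, ae_iff] at h ⊢
  have : {a : E d | ¬ f (c • a) = g (c • a)} = (c • ·) ⁻¹' {a | ¬ f a = g a} := rfl
  rw [this, Measure.addHaar_preimage_smul volume hc, h, mul_zero]

/-- The Herz multiplier norm of the symbol is controlled by the kernel majorants. -/
theorem exists_herzMultiplierNorm_le {φ : E d → ℝ} (hφ : IsAnnularCutoff φ)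
    (he1 : 1 / 2 ≤ ‖e‖) (he2 : ‖e‖ ≤ 2) (hK : 3 ≤ K)
    (hZ : ∀ ζ, Z ζ ≠ 0 → 8 * ‖ζ‖ ≤ 2 ^ K) (hc : Function.Injective code)
    {u t A : ℝ≥0∞} {s : ℝ} (ht : 0 < t) (hA : A ≠ ∞)
    (hκ : ∀ j k, seqNorm t (fun i : ℕ => ENNReal.ofReal ((2 : ℝ) ^ (s * i)) *
      eLpNorm (kernelMajorant (κ j) k) u (volume.restrict (annulus d i))) ≤ A)
    {m : Lp ℂ ∞ (volume : Measure (E d))} (hm : m =ᵐ[volume] symbol e K code Z κ) :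
    herzMultiplierNorm φ u s t m < ∞ := by
  obtain ⟨Y, hY⟩ := hφ.exists_schwartz
  obtain ⟨C, hC0, hC⟩ := exists_norm_oscKernel_le Z Y (2 * d + 2)
  refine lt_of_le_of_lt ?_ (ENNReal.mul_lt_top (ENNReal.ofReal_lt_top (r := C)) hA.lt_top)
  refine iSup_le fun k => ?_
  have hcongr : (𝓕⁻ fun ξ : E d => m ((2 : ℝ) ^ k • ξ) * (φ ξ : ℂ)) =
      𝓕⁻ fun ξ : E d => symbol e K code Z κ ((2 : ℝ) ^ k • ξ) * Y ξ := by
    ext x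
    refine Real.fourierInv_congr_ae ?_ x
    filter_upwards [ae_comp_smul hm (zpow_ne_zero k (two_ne_zero' ℝ))] with ξ hξ
    rw [hξ, hY]
  rw [hcongr]
  have hYs : ∀ ξ, Y ξ ≠ 0 → 1 / 4 ≤ ‖ξ‖ ∧ ‖ξ‖ ≤ 4 := by
    intro ξ hξ
    refine hφ.tsupport_subset (subset_tsupport _ ?_)
    rw [hY] at hξ
    exact_mod_cast hξ
  by_cases hj : ∃ j : ι, -3 ≤ (blockExp K code j : ℤ) - k ∧ (blockExp K code j : ℤ) - k ≤ 3
  · obtain ⟨j, hj1, hj2⟩ := hj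
    -- A scale that meets a block satisfies `k ≥ b_j - 3 ≥ K - 3 ≥ 0`, so it is a natural number.
    obtain ⟨k', rfl⟩ : ∃ k' : ℕ, k = k' := ⟨k.toNat, by unfold blockExp at hj1 hj2; lia⟩
    have hfun : (fun ξ : E d => symbol e K code Z κ ((2 : ℝ) ^ (k' : ℤ) • ξ) * Y ξ) = fun ξ =>
        trigSum (κ j) ((2 : ℝ) ^ k' • ξ - blockCentre e K code j) *
          Z ((2 : ℝ) ^ k' • ξ - blockCentre e K code j) * Y ξ := by
      ext ξ
      rw [zpow_natCast]
      by_cases hξ : Y ξ = 0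
      · simp [hξ]
      obtain ⟨h1, h2⟩ := hYs ξ hξ
      congr 1
      by_cases hz : Z ((2 : ℝ) ^ k' • ξ - blockCentre e K code j) = 0
      · rw [hz, mul_zero, symbol_eq_zero]
        intro j'
        by_contra hj'
        obtain ⟨h3, h4⟩ := blockExp_sub_le (k := k') he1 he2 hZ (by rwa [zpow_natCast]) h1 h2
        -- Both exponents lie within `3` of `k`, so they differ by at most `6`, less than the
        -- spacing `8`.
        have : j' = j := hc (by unfold blockExp at *; push_cast at *; lia)
        exact hj' (this ▸ hz)
      · exact symbol_eq he1 he2 hZ hc hz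
    rw [hfun]
    refine le_trans ?_ (mul_le_mul_right (hκ j k') _)
    rw [herzNorm, ← seqNorm_const_mul ht.ne']
    refine seqNorm_mono fun i => ?_
    rw [mul_left_comm]
    refine mul_le_mul_right ?_ _
    refine eLpNorm_le_mul_eLpNorm_of_ae_le_mul (Filter.Eventually.of_forall fun x => ?_) u
    rw [fourierInv_block, norm_mul, Complex.norm_real, Real.norm_of_nonneg (by positivity),
      Real.norm_of_nonneg (kernelMajorant_nonneg _ _ _), kernelMajorant, mul_left_comm]
    refine mul_le_mul_of_nonneg_left ?_ (by positivity)
    rw [Finset.mul_sum]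
    refine (norm_sum_le _ _).trans (Finset.sum_le_sum fun n _ => ?_)
    rw [norm_mul, norm_mul, Circle.norm_coe, one_mul, mul_left_comm]
    refine mul_le_mul_of_nonneg_left (hC _ (by positivity)
      (pow_le_one₀ (by norm_num) (by norm_num)) _ _) (norm_nonneg _)
  · have hfun : (fun ξ : E d => symbol e K code Z κ ((2 : ℝ) ^ k • ξ) * Y ξ) = 0 := by
      ext ξ
      by_cases hξ : Y ξ = 0
      · simp [hξ]
      obtain ⟨h1, h2⟩ := hYs ξ hξ
      rw [symbol_eq_zero, zero_mul, Pi.zero_apply]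
      intro j'
      by_contra hj'
      exact hj ⟨j', blockExp_sub_le he1 he2 hZ hj' h1 h2⟩
    have h0 : (𝓕⁻ fun ξ : E d => symbol e K code Z κ ((2 : ℝ) ^ k • ξ) * Y ξ) = 0 := by
      rw [hfun]
      ext x
      simp [Real.fourierInv_eq]
    rw [h0, herzNorm]
    simp [seqNorm_zero ht.ne']

end

/-! ### Herz norms of lattice kernels -/

/-- Interpolation between `L¹` and `L^∞`. -/
theorem eLpNorm_le_interpolate {α : Type*} [MeasurableSpace α] {μ : Measure α} {u M : ℝ≥0∞}
    (hu : 1 ≤ u) {f : α → ℝ≥0∞} (hf : ∀ x, f x ≤ M) (hM : M ≠ ∞) :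
    eLpNorm f u μ ≤ M ^ (1 - (u⁻¹).toReal) * (∫⁻ x, f x ∂μ) ^ (u⁻¹).toReal := by
  by_cases hut : u = ∞
  · subst hut
    simp only [eLpNorm_exponent_top, ENNReal.inv_top, ENNReal.toReal_zero, sub_zero,
      ENNReal.rpow_one, ENNReal.rpow_zero, mul_one]
    exact eLpNormEssSup_le_of_ae_enorm_bound (Filter.Eventually.of_forall hf)
  · have h0 : u ≠ 0 := (zero_lt_one.trans_le hu).ne'
    have hu1 : 1 ≤ u.toReal := by
      simpa using ENNReal.toReal_mono hut hu
    have hupos : 0 < u.toReal := by linarith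
    rw [eLpNorm_eq_lintegral_rpow_enorm_toReal h0 hut, ENNReal.toReal_inv, one_div]
    simp only [enorm_eq_self]
    have h1 : ∫⁻ x, f x ^ u.toReal ∂μ ≤ M ^ (u.toReal - 1) * ∫⁻ x, f x ∂μ := by
      have hM' : ∀ x, f x ^ u.toReal ≤ M ^ (u.toReal - 1) * f x := by
        intro x
        calc f x ^ u.toReal = f x ^ (u.toReal - 1) * f x ^ (1 : ℝ) := by
              rw [← ENNReal.rpow_add_of_nonneg _ _ (by linarith) zero_le_one, sub_add_cancel]
          _ ≤ _ := by
              rw [ENNReal.rpow_one]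
              exact mul_le_mul_left (ENNReal.rpow_le_rpow (hf x) (by linarith)) _
      exact (lintegral_mono hM').trans_eq
        (lintegral_const_mul' _ _ (ENNReal.rpow_ne_top_of_nonneg (by linarith) hM))
    calc _ ≤ (M ^ (u.toReal - 1) * ∫⁻ x, f x ∂μ) ^ (u.toReal)⁻¹ := by gcongr
      _ = _ := by
        rw [ENNReal.mul_rpow_of_nonneg _ _ (by positivity), ← ENNReal.rpow_mul]
        congr 2
        field_simp

/-- For `t ≥ 1`, a sequence that is bounded and has sum of order `L` costs only `L^{1/t}`. This is
the gain from spreading a kernel over many shells when `t > 1`. -/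
theorem seqNorm_le_interpolate {ι : Type} {t M : ℝ≥0∞} (ht : 1 ≤ t) {v : ι → ℝ≥0∞}
    (hv : ∀ i, v i ≤ M) (hM : M ≠ ∞) :
    seqNorm t v ≤ M ^ (1 - (t⁻¹).toReal) * (∑' i, v i) ^ (t⁻¹).toReal := by
  let _ : MeasurableSpace ι := ⊤
  rw [seqNorm_eq_eLpNorm (zero_lt_one.trans_le ht).ne', ← lintegral_count]
  exact eLpNorm_le_interpolate ht hv hM

/-- Two-sided geometric decay. -/
noncomputable def geomDecay (σ : ℝ) (r : ℤ) : ℝ := (2 : ℝ) ^ (-σ * |(r : ℝ)|)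

theorem geomDecay_pos (σ : ℝ) (r : ℤ) : 0 < geomDecay σ r := by
  unfold geomDecay
  positivity

theorem geomDecay_le_one {σ : ℝ} (hσ : 0 < σ) (r : ℤ) : geomDecay σ r ≤ 1 := by
  unfold geomDecay
  exact Real.rpow_le_one_of_one_le_of_nonpos one_le_two (by
    have := abs_nonneg (r : ℝ)
    nlinarith)

theorem summable_geomDecay {σ : ℝ} (hσ : 0 < σ) : Summable (geomDecay σ) := by
  have h : Summable fun n : ℕ => geomDecay σ n := by
    have h1 : ∀ n : ℕ, geomDecay σ n = ((2 : ℝ) ^ (-σ)) ^ n := by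
      intro n
      rw [geomDecay, Real.rpow_mul zero_le_two, ← Real.rpow_natCast]
      simp
    simp_rw [h1]
    exact summable_geometric_of_lt_one (by positivity)
      (Real.rpow_lt_one_of_one_lt_of_neg one_lt_two (by linarith))
  refine Summable.of_nat_of_neg h (h.congr fun n => ?_)
  simp [geomDecay]

theorem tsum_geomDecay_ne_top {σ : ℝ} (hσ : 0 < σ) :
    ∑' r, ENNReal.ofReal (geomDecay σ r) ≠ ∞ :=
  (summable_geomDecay hσ).tsum_ofReal_ne_top

theorem seqNorm_geomDecay_ne_top {t : ℝ≥0∞} (ht : 0 < t) {σ : ℝ} (hσ : 0 < σ) :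
    seqNorm t (fun r : ℤ => ENNReal.ofReal (geomDecay σ r)) ≠ ∞ := by
  by_cases htt : t = ∞
  · subst htt
    rw [seqNorm_top]
    exact ne_top_of_le_ne_top ENNReal.one_ne_top (iSup_le fun r => by
      simpa using geomDecay_le_one hσ r)
  · have htpos : 0 < t.toReal := ENNReal.toReal_pos ht.ne' htt
    rw [seqNorm_of_ne_top htt]
    refine ENNReal.rpow_ne_top_of_nonneg (by positivity) ?_
    have h : ∀ r, ENNReal.ofReal (geomDecay σ r) ^ t.toReal =
        ENNReal.ofReal (geomDecay (σ * t.toReal) r) := by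
      intro r
      rw [ENNReal.ofReal_rpow_of_pos (geomDecay_pos σ r), geomDecay, ← Real.rpow_mul zero_le_two,
        geomDecay]
      congr 2
      ring
    simp_rw [h]
    exact tsum_geomDecay_ne_top (by positivity)

/-- The `i`-th entry of the sequence defining the Herz norm. -/
noncomputable def herzEntry (u : ℝ≥0∞) (s : ℝ) (g : E d → ℝ) (i : ℕ) : ℝ≥0∞ :=
  ENNReal.ofReal ((2 : ℝ) ^ (s * i)) * eLpNorm g u (volume.restrict (annulus d i))

theorem exists_sum_weight_le (d : ℕ) : ∃ B : ℝ, 0 < B ∧ ∀ (S : Finset (Fin d → ℤ)) (y : E d),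
    ∑ n ∈ S, weight (d + 1) (y - latticePoint n) ≤ B := by
  have hS := tsum_weight_latticePoint_ne_top (d := d) (M := d + 1) (Nat.lt_succ_self d)
  set T := ∑' n : Fin d → ℤ, ENNReal.ofReal (weight (d + 1) (latticePoint n)) with hT
  refine ⟨(1 + d) ^ (d + 1) * T.toReal + 1, by positivity, fun S y => ?_⟩
  have h1 : ∑ n ∈ S, weight (d + 1) (latticePoint (floorVec y - n)) ≤ T.toReal := by
    rw [← ENNReal.ofReal_le_iff_le_toReal hS, ENNReal.ofReal_sum_of_nonneg
      (fun n _ => (weight_pos _ _).le), hT, ← (Equiv.subLeft (floorVec y)).tsum_eq]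
    exact ENNReal.sum_le_tsum S
  calc _ ≤ ∑ n ∈ S, (1 + d) ^ (d + 1) * weight (d + 1) (latticePoint (floorVec y - n)) := by
        refine Finset.sum_le_sum fun n _ => ?_
        rw [latticePoint_sub]
        exact weight_sub_floorVec_le _ _ _
    _ ≤ _ := by
        rw [← Finset.mul_sum]
        have : (1 + d : ℝ) ^ (d + 1) * ∑ n ∈ S, weight (d + 1) (latticePoint (floorVec y - n)) ≤
          (1 + d) ^ (d + 1) * T.toReal := by gcongr
        linarith

/-- The lattice points with all coordinates in `[2^l, 2^{l+1})`. -/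
noncomputable def shell (d l : ℕ) : Finset (Fin d → ℤ) :=
  Fintype.piFinset fun _ => Finset.Ico (2 ^ l) (2 ^ (l + 1))

theorem mem_shell {l : ℕ} {n : Fin d → ℤ} :
    n ∈ shell d l ↔ ∀ i, 2 ^ l ≤ n i ∧ n i < 2 ^ (l + 1) := by
  simp [shell]

theorem card_shell (d l : ℕ) : (shell d l).card = 2 ^ (l * d) := by
  have h : ((2 : ℤ) ^ (l + 1) - 2 ^ l).toNat = 2 ^ l := by
    rw [pow_succ, mul_two, add_sub_cancel_right]
    exact_mod_cast Int.toNat_natCast (2 ^ l)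
  rw [shell, Fintype.card_piFinset]
  simp [h, pow_mul]

theorem norm_latticePoint_le_of_mem_shell {l : ℕ} {n : Fin d → ℤ} (hn : n ∈ shell d l) :
    ‖latticePoint n‖ ≤ 2 * d * 2 ^ l := by
  rw [mem_shell] at hn
  have := norm_le_of_forall_abs_le (x := latticePoint n) (δ := 2 ^ (l + 1)) (by positivity)
    fun i => by
      obtain ⟨h1, h2⟩ := hn i
      rw [latticePoint_apply, abs_of_nonneg]
      · have : (n i : ℝ) < ((2 ^ (l + 1) : ℤ) : ℝ) := Int.cast_lt.2 h2
        push_cast at this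
        exact this.le
      · exact Int.cast_nonneg ((pow_pos two_pos l).le.trans h1)
  rw [pow_succ] at this
  linarith

/-- A shell lies within `2d · 2^l` of the origin, so at scale `2^l` it is indistinguishable from the
origin. -/
theorem weight_sub_shell_le (M : ℕ) {l : ℕ} {n : Fin d → ℤ} (hn : n ∈ shell d l) (y : E d) :
    weight M (y - latticePoint n) ≤ (1 + 2 * d) ^ M * weight M ((2⁻¹ : ℝ) ^ l • y) := by
  refine weight_le_of_one_add_le (by positivity) ?_
  have h1 := norm_latticePoint_le_of_mem_shell hn
  have h2 : ‖y‖ ≤ ‖y - latticePoint n‖ + ‖latticePoint n‖ := by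
    simpa using norm_add_le (y - latticePoint n) (latticePoint n)
  have h3 : (0 : ℝ) < 2⁻¹ ^ l := by positivity
  have h4 : (2⁻¹ : ℝ) ^ l ≤ 1 := pow_le_one₀ (by norm_num) (by norm_num)
  have h5 : (2⁻¹ : ℝ) ^ l * 2 ^ l = 1 := by rw [← mul_pow]; norm_num
  rw [norm_smul, Real.norm_of_nonneg h3.le]
  have h6 : (2⁻¹ : ℝ) ^ l * ‖y‖ ≤ ‖y - latticePoint n‖ + 2 * d := by
    calc (2⁻¹ : ℝ) ^ l * ‖y‖ ≤ 2⁻¹ ^ l * (‖y - latticePoint n‖ + 2 * d * 2 ^ l) := by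
          gcongr
          exact h2.trans (by gcongr)
      _ = 2⁻¹ ^ l * ‖y - latticePoint n‖ + 2 * d * (2⁻¹ ^ l * 2 ^ l) := by ring
      _ ≤ _ := by
          rw [h5, mul_one]
          gcongr
          exact mul_le_of_le_one_left (norm_nonneg _) h4
  have h7 : (0 : ℝ) ≤ 2 * d * ‖y - latticePoint n‖ := by positivity
  linarith

theorem weight_annulus_le (M : ℕ) (h i : ℕ) {x : E d} (hx : x ∈ annulus d i) :
    weight M ((2⁻¹ : ℝ) ^ h • x) ≤ 2 ^ M * ((1 + (2 : ℝ) ^ ((i : ℤ) - h)) ^ M)⁻¹ := by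
  have h3 : (0 : ℝ) < 2⁻¹ ^ h := by positivity
  have h4 : (2⁻¹ : ℝ) ^ h ≤ 1 := pow_le_one₀ (by norm_num) (by norm_num)
  have h5 : (2 : ℝ) ^ ((i : ℤ) - h) = 2⁻¹ ^ h * 2 ^ i := by
    rw [sub_eq_neg_add, zpow_add₀ two_ne_zero, zpow_neg, zpow_natCast, zpow_natCast, inv_pow]
  rw [h5, weight, ← div_eq_mul_inv, inv_eq_one_div, div_le_div_iff₀ (by positivity) (by positivity),
    one_mul, ← mul_pow]
  gcongr
  rw [norm_smul, Real.norm_of_nonneg h3.le]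
  cases i with
  -- The set `B_0` gives no lower bound on `|x|`, but there `1 + 2^{-h} ≤ 2`, so the factor `2`
  -- suffices.
  | zero =>
    have := norm_nonneg x
    rw [pow_zero, mul_one]
    nlinarith
  | succ i =>
    have := mul_le_mul_of_nonneg_left hx.1.le h3.le
    have : 0 ≤ (2⁻¹ : ℝ) ^ h * ‖x‖ := by positivity
    linarith

/-- For `r ≥ 0` the power `d + 1` of the weight beats `2^{sr}` with at least `2^{-r}` to spare,
since `s ≤ d`. For `r ≤ 0` the factor `2^{sr}` provides the estimate by itself. -/
theorem rpow_mul_weight_le_geomDecay {s : ℝ} (hs : s ≤ d) (r : ℤ) :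
    (2 : ℝ) ^ (s * r) * ((1 + (2 : ℝ) ^ r) ^ (d + 1))⁻¹ ≤ geomDecay (min s 1) r := by
  have h2 : (0 : ℝ) < 2 ^ r := by positivity
  rcases le_total 0 r with hr | hr
  · have hr' : (0 : ℝ) ≤ r := by exact_mod_cast hr
    have h3 : ((1 + (2 : ℝ) ^ r) ^ (d + 1))⁻¹ ≤ (((2 : ℝ) ^ r) ^ (d + 1))⁻¹ := by
      gcongr
      linarith
    calc (2 : ℝ) ^ (s * r) * ((1 + (2 : ℝ) ^ r) ^ (d + 1))⁻¹
        ≤ (2 : ℝ) ^ (s * r) * (((2 : ℝ) ^ r) ^ (d + 1))⁻¹ := by gcongr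
      _ = (2 : ℝ) ^ (s * r - r * (d + 1)) := by
          rw [Real.rpow_sub two_pos, div_eq_mul_inv, Real.rpow_mul zero_le_two (r : ℝ),
            Real.rpow_intCast]
          congr 2
          exact_mod_cast (Real.rpow_natCast _ (d + 1)).symm
      _ ≤ _ := by
          unfold geomDecay
          rw [abs_of_nonneg hr']
          refine Real.rpow_le_rpow_of_exponent_le one_le_two ?_
          have := min_le_right s 1
          nlinarith
  · have hr' : (r : ℝ) ≤ 0 := by exact_mod_cast hr
    calc (2 : ℝ) ^ (s * r) * ((1 + (2 : ℝ) ^ r) ^ (d + 1))⁻¹ ≤ (2 : ℝ) ^ (s * r) * 1 := by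
          gcongr
          exact inv_le_one_of_one_le₀ (one_le_pow₀ (by linarith))
      _ ≤ _ := by
          unfold geomDecay
          rw [mul_one, abs_of_nonpos hr']
          refine Real.rpow_le_rpow_of_exponent_le one_le_two ?_
          have := min_le_left s 1
          nlinarith

/-- The Herz entries of a kernel on a dyadic shell decay geometrically. -/
theorem exists_herzEntry_le (hd : 1 ≤ d) {u : ℝ≥0∞} (hu : 1 < u) {s : ℝ}
    (hs : s = d - d * (u⁻¹).toReal) :
    ∃ C : ℝ, 0 < C ∧ ∀ (l k i : ℕ) (κ : (Fin d → ℤ) →₀ ℂ) (a v : ℝ), κ.support ⊆ shell d l →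
      (∀ n, ‖κ n‖ ≤ a) → (κ.support.card : ℝ) ≤ v →
      herzEntry u s (kernelMajorant κ k) i ≤
        ENNReal.ofReal (C * (a * v ^ (u⁻¹).toReal * 2 ^ (l * s)) *
          geomDecay (min s 1) ((i : ℤ) - (k + l : ℕ))) := by
  set β := (u⁻¹).toReal with hβ
  have hβ0 : 0 ≤ β := ENNReal.toReal_nonneg
  have hβ1 : β ≤ 1 := by
    rw [hβ]
    exact ENNReal.toReal_le_of_le_ofReal zero_le_one (by simpa using hu.le)
  obtain ⟨B, hB0, hB⟩ := exists_sum_weight_le d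
  set I : ℝ := ∫ x : E d, weight (d + 1) x with hI
  have hI0 : 0 ≤ I := integral_nonneg fun x => (weight_pos _ _).le
  refine ⟨2 ^ (d + 1) * (1 + 2 * d) ^ (d + 1) * (B ^ (1 - β) * (I + 1) ^ β), by positivity, ?_⟩
  intro l k i κ a v hsupp ha hv
  have ha0 : 0 ≤ a := (norm_nonneg _).trans (ha 0)
  have hv0 : 0 ≤ v := (Nat.cast_nonneg _).trans hv
  set h : ℝ := 2⁻¹ ^ k with hh
  have hh0 : 0 < h := by positivity
  set f : E d → ℝ := fun x => ∑ n ∈ κ.support, weight (d + 1) (h • x - latticePoint n) with hf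
  have hf0 : ∀ x, 0 ≤ f x := fun x => Finset.sum_nonneg fun n _ => (weight_pos _ _).le
  -- The weight of exponent `2d + 2` is split in half: one half gives decay of the annulus relative
  -- to scale `2^{k+l}` and enters `A`, the other remains in `f` and provides integrability.
  set A : ℝ := h ^ d * (a * ((1 + 2 * d) ^ (d + 1) *
    (2 ^ (d + 1) * ((1 + (2 : ℝ) ^ ((i : ℤ) - (k + l : ℕ))) ^ (d + 1))⁻¹))) with hA
  have hA0 : 0 ≤ A := by positivity
  have hpt : ∀ x ∈ annulus d i, kernelMajorant κ k x ≤ A * f x := by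
    intro x hx
    rw [kernelMajorant, hA, mul_assoc]
    refine mul_le_mul_of_nonneg_left ?_ (by positivity)
    rw [hf, Finset.mul_sum]
    refine Finset.sum_le_sum fun n hn => ?_
    have h1 := weight_sub_shell_le (d + 1) (hsupp hn) (h • x)
    rw [smul_smul, hh, ← pow_add, add_comm l k] at h1
    have h2 := weight_annulus_le (d + 1) (k + l) i hx
    rw [show 2 * d + 2 = (d + 1) + (d + 1) by ring, weight_add, ← mul_assoc]
    have := weight_pos (d + 1) (h • x - latticePoint n)
    gcongr
    · exact ha n
    · exact h1.trans (by gcongr)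
  have hint : ∫⁻ x, ENNReal.ofReal (f x) = ENNReal.ofReal (κ.support.card * ((h ^ d)⁻¹ * I)) := by
    have hterm : ∀ n : Fin d → ℤ, Integrable fun x : E d =>
        weight (d + 1) (h • x - latticePoint n) := fun n =>
      ((integrable_weight (Nat.lt_succ_self d)).comp_sub_right (latticePoint n)).comp_smul hh0.ne'
    rw [← ofReal_integral_eq_lintegral_ofReal (integrable_finsetSum _ fun n _ => hterm n)
      (Filter.Eventually.of_forall hf0), integral_finsetSum _ fun n _ => hterm n]
    congr 1
    rw [← nsmul_eq_mul, ← Finset.sum_const]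
    refine Finset.sum_congr rfl fun n _ => ?_
    rw [Measure.integral_comp_smul volume (fun x => weight (d + 1) (x - latticePoint n)),
      integral_sub_right_eq_self (weight (d + 1)), finrank_euclideanSpace_fin,
      abs_of_nonneg (by positivity), smul_eq_mul]
  have hfn : eLpNorm f u volume ≤ ENNReal.ofReal (B ^ (1 - β) * (v * ((h ^ d)⁻¹ * (I + 1))) ^ β) := by
    have e1 : eLpNorm f u volume = eLpNorm (fun x => ENNReal.ofReal (f x)) u volume := by
      refine eLpNorm_congr_enorm_ae (Filter.Eventually.of_forall fun x => ?_)
      rw [Real.enorm_of_nonneg (hf0 x), enorm_eq_self]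
    rw [e1]
    refine (eLpNorm_le_interpolate hu.le (M := ENNReal.ofReal B) (fun x =>
      ENNReal.ofReal_le_ofReal (hB _ _)) ENNReal.ofReal_ne_top).trans ?_
    rw [hint, ← hβ, ENNReal.ofReal_rpow_of_pos hB0, ENNReal.ofReal_rpow_of_nonneg (by positivity) hβ0,
      ← ENNReal.ofReal_mul (by positivity)]
    refine ENNReal.ofReal_le_ofReal ?_
    gcongr
    linarith
  have hentry : eLpNorm (kernelMajorant κ k) u (volume.restrict (annulus d i)) ≤
      ENNReal.ofReal A * ENNReal.ofReal (B ^ (1 - β) * (v * ((h ^ d)⁻¹ * (I + 1))) ^ β) := by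
    have hm : MeasurableSet (annulus d i) := by
      cases i with
      | zero => exact measurableSet_le measurable_norm measurable_const
      | succ i =>
        have h1 : MeasurableSet {x : E d | (2 : ℝ) ^ (i + 1) < ‖x‖} :=
          measurableSet_lt measurable_const measurable_norm
        have h2 : MeasurableSet {x : E d | ‖x‖ ≤ (2 : ℝ) ^ (i + 2)} :=
          measurableSet_le measurable_norm measurable_const
        exact h1.inter h2
    refine (eLpNorm_le_mul_eLpNorm_of_ae_le_mul (g := f) (c := A) ?_ u).trans ?_
    · filter_upwards [ae_restrict_mem hm] with x hx
      rw [Real.norm_of_nonneg (kernelMajorant_nonneg _ _ _), Real.norm_of_nonneg (hf0 x)]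
      exact hpt x hx
    · gcongr
      exact (eLpNorm_mono_measure f Measure.restrict_le_self).trans hfn
  unfold herzEntry
  refine (mul_le_mul_right hentry _).trans ?_
  rw [← ENNReal.ofReal_mul hA0, ← ENNReal.ofReal_mul (by positivity)]
  refine ENNReal.ofReal_le_ofReal ?_
  have hsd : s ≤ d := by
    rw [hs]
    have : (0 : ℝ) ≤ d * β := by positivity
    linarith
  have hgd := rpow_mul_weight_le_geomDecay hsd ((i : ℤ) - (k + l : ℕ))
  set W : ℝ := ((1 + (2 : ℝ) ^ ((i : ℤ) - (k + l : ℕ))) ^ (d + 1))⁻¹ with hW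
  -- The place where `s = d - d/u` is used: the factor `2^{-kd(1 - 1/u)}` left by rescaling equals
  -- `2^{-ks}`, so the estimate depends on `i` and `k` only through `i - (k + l)`.
  have hpow : (2 : ℝ) ^ (s * i) * (h ^ d * ((h ^ d)⁻¹) ^ β) =
      2 ^ (l * s) * 2 ^ (s * (((i : ℤ) - (k + l : ℕ) : ℤ) : ℝ)) := by
    have e1 : h = (2 : ℝ) ^ (-(k : ℝ)) := by
      rw [hh, inv_pow, Real.rpow_neg zero_le_two, Real.rpow_natCast]
    have e2 : h ^ d = (2 : ℝ) ^ (-(k : ℝ) * d) := by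
      rw [e1, Real.rpow_mul zero_le_two, Real.rpow_natCast]
    rw [e2, ← Real.rpow_neg zero_le_two, ← Real.rpow_mul zero_le_two, ← Real.rpow_add two_pos,
      ← Real.rpow_add two_pos, ← Real.rpow_add two_pos]
    congr 1
    push_cast
    rw [hs]
    ring
  have hsplit : (v * ((h ^ d)⁻¹ * (I + 1))) ^ β = v ^ β * (((h ^ d)⁻¹) ^ β * (I + 1) ^ β) := by
    rw [Real.mul_rpow hv0 (by positivity), Real.mul_rpow (by positivity) (by positivity)]
  rw [hsplit, hA]
  calc _ = 2 ^ (d + 1) * (1 + 2 * d) ^ (d + 1) * (B ^ (1 - β) * (I + 1) ^ β) * (a * v ^ β) *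
        ((2 : ℝ) ^ (s * i) * (h ^ d * ((h ^ d)⁻¹) ^ β)) * W := by ring
    _ = 2 ^ (d + 1) * (1 + 2 * d) ^ (d + 1) * (B ^ (1 - β) * (I + 1) ^ β) *
        (a * v ^ β * 2 ^ (l * s)) *
        (2 ^ (s * (((i : ℤ) - (k + l : ℕ) : ℤ) : ℝ)) * W) := by rw [hpow]; ring
    _ ≤ _ := by gcongr

/-! ### From lattice blocks to multipliers -/

theorem mixedNorm_block {J : Type} {p q : ℝ≥0∞} (hq : q ≠ 0) (N : ℕ)
    (b : J → (Fin d → ℤ) →₀ ℂ) (b' : ℕ × J → (Fin d → ℤ) →₀ ℂ)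
    (h : ∀ j, b' (N, j) = b j) (h0 : ∀ i, i.1 ≠ N → b' i = 0) :
    mixedNorm p q (fun i => b' i) = mixedNorm p q fun j => b j := by
  unfold mixedNorm
  congr 1
  ext n
  rw [seqNorm_eq_comp_of_support hq _ (σ := fun j : J => (N, j)) (fun i j hij => (Prod.ext_iff.1 hij).2)]
  · simp only [h]
  · intro i hi
    have h1 : b' i = 0 := h0 i fun h1 => hi ⟨i.2, Prod.ext h1.symm rfl⟩
    simp [h1]

theorem lowerConst_ne_zero (d K : ℕ) (p : ℝ≥0∞) : lowerConst d K p ≠ 0 := by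
  unfold lowerConst
  have h : (0 : ℝ≥0∞) < ENNReal.ofReal (2⁻¹ ^ K) ^ d := by positivity
  exact (ENNReal.rpow_pos h (by finiteness)).ne'

theorem lowerConst_ne_top (d K : ℕ) (p : ℝ≥0∞) : lowerConst d K p ≠ ∞ :=
  ENNReal.rpow_ne_top_of_nonneg (by positivity) (by finiteness)

/-- A family of lattice convolution operators with uniformly bounded symbols and Herz norms, but
unbounded on mixed sequence norms, yields an unbounded multiplier. -/
theorem exists_multiplier_of_blocks (hd : 1 ≤ d) {φ : E d → ℝ} (hφ : IsAnnularCutoff φ)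
    {ϕ : 𝓢(E d, ℂ)} (hϕ : IsLittlewoodPaley ϕ) {p q u t : ℝ≥0∞} {s : ℝ} (hp : 1 ≤ p) (hq : 1 ≤ q)
    (ht : 0 < t) {J : Type} [Countable J] {A : ℝ} (hA0 : 0 ≤ A) {A' : ℝ≥0∞} (hA' : A' ≠ ∞)
    (h : ∀ N : ℕ, ∃ (κ a : J → (Fin d → ℤ) →₀ ℂ) (S : Finset J), (∀ j ∉ S, a j = 0) ∧
      (∀ j (ζ : E d), ‖trigSum (κ j) ζ‖ ≤ A) ∧
      (∀ j k, seqNorm t (herzEntry u s (kernelMajorant (κ j) k)) ≤ A') ∧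
      N * mixedNorm p q (fun j => a j) < mixedNorm p q fun j => latticeConv (κ j) (a j)) :
    ∃ m : Lp ℂ ∞ (volume : Measure (E d)),
      herzMultiplierNorm φ u s t m < ∞ ∧ ¬ IsBoundedMultiplier ϕ p q m := by
  classical
  choose κ a S ha hA hH hgap using h
  have hq0 : q ≠ 0 := (zero_lt_one.trans_le hq).ne'
  obtain ⟨e, X, R, hR, hXR, hwin⟩ := exists_transferWindow hd hϕ
  obtain ⟨Z, hZR, hZsupp, hZ1, -⟩ := exists_schwartz_cutoff (d := d) hR
  -- The cutoff `Z` lives in `|ζ| < 2R`, so `16 R < 2^{K₀}` gives the separation condition for `Z`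
  -- as well as for `X`.
  obtain ⟨K₀, hK₀⟩ := pow_unbounded_of_one_lt (16 * R) (one_lt_two (α := ℝ))
  obtain ⟨K, hK, C, c, V, H⟩ := hwin (max K₀ 3)
  have hK3 : 3 ≤ K := (le_max_right _ _).trans hK
  have hZ8 : ∀ ζ, Z ζ ≠ 0 → 8 * ‖ζ‖ ≤ 2 ^ K := by
    intro ζ hζ
    have h1 := hZsupp ζ hζ
    have h2 : (2 : ℝ) ^ K₀ ≤ 2 ^ K := pow_le_pow_right₀ one_le_two ((le_max_left _ _).trans hK)
    linarith
  -- One enumeration gives every pair of a level `N` and an index `j` its own frequency block.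
  obtain ⟨code, hcode⟩ := Countable.exists_injective_nat (ℕ × J)
  set κ' : ℕ × J → (Fin d → ℤ) →₀ ℂ := fun i => κ i.1 i.2 with hκ'
  have hbound := norm_symbol_le (κ := κ') H.le_norm H.norm_le hZ8 hZ1 hcode hA0
    fun i ζ => hA i.1 i.2 ζ
  have hmem : MemLp (symbol e K code Z κ') ∞ (volume : Measure (E d)) :=
    memLp_top_of_bound (measurable_symbol e K code Z κ').aestronglyMeasurable A
      (Filter.Eventually.of_forall hbound)
  refine ⟨hmem.toLp, exists_herzMultiplierNorm_le hφ H.le_norm H.norm_le hK3 hZ8 hcode ht hA'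
    (fun i k => hH i.1 i.2 k) hmem.coeFn_toLp, ?_⟩
  rintro ⟨C₀, hC₀⟩
  set U : ℝ≥0∞ := C₀ * upperConst d C with hU
  set D : ℝ≥0∞ := ENNReal.ofReal (c / 2) * lowerConst d K p with hD
  have hc := H.const_pos
  have hUt : U ≠ ∞ := ENNReal.mul_ne_top ENNReal.coe_ne_top (upperConst_ne_top H.const_nonneg)
  have hD0 : D ≠ 0 := mul_ne_zero (by simpa using hc) (lowerConst_ne_zero d K p)
  have hDt : D ≠ ∞ := ENNReal.mul_ne_top ENNReal.ofReal_ne_top (lowerConst_ne_top d K p)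
  -- Boundedness with constant `C₀` would give `D ‖κ * a‖ ≤ U ‖a‖` in mixed norms at every level,
  -- which the gap at a level `N > U / D` contradicts.
  obtain ⟨N, hN⟩ := ENNReal.exists_nat_gt (ENNReal.div_ne_top hUt hD0)
  set a' : ℕ × J → (Fin d → ℤ) →₀ ℂ := fun i => if i.1 = N then a N i.2 else 0 with ha'
  set S' : Finset (ℕ × J) := (S N).image fun j => (N, j) with hS'
  have hsupp : ∀ i ∉ S', a' i = 0 := by
    intro i hi
    rw [ha']
    dsimp only
    split_ifs with h1
    · refine ha N i.2 fun h2 => hi ?_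
      rw [hS', Finset.mem_image]
      exact ⟨i.2, h2, Prod.ext h1.symm rfl⟩
    · rfl
  have hXsupp : ∀ ζ, X ζ ≠ 0 → 8 * ‖ζ‖ ≤ 2 ^ K := H.norm_support
  have hop : multiplierOp hmem.toLp (𝓕⁻ (packetHat X (blockCentre e K code) S' a') : 𝓢(E d, ℂ)) =
      packet X (blockCentre e K code) S' fun i => latticeConv (κ' i) (a' i) := by
    refine multiplierOp_eq ?_
    filter_upwards [hmem.coeFn_toLp] with ξ hξ
    rw [hξ, FourierTransform.fourier_fourierInv_eq,
      symbol_mul_packetHat H.le_norm H.norm_le hZ8 hXR hZR hcode]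
  have h1 := hC₀ _ (hasVanishingMoments_packet (code := code) H.le_norm H.norm_le hXsupp S' a')
  rw [hop] at h1
  have h2 : D * mixedNorm p q (fun j => latticeConv (κ N j) (a N j)) ≤
      U * mixedNorm p q fun j => a N j := by
    calc _ = ENNReal.ofReal (c / 2) * (lowerConst d K p *
          mixedNorm p q fun i => latticeConv (κ' i) (a' i)) := by
          rw [mixedNorm_block hq0 N (fun j => latticeConv (κ N j) (a N j))
            (fun i => latticeConv (κ' i) (a' i)) (fun j => by simp [κ', a'])
            (fun i hi => by simp [a', hi]), hD, mul_assoc]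
      _ ≤ _ := H.le_tlNorm hϕ hcode hp hq fun i hi => by simp [hsupp i hi]
      _ ≤ _ := h1
      _ ≤ C₀ * (upperConst d C * mixedNorm p q fun i => a' i) := by
          gcongr
          exact H.tlNorm_le hϕ hcode hp hq S' a'
      _ = _ := by
          rw [mixedNorm_block hq0 N (fun j => a N j) a' (fun j => by simp [a'])
            (fun i hi => by simp [a', hi]), hU, mul_assoc]
  have h3 : D * (N * mixedNorm p q (fun j => a N j)) < U * mixedNorm p q fun j => a N j :=
    ((ENNReal.mul_lt_mul_iff_right hD0 hDt).2 (hgap N)).trans_le h2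
  refine h3.not_ge ?_
  rw [← mul_assoc]
  gcongr
  rw [mul_comm]
  exact (ENNReal.div_le_iff hD0 hDt).1 hN.le

/-- Subcritical Herz norms are controlled by critical ones. -/
theorem herzMultiplierNorm_lt_top_of_lt {φ : E d → ℝ} {u t : ℝ≥0∞} {s s' : ℝ} (ht : 0 < t)
    (hs : s < s') {m : Lp ℂ ∞ (volume : Measure (E d))}
    (h : herzMultiplierNorm φ u s' ∞ m < ∞) : herzMultiplierNorm φ u s t m < ∞ := by
  have hσ : 0 < s' - s := by linarith
  have hG := seqNorm_geomDecay_ne_top ht hσ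
  refine lt_of_le_of_lt (iSup_le fun k => ?_) (ENNReal.mul_lt_top h hG.lt_top)
  have h1 := le_iSup (fun k : ℤ => herzNorm u s' ∞
    (𝓕⁻ fun ξ : E d => m ((2 : ℝ) ^ k • ξ) * (φ ξ : ℂ))) k
  refine le_trans ?_ (mul_le_mul_left h1 _)
  have h2 := seqNorm_comp_injective_le (q := t)
    (fun r : ℤ => ENNReal.ofReal (geomDecay (s' - s) r)) (σ := fun n : ℕ => (n : ℤ)) Nat.cast_injective
  refine le_trans ?_ (mul_le_mul_right h2 _)
  rw [← seqNorm_const_mul ht.ne', herzNorm]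
  refine seqNorm_mono fun i => ?_
  have h3 := le_seqNorm ENNReal.top_ne_zero (fun k' : ℕ => ENNReal.ofReal ((2 : ℝ) ^ (s' * k')) *
    eLpNorm (𝓕⁻ fun ξ : E d => m ((2 : ℝ) ^ k • ξ) * (φ ξ : ℂ)) u
      (volume.restrict (annulus d k'))) i
  refine le_trans (le_of_eq ?_) (mul_le_mul_left h3 _)
  rw [mul_right_comm, ← ENNReal.ofReal_mul (by positivity), geomDecay, ← Real.rpow_add two_pos]
  congr 3
  simp
  ring

/-! ### Dyadic densities -/

theorem seqNorm_of_support_singleton {ι : Type} {q : ℝ≥0∞} (h0 : q ≠ 0) {a : ι → ℝ≥0∞} {m : ι}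
    (ha : ∀ i, i ≠ m → a i = 0) : seqNorm q a = a m := by
  rw [seqNorm_eq_comp_of_support h0 a (σ := fun _ : Unit => m) (fun _ _ _ => rfl)
    fun i hi => ha i fun h => hi ⟨(), h.symm⟩]
  have h := seqNorm_indicator_const h0 ({()} : Finset Unit) (Finset.singleton_nonempty _) (a m)
  simpa using h

theorem exists_nat_mul_rpow_lt_real {θ₁ θ₂ : ℝ} (h : θ₁ < θ₂) (N : ℕ) :
    ∃ L : ℕ, 1 ≤ L ∧ (N : ℝ) * (L : ℝ) ^ θ₁ < (L : ℝ) ^ θ₂ := by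
  have ht : Filter.Tendsto (fun L : ℕ => (L : ℝ) ^ (θ₂ - θ₁)) Filter.atTop Filter.atTop :=
    (tendsto_rpow_atTop (by linarith)).comp tendsto_natCast_atTop_atTop
  obtain ⟨L, hL1, hL⟩ := ((Filter.eventually_ge_atTop 1).and (ht.eventually_gt_atTop (N : ℝ))).exists
  refine ⟨L, hL1, ?_⟩
  have hL0 : (0 : ℝ) < L := by exact_mod_cast hL1
  calc (N : ℝ) * (L : ℝ) ^ θ₁ < (L : ℝ) ^ (θ₂ - θ₁) * (L : ℝ) ^ θ₁ := by gcongr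
    _ = _ := by rw [← Real.rpow_add hL0, sub_add_cancel]

theorem exists_nat_mul_rpow_lt {θ₁ θ₂ : ℝ} (h : θ₁ < θ₂) (N : ℕ) :
    ∃ L : ℕ, 1 ≤ L ∧ (N : ℝ≥0∞) * (L : ℝ≥0∞) ^ θ₁ < (L : ℝ≥0∞) ^ θ₂ := by
  obtain ⟨L, hL1, hL⟩ := exists_nat_mul_rpow_lt_real h N
  refine ⟨L, hL1, ?_⟩
  have hL0 : (0 : ℝ) < L := by exact_mod_cast hL1
  have h2 := (ENNReal.ofReal_lt_ofReal_iff (by positivity)).2 hL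
  rwa [ENNReal.ofReal_mul (by positivity), ← ENNReal.ofReal_rpow_of_pos hL0,
    ← ENNReal.ofReal_rpow_of_pos hL0, ENNReal.ofReal_natCast, ENNReal.ofReal_natCast] at h2

theorem eq_of_mem_shell (hd : 1 ≤ d) {l l' : ℕ} {n : Fin d → ℤ} (h : n ∈ shell d l)
    (h' : n ∈ shell d l') : l = l' := by
  obtain ⟨h1, h2⟩ := mem_shell.1 h ⟨0, hd⟩
  obtain ⟨h3, h4⟩ := mem_shell.1 h' ⟨0, hd⟩
  have h5 := (pow_lt_pow_iff_right₀ (one_lt_two (α := ℤ))).1 (h1.trans_lt h4)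
  have h6 := (pow_lt_pow_iff_right₀ (one_lt_two (α := ℤ))).1 (h3.trans_lt h2)
  lia

/-- The density equal to `2^{-ld}` on the `l`-th shell, `l < L`. -/
noncomputable def shellDensity (d L : ℕ) (n : Fin d → ℤ) : ℝ :=
  ∑ l ∈ Finset.range L, if n ∈ shell d l then ((2 : ℝ) ^ (l * d))⁻¹ else 0

theorem shellDensity_of_mem (hd : 1 ≤ d) {L l : ℕ} (hl : l < L) {n : Fin d → ℤ}
    (hn : n ∈ shell d l) : shellDensity d L n = ((2 : ℝ) ^ (l * d))⁻¹ := by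
  rw [shellDensity, Finset.sum_eq_single_of_mem l (Finset.mem_range.2 hl), if_pos hn]
  intro l' _ hne
  exact if_neg fun h => hne (eq_of_mem_shell hd h hn)

theorem exists_of_shellDensity_ne_zero {L : ℕ} {n : Fin d → ℤ} (h : shellDensity d L n ≠ 0) :
    ∃ l < L, n ∈ shell d l := by
  obtain ⟨l, hl, h1⟩ := Finset.exists_ne_zero_of_sum_ne_zero h
  exact ⟨l, Finset.mem_range.1 hl, by by_contra h2; exact h1 (if_neg h2)⟩

theorem shellDensity_nonneg (L : ℕ) (n : Fin d → ℤ) : 0 ≤ shellDensity d L n :=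
  Finset.sum_nonneg fun l _ => by positivity

theorem tsum_shellDensity (d L : ℕ) : ∑' n, ENNReal.ofReal (shellDensity d L n) = L := by
  have h : ∀ n, ENNReal.ofReal (shellDensity d L n) = ∑ l ∈ Finset.range L,
      ENNReal.ofReal (if n ∈ shell d l then ((2 : ℝ) ^ (l * d))⁻¹ else 0) := fun n =>
    ENNReal.ofReal_sum_of_nonneg fun l _ => by positivity
  simp_rw [h]
  rw [Summable.tsum_finsetSum fun _ _ => ENNReal.summable]
  have h2 : ∀ l, ∑' n, ENNReal.ofReal (if n ∈ shell d l then ((2 : ℝ) ^ (l * d))⁻¹ else 0) = 1 := by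
    intro l
    rw [tsum_eq_sum (s := shell d l) fun n hn => by simp [hn]]
    rw [Finset.sum_congr rfl fun n hn => by rw [if_pos hn], Finset.sum_const, card_shell,
      nsmul_eq_mul, ENNReal.ofReal_inv_of_pos (by positivity), ENNReal.ofReal_pow zero_le_two,
      ENNReal.ofReal_ofNat]
    push_cast
    exact ENNReal.mul_inv_cancel (by positivity) (by finiteness)
  simp [h2]

/-- A power of the dyadic density, restricted to its support. -/
noncomputable def densityPow (d L : ℕ) (θ : ℝ) (n : Fin d → ℤ) : ℝ :=
  if shellDensity d L n = 0 then 0 else shellDensity d L n ^ θ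

theorem densityPow_nonneg (L : ℕ) (θ : ℝ) (n : Fin d → ℤ) : 0 ≤ densityPow d L θ n := by
  have := shellDensity_nonneg L n
  unfold densityPow
  positivity

theorem densityPow_mul (L : ℕ) (θ₁ θ₂ : ℝ) (n : Fin d → ℤ) :
    densityPow d L θ₁ n * densityPow d L θ₂ n = densityPow d L (θ₁ + θ₂) n := by
  unfold densityPow
  split_ifs with h
  · simp
  · rw [Real.rpow_add ((shellDensity_nonneg L n).lt_of_ne' h)]

theorem densityPow_one (L : ℕ) (n : Fin d → ℤ) : densityPow d L 1 n = shellDensity d L n := by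
  unfold densityPow
  split_ifs with h
  · exact h.symm
  · exact Real.rpow_one _

theorem shellDensity_le_one (hd : 1 ≤ d) (L : ℕ) (n : Fin d → ℤ) : shellDensity d L n ≤ 1 := by
  by_cases h : shellDensity d L n = 0
  · rw [h]
    exact zero_le_one
  · obtain ⟨l, hl, hn⟩ := exists_of_shellDensity_ne_zero h
    rw [shellDensity_of_mem hd hl hn]
    exact inv_le_one_of_one_le₀ (one_le_pow₀ one_le_two)

theorem densityPow_le_one (hd : 1 ≤ d) (L : ℕ) {θ : ℝ} (hθ : 0 ≤ θ) (n : Fin d → ℤ) :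
    densityPow d L θ n ≤ 1 := by
  unfold densityPow
  split_ifs
  · exact zero_le_one
  · exact Real.rpow_le_one (shellDensity_nonneg L n) (shellDensity_le_one hd L n) hθ

/-- Each of the `L` shells has mass one for the density, so its `1/p`-th power has `ℓ^p` norm
`L^{1/p}`. For `p = ∞` the power must be the indicator of the support, hence the separate zero
branch of `densityPow`. -/
theorem seqNorm_densityPow (hd : 1 ≤ d) {L : ℕ} (hL : 1 ≤ L) {p : ℝ≥0∞} (h0 : p ≠ 0) :
    seqNorm p (fun n => ENNReal.ofReal (densityPow d L (p⁻¹).toReal n)) =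
      (L : ℝ≥0∞) ^ (p⁻¹).toReal := by
  by_cases hp : p = ∞
  · subst hp
    simp only [seqNorm_top, ENNReal.inv_top, ENNReal.toReal_zero, ENNReal.rpow_zero]
    refine le_antisymm (iSup_le fun n => ?_) ?_
    · simpa using densityPow_le_one hd L le_rfl n
    · have h1 : (fun _ => 2 ^ 0 : Fin d → ℤ) ∈ shell d 0 := mem_shell.2 fun _ => by simp
      refine le_trans (le_of_eq ?_) (le_iSup _ (fun _ => 2 ^ 0 : Fin d → ℤ))
      rw [densityPow, shellDensity_of_mem hd hL h1]
      simp
  · have hpos : 0 < p.toReal := ENNReal.toReal_pos h0 hp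
    rw [seqNorm_of_ne_top hp, ENNReal.toReal_inv, one_div, ← tsum_shellDensity d L]
    congr 2
    ext n
    rw [ENNReal.ofReal_rpow_of_nonneg (densityPow_nonneg _ _ _) hpos.le]
    congr 1
    unfold densityPow
    split_ifs with h
    · rw [h, Real.zero_rpow hpos.ne']
    · rw [← Real.rpow_mul (shellDensity_nonneg L n), inv_mul_cancel₀ hpos.ne', Real.rpow_one]

/-! ### Lattice kernels -/

/-- The restriction of a function to a finite set of lattice points. -/
noncomputable def latticeKernel (S : Finset (Fin d → ℤ)) (f : (Fin d → ℤ) → ℂ) :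
    (Fin d → ℤ) →₀ ℂ := Finsupp.indicator S fun n _ => f n

theorem latticeKernel_apply (S : Finset (Fin d → ℤ)) (f : (Fin d → ℤ) → ℂ) (n : Fin d → ℤ) :
    latticeKernel S f n = if n ∈ S then f n else 0 := by
  rw [latticeKernel, Finsupp.indicator_apply]
  rfl

theorem support_latticeKernel_subset (S : Finset (Fin d → ℤ)) (f : (Fin d → ℤ) → ℂ) :
    (latticeKernel S f).support ⊆ S := by
  intro n hn
  rw [Finsupp.mem_support_iff, latticeKernel_apply] at hn
  by_contra h
  exact hn (if_neg h)

theorem latticeConv_latticeKernel (S : Finset (Fin d → ℤ)) (f : (Fin d → ℤ) → ℂ)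
    (a : (Fin d → ℤ) →₀ ℂ) (n : Fin d → ℤ) :
    latticeConv (latticeKernel S f) a n = ∑ r ∈ S, f r * a (n - r) := by
  rw [latticeConv_apply, Finset.sum_subset (support_latticeKernel_subset S f) fun r _ hr => by
    rw [Finsupp.notMem_support_iff.1 hr, zero_mul]]
  exact Finset.sum_congr rfl fun r hr => by rw [latticeKernel_apply, if_pos hr]

theorem trigSum_latticeKernel (S : Finset (Fin d → ℤ)) (f : (Fin d → ℤ) → ℂ) (ζ : E d) :
    trigSum (latticeKernel S f) ζ =
      ∑ n ∈ S, f n * (Real.fourierChar (-inner ℝ (latticePoint n) ζ) : ℂ) := by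
  rw [trigSum_eq_sum, Finset.sum_subset (support_latticeKernel_subset S f) fun r _ hr => by
    rw [Finsupp.notMem_support_iff.1 hr, zero_mul]]
  exact Finset.sum_congr rfl fun r hr => by rw [latticeKernel_apply, if_pos hr]

theorem norm_trigSum_latticeKernel_le (S : Finset (Fin d → ℤ)) (f : (Fin d → ℤ) → ℂ) (ζ : E d) :
    ‖trigSum (latticeKernel S f) ζ‖ ≤ ∑ n ∈ S, ‖f n‖ := by
  rw [trigSum_latticeKernel]
  refine (norm_sum_le _ _).trans (Finset.sum_le_sum fun n _ => ?_)
  rw [norm_mul, Circle.norm_coe, mul_one]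

/-- The assumption `u > 1` makes the critical smoothness positive; this is the rate at which Herz
entries decay towards small annuli. -/
theorem critical_pos {u : ℝ≥0∞} (hd : 1 ≤ d) (hu : 1 < u) {s : ℝ}
    (hs : s = d - d * (u⁻¹).toReal) : 0 < min s 1 := by
  refine lt_min ?_ one_pos
  have h1 : (u⁻¹).toReal < 1 := by
    have h2 : u⁻¹ < 1 := ENNReal.inv_lt_one.2 hu
    simpa using (ENNReal.toReal_lt_toReal h2.ne_top ENNReal.one_ne_top).2 h2
  have h3 : (0 : ℝ) < d := by exact_mod_cast hd
  rw [hs]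
  nlinarith

/-- Normalized kernels on a dyadic shell have uniformly bounded Herz norms. -/
theorem exists_seqNorm_herzEntry_le (hd : 1 ≤ d) {u t : ℝ≥0∞} (hu : 1 < u) (ht : 0 < t) {s : ℝ}
    (hs : s = d - d * (u⁻¹).toReal) :
    ∃ A : ℝ≥0∞, A ≠ ∞ ∧ ∀ (l k : ℕ) (κ : (Fin d → ℤ) →₀ ℂ) (a v : ℝ), κ.support ⊆ shell d l →
      (∀ n, ‖κ n‖ ≤ a) → (κ.support.card : ℝ) ≤ v → a * v ^ (u⁻¹).toReal * 2 ^ (l * s) ≤ 1 →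
      seqNorm t (herzEntry u s (kernelMajorant κ k)) ≤ A := by
  obtain ⟨C, hC, h⟩ := exists_herzEntry_le hd hu hs
  have hσ := critical_pos hd hu hs
  refine ⟨ENNReal.ofReal C * seqNorm t fun r : ℤ => ENNReal.ofReal (geomDecay (min s 1) r),
    ENNReal.mul_ne_top ENNReal.ofReal_ne_top (seqNorm_geomDecay_ne_top ht hσ), ?_⟩
  intro l k κ a v hsupp ha hv hav
  have h1 := seqNorm_comp_injective_le (q := t)
    (fun r : ℤ => ENNReal.ofReal (geomDecay (min s 1) r))
    (σ := fun i : ℕ => (i : ℤ) - (k + l : ℕ)) fun i i' hi => by simpa using hi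
  refine le_trans ?_ (mul_le_mul_right h1 _)
  rw [← seqNorm_const_mul ht.ne']
  refine seqNorm_mono fun i => (h l k i κ a v hsupp ha hv).trans ?_
  rw [← ENNReal.ofReal_mul hC.le]
  refine ENNReal.ofReal_le_ofReal ?_
  have := geomDecay_pos (min s 1) ((i : ℤ) - (k + l : ℕ))
  have : C * (a * v ^ (u⁻¹).toReal * 2 ^ (l * s)) ≤ C * 1 := by gcongr
  rw [mul_one] at this
  gcongr

/-! ### Unbounded families of averages and translations -/

/-- The average over a dyadic shell. -/
noncomputable def shellAverage (d l : ℕ) : (Fin d → ℤ) →₀ ℂ :=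
  latticeKernel (shell d l) fun _ => (((2 : ℝ) ^ (l * d))⁻¹ : ℝ)

theorem norm_trigSum_shellAverage_le (l : ℕ) (ζ : E d) : ‖trigSum (shellAverage d l) ζ‖ ≤ 1 := by
  refine (norm_trigSum_latticeKernel_le _ _ _).trans (le_of_eq ?_)
  rw [Finset.sum_const, card_shell, Complex.norm_real, Real.norm_of_nonneg (by positivity),
    nsmul_eq_mul]
  push_cast
  exact mul_inv_cancel₀ (by positivity)

/-- A kernel of size `ε 2^{-ld}` on the `2^{ld}` points of a shell has critical Herz size exactly
`ε`, independently of `l`. -/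
theorem shell_critical {u : ℝ≥0∞} {s : ℝ} (hs : s = d - d * (u⁻¹).toReal) (l : ℕ) (ε : ℝ) :
    ε * ((2 : ℝ) ^ (l * d))⁻¹ * ((2 : ℝ) ^ (l * d)) ^ (u⁻¹).toReal * 2 ^ (l * s) = ε := by
  have e : (2 : ℝ) ^ (l * d) = (2 : ℝ) ^ ((l : ℝ) * d) := by
    exact_mod_cast (Real.rpow_natCast 2 (l * d)).symm
  rw [e, ← Real.rpow_neg zero_le_two, ← Real.rpow_mul zero_le_two, mul_assoc, mul_assoc,
    ← Real.rpow_add two_pos, ← Real.rpow_add two_pos, hs]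
  convert mul_one ε using 2
  convert Real.rpow_zero (2 : ℝ) using 2
  ring

theorem exists_seqNorm_shellAverage_le (hd : 1 ≤ d) {u t : ℝ≥0∞} (hu : 1 < u) (ht : 0 < t) {s : ℝ}
    (hs : s = d - d * (u⁻¹).toReal) : ∃ A : ℝ≥0∞, A ≠ ∞ ∧ ∀ l k,
      seqNorm t (herzEntry u s (kernelMajorant (shellAverage d l) k)) ≤ A := by
  obtain ⟨A, hA, h⟩ := exists_seqNorm_herzEntry_le hd hu ht hs
  refine ⟨A, hA, fun l k => h l k _ ((2 : ℝ) ^ (l * d))⁻¹ ((2 : ℝ) ^ (l * d))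
    (support_latticeKernel_subset _ _) (fun n => ?_) ?_ (le_of_eq ?_)⟩
  · rw [shellAverage, latticeKernel_apply]
    split_ifs
    · rw [Complex.norm_real, Real.norm_of_nonneg (by positivity)]
    · rw [norm_zero]
      positivity
  · have := Finset.card_le_card (support_latticeKernel_subset (shell d l) fun _ =>
      ((((2 : ℝ) ^ (l * d))⁻¹ : ℝ) : ℂ))
    rw [card_shell] at this
    unfold shellAverage
    exact_mod_cast this
  · simpa using shell_critical hs l 1

theorem mixedNorm_of_support_singleton {J : Type} {p q : ℝ≥0∞} (hp : p ≠ 0) (hq : q ≠ 0)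
    {b : J → (Fin d → ℤ) → ℂ} {m : Fin d → ℤ} (h : ∀ j n, n ≠ m → b j n = 0) :
    mixedNorm p q b = seqNorm q fun j => ‖b j m‖ₑ :=
  seqNorm_of_support_singleton (a := fun n => seqNorm q fun j => ‖b j n‖ₑ) hp fun n hn => by
    simp [h _ n hn, seqNorm_zero hq]

theorem le_mixedNorm {J : Type} {p q : ℝ≥0∞} (hp : p ≠ 0) (b : J → (Fin d → ℤ) → ℂ)
    (m : Fin d → ℤ) : seqNorm q (fun j => ‖b j m‖ₑ) ≤ mixedNorm p q b :=
  le_seqNorm hp (fun n => seqNorm q fun j => ‖b j n‖ₑ) m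

theorem seqNorm_le_mixedNorm {J : Type} {p q : ℝ≥0∞} (hq : q ≠ 0) (b : J → (Fin d → ℤ) → ℂ)
    (σ : (Fin d → ℤ) → J) : seqNorm p (fun n => ‖b (σ n) n‖ₑ) ≤ mixedNorm p q b :=
  seqNorm_mono fun n => le_seqNorm hq (fun j => ‖b j n‖ₑ) (σ n)

theorem enorm_ofReal_of_nonneg {x : ℝ} (hx : 0 ≤ x) : ‖(x : ℂ)‖ₑ = ENNReal.ofReal x := by
  rw [← ofReal_norm, Complex.norm_real, Real.norm_of_nonneg hx]

theorem latticeConv_single_right (κ : (Fin d → ℤ) →₀ ℂ) (n : Fin d → ℤ) :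
    latticeConv κ (Finsupp.single 0 1) n = κ n := by
  rw [latticeConv_apply]
  by_cases h : n ∈ κ.support
  · rw [Finset.sum_eq_single_of_mem n h fun r _ hr => by
      rw [Finsupp.single_apply, if_neg fun h => hr (sub_eq_zero.1 h.symm).symm, mul_zero]]
    simp
  · rw [Finsupp.notMem_support_iff.1 h]
    refine Finset.sum_eq_zero fun r hr => ?_
    rw [Finsupp.single_apply, if_neg, mul_zero]
    intro h1
    exact h ((sub_eq_zero.1 h1.symm) ▸ hr)

/-- All `L` inputs are the point mass at the origin, of joint norm `L^{1/q}`. The outputs are the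
normalized indicators of disjoint shells, whose `ℓ^1` norms add up to `L`. -/
theorem exists_shellAverage_gap_one (hd : 1 ≤ d) {q : ℝ≥0∞} (hq : 1 < q) (N : ℕ) :
    ∃ (a : ℕ → (Fin d → ℤ) →₀ ℂ) (S : Finset ℕ), (∀ j ∉ S, a j = 0) ∧
      N * mixedNorm 1 q (fun j => a j) < mixedNorm 1 q fun j => latticeConv (shellAverage d j) (a j) := by
  have hq0 : q ≠ 0 := (zero_lt_one.trans hq).ne'
  obtain ⟨L, hL, hN⟩ := exists_nat_mul_rpow_lt (θ₁ := (q⁻¹).toReal) (θ₂ := 1)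
    (by
      have h2 : q⁻¹ < 1 := ENNReal.inv_lt_one.2 hq
      simpa using (ENNReal.toReal_lt_toReal h2.ne_top ENNReal.one_ne_top).2 h2) N
  refine ⟨fun l => if l ∈ Finset.range L then Finsupp.single 0 1 else 0, Finset.range L,
    fun j hj => if_neg hj, ?_⟩
  have h1 : mixedNorm 1 q (fun l => ((if l ∈ Finset.range L then Finsupp.single 0 1 else 0 :
      (Fin d → ℤ) →₀ ℂ) : (Fin d → ℤ) → ℂ)) = (L : ℝ≥0∞) ^ (q⁻¹).toReal := by
    rw [mixedNorm_of_support_singleton (m := 0) one_ne_zero hq0]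
    · have h2 := seqNorm_indicator_const hq0 (Finset.range L)
        (Finset.nonempty_range_iff.2 (by lia)) 1
      rw [Finset.card_range, one_mul, one_div, ← ENNReal.toReal_inv] at h2
      rw [← h2]
      congr 1
      ext l
      split_ifs <;> simp
    · intro l n hn
      split_ifs
      · exact Finsupp.single_eq_of_ne hn
      · rfl
  rw [h1]
  refine hN.trans_le ?_
  have h3 := seqNorm_densityPow hd hL (one_ne_zero (α := ℝ≥0∞))
  simp only [inv_one, ENNReal.toReal_one, densityPow_one] at h3
  rw [← h3]
  refine seqNorm_mono fun n => ?_
  by_cases h : shellDensity d L n = 0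
  · simp [h]
  · obtain ⟨l, hl, hn⟩ := exists_of_shellDensity_ne_zero h
    refine le_trans (le_of_eq ?_) (le_seqNorm hq0 _ l)
    simp only [Finset.mem_range, hl, if_true]
    rw [latticeConv_single_right, shellAverage, latticeKernel_apply, if_pos hn,
      enorm_ofReal_of_nonneg (by positivity), shellDensity_of_mem hd hl hn]

/-- The inputs are indicators of the reflected shells. These are disjoint, so the joint norm is at
most one, while all `L` averages equal one at the origin. -/
theorem exists_shellAverage_gap_top (hd : 1 ≤ d) {q : ℝ≥0∞} (hq : 1 ≤ q) (hq' : q ≠ ∞) (N : ℕ) :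
    ∃ (a : ℕ → (Fin d → ℤ) →₀ ℂ) (S : Finset ℕ), (∀ j ∉ S, a j = 0) ∧
      N * mixedNorm ∞ q (fun j => a j) < mixedNorm ∞ q fun j => latticeConv (shellAverage d j) (a j) := by
  have hq0 : q ≠ 0 := (zero_lt_one.trans_le hq).ne'
  obtain ⟨L, hL, hN⟩ := exists_nat_mul_rpow_lt (θ₁ := 0) (θ₂ := (q⁻¹).toReal)
    (ENNReal.toReal_pos (by simpa using hq') (by simpa using hq0)) N
  rw [ENNReal.rpow_zero, mul_one] at hN
  refine ⟨fun l => if l ∈ Finset.range L then latticeKernel ((shell d l).image Neg.neg) fun _ => 1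
    else 0, Finset.range L, fun j hj => if_neg hj, ?_⟩
  have hmem : ∀ (l : ℕ) (n : Fin d → ℤ), n ∈ (shell d l).image Neg.neg ↔ -n ∈ shell d l := by
    intro l n
    simp [neg_eq_iff_eq_neg]
  have h1 : mixedNorm ∞ q (fun l => ((if l ∈ Finset.range L then
      latticeKernel ((shell d l).image Neg.neg) fun _ => 1 else 0 :
      (Fin d → ℤ) →₀ ℂ) : (Fin d → ℤ) → ℂ)) ≤ 1 := by
    unfold mixedNorm
    rw [seqNorm_top]
    refine iSup_le fun n => ?_
    by_cases h : ∃ l, -n ∈ shell d l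
    · obtain ⟨l, hl⟩ := h
      rw [seqNorm_of_support_singleton (m := l) hq0]
      · dsimp only
        split_ifs
        · rw [latticeKernel_apply]
          split_ifs <;> simp
        · simp
      · intro l' hl'
        dsimp only
        split_ifs
        · rw [latticeKernel_apply, if_neg, enorm_zero]
          rw [hmem]
          exact fun h => hl' (eq_of_mem_shell hd h hl)
        · simp
    · push Not at h
      refine le_of_eq_of_le ?_ zero_le_one
      rw [← seqNorm_zero hq0 (ι := ℕ)]
      congr 1
      ext l
      dsimp only
      split_ifs
      · rw [latticeKernel_apply, if_neg (by rw [hmem]; exact h l), enorm_zero]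
      · simp
  calc _ ≤ (N : ℝ≥0∞) * 1 := by gcongr
    _ < (L : ℝ≥0∞) ^ (q⁻¹).toReal := by rwa [mul_one]
    _ ≤ _ := ?_
  refine le_trans ?_ (le_mixedNorm ENNReal.top_ne_zero _ 0)
  have h2 := seqNorm_indicator_const hq0 (Finset.range L)
    (Finset.nonempty_range_iff.2 (by lia)) 1
  rw [Finset.card_range, one_mul, one_div, ← ENNReal.toReal_inv] at h2
  rw [← h2]
  refine seqNorm_mono fun l => ?_
  split_ifs with hl
  · dsimp only
    rw [if_pos hl, shellAverage, latticeConv_latticeKernel, Finset.sum_congr rfl fun r hr => by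
      rw [latticeKernel_apply, if_pos ((hmem _ _).2 (by simpa using hr)), mul_one],
      Finset.sum_const, card_shell, nsmul_eq_mul]
    push_cast
    rw [mul_inv_cancel₀ (pow_ne_zero _ two_ne_zero), enorm_one]
  · simp

/-- A translation weighted by a power of the dyadic density. -/
noncomputable def shellTranslation (d L : ℕ) (γ : ℝ) (r : Fin d → ℤ) : (Fin d → ℤ) →₀ ℂ :=
  latticeKernel {r} fun n => (densityPow d L γ n : ℝ)

theorem latticeConv_shellTranslation (L : ℕ) (γ : ℝ) (r : Fin d → ℤ) (a : (Fin d → ℤ) →₀ ℂ)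
    (n : Fin d → ℤ) :
    latticeConv (shellTranslation d L γ r) a n = densityPow d L γ r * a (n - r) := by
  rw [shellTranslation, latticeConv_latticeKernel, Finset.sum_singleton]

theorem norm_trigSum_shellTranslation_le (hd : 1 ≤ d) (L : ℕ) {γ : ℝ} (hγ : 0 ≤ γ)
    (r : Fin d → ℤ) (ζ : E d) : ‖trigSum (shellTranslation d L γ r) ζ‖ ≤ 1 := by
  refine (norm_trigSum_latticeKernel_le _ _ _).trans ?_
  rw [Finset.sum_singleton, Complex.norm_real, Real.norm_of_nonneg (densityPow_nonneg _ _ _)]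
  exact densityPow_le_one hd L hγ r

/-- For `r` in shell `l`, a single point of size `2^{-ldγ}` has critical Herz size about `2^{ld(1 -
1/u - γ)}`, which is at most one precisely under the assumption on `γ`. -/
theorem exists_seqNorm_shellTranslation_le (hd : 1 ≤ d) {u t : ℝ≥0∞} (hu : 1 < u) (ht : 0 < t)
    {s : ℝ} (hs : s = d - d * (u⁻¹).toReal) {γ : ℝ} (hγ : 1 - (u⁻¹).toReal ≤ γ) :
    ∃ A : ℝ≥0∞, A ≠ ∞ ∧ ∀ L r k,
      seqNorm t (herzEntry u s (kernelMajorant (shellTranslation d L γ r) k)) ≤ A := by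
  obtain ⟨A, hA, h⟩ := exists_seqNorm_herzEntry_le hd hu ht hs
  refine ⟨A, hA, fun L r k => ?_⟩
  have hcard : ((shellTranslation d L γ r).support.card : ℝ) ≤ 1 := by
    have := Finset.card_le_card (support_latticeKernel_subset {r} fun n =>
      ((densityPow d L γ n : ℝ) : ℂ))
    rw [Finset.card_singleton] at this
    unfold shellTranslation
    exact_mod_cast this
  have hval : ∀ n, ‖shellTranslation d L γ r n‖ ≤ densityPow d L γ r := by
    intro n
    rw [shellTranslation, latticeKernel_apply]
    split_ifs with hn
    · rw [Finset.mem_singleton.1 hn, Complex.norm_real,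
        Real.norm_of_nonneg (densityPow_nonneg _ _ _)]
    · rw [norm_zero]
      exact densityPow_nonneg _ _ _
  -- Outside the shells the kernel is zero, so any shell index and the bound `0` will do.
  by_cases hr : shellDensity d L r = 0
  · have h0 : densityPow d L γ r = 0 := if_pos hr
    refine h 0 k _ 0 1 ?_ (fun n => h0 ▸ hval n) hcard (by simp)
    intro n hn
    have h1 := hval n
    rw [h0, norm_le_zero_iff] at h1
    exact absurd h1 (Finsupp.mem_support_iff.1 hn)
  · obtain ⟨l, hl, hrl⟩ := exists_of_shellDensity_ne_zero hr
    refine h l k _ _ 1 ((support_latticeKernel_subset _ _).trans (by simpa using hrl)) hval hcard ?_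
    rw [densityPow, if_neg hr, shellDensity_of_mem hd hl hrl, Real.one_rpow, mul_one]
    have e : (2 : ℝ) ^ (l * d) = (2 : ℝ) ^ ((l : ℝ) * d) := by
      exact_mod_cast (Real.rpow_natCast 2 (l * d)).symm
    rw [e, ← Real.rpow_neg zero_le_two, ← Real.rpow_mul zero_le_two, ← Real.rpow_add two_pos, hs]
    refine Real.rpow_le_one_of_one_le_of_nonpos one_le_two ?_
    have h2 : (0 : ℝ) ≤ l * d := by positivity
    nlinarith

/-- The support of the dyadic density. -/
theorem densityPow_eq_zero {L : ℕ} (θ : ℝ) {n : Fin d → ℤ}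
    (hn : n ∉ (Finset.range L).biUnion (shell d)) : densityPow d L θ n = 0 := by
  refine if_pos ?_
  by_contra h
  obtain ⟨l, hl, hnl⟩ := exists_of_shellDensity_ne_zero h
  exact hn (Finset.mem_biUnion.2 ⟨l, Finset.mem_range.2 hl, hnl⟩)

/-- If `1/p < 1/q`, the point masses at `-r` of size `ρ(r)^{1/p}`, with `ρ` the dyadic density, have
norm `L^{1/p}`. Translation moves them all to the origin with size `ρ(r)^{1/q}`, where the `ℓ^q`
norm is `L^{1/q}`. If `1/p > 1/q`, masses `ρ(r)^{1/q}` at the origin are spread to the points `r`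
with size `ρ(r)^{1/p}`, and the roles are exchanged. -/
theorem exists_shellTranslation_gap (hd : 1 ≤ d) {p q : ℝ≥0∞} (hp : p ≠ 0) (hq : q ≠ 0)
    (hpq : (p⁻¹).toReal ≠ (q⁻¹).toReal) (N : ℕ) :
    ∃ (L : ℕ) (a : (Fin d → ℤ) → (Fin d → ℤ) →₀ ℂ) (S : Finset (Fin d → ℤ)),
      (∀ j ∉ S, a j = 0) ∧ N * mixedNorm p q (fun j => a j) < mixedNorm p q fun j =>
        latticeConv (shellTranslation d L |(p⁻¹).toReal - (q⁻¹).toReal| j) (a j) := by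
  rcases hpq.lt_or_gt with h | h
  · obtain ⟨L, hL, hN⟩ := exists_nat_mul_rpow_lt h N
    refine ⟨L, fun r => latticeKernel {-r} fun _ => (densityPow d L (p⁻¹).toReal r : ℝ),
      (Finset.range L).biUnion (shell d), fun r hr => ?_, ?_⟩
    · ext n
      rw [latticeKernel_apply, densityPow_eq_zero _ hr]
      simp
    · have h1 : mixedNorm p q (fun r : Fin d → ℤ => (latticeKernel {-r} fun _ =>
          (densityPow d L (p⁻¹).toReal r : ℂ) : (Fin d → ℤ) → ℂ)) =
          (L : ℝ≥0∞) ^ (p⁻¹).toReal := by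
        rw [← seqNorm_densityPow hd hL hp, ← seqNorm_comp_equiv _ (Equiv.neg (Fin d → ℤ))]
        unfold mixedNorm
        congr 1
        ext n
        rw [seqNorm_of_support_singleton (m := -n) hq]
        · simp only [latticeKernel_apply, neg_neg, Finset.mem_singleton, if_true, Equiv.neg_apply]
          exact enorm_ofReal_of_nonneg (densityPow_nonneg _ _ _)
        · intro r hr
          dsimp only
          rw [latticeKernel_apply, if_neg, enorm_zero]
          rw [Finset.mem_singleton]
          rintro rfl
          exact hr (neg_neg r).symm
      rw [h1]
      refine hN.trans_le (le_trans ?_ (le_mixedNorm hp _ 0))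
      rw [← seqNorm_densityPow hd hL hq]
      refine seqNorm_mono fun r => ?_
      rw [latticeConv_shellTranslation, latticeKernel_apply, if_pos (by simp), ← Complex.ofReal_mul,
        densityPow_mul, abs_of_neg (by linarith), neg_sub, sub_add_cancel,
        enorm_ofReal_of_nonneg (densityPow_nonneg _ _ _)]
  · obtain ⟨L, hL, hN⟩ := exists_nat_mul_rpow_lt h N
    refine ⟨L, fun r => latticeKernel {0} fun _ => (densityPow d L (q⁻¹).toReal r : ℝ),
      (Finset.range L).biUnion (shell d), fun r hr => ?_, ?_⟩
    · ext n
      rw [latticeKernel_apply, densityPow_eq_zero _ hr]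
      simp
    · have h1 : mixedNorm p q (fun r : Fin d → ℤ => (latticeKernel {0} fun _ =>
          (densityPow d L (q⁻¹).toReal r : ℂ) : (Fin d → ℤ) → ℂ)) =
          (L : ℝ≥0∞) ^ (q⁻¹).toReal := by
        rw [mixedNorm_of_support_singleton (m := 0) hp hq fun r n hn => by
          rw [latticeKernel_apply, if_neg (by simpa using hn)], ← seqNorm_densityPow hd hL hq]
        congr 1
        ext r
        rw [latticeKernel_apply, if_pos (by simp), enorm_ofReal_of_nonneg (densityPow_nonneg _ _ _)]
      rw [h1]
      refine hN.trans_le (le_trans ?_ (seqNorm_le_mixedNorm hq _ id))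
      rw [← seqNorm_densityPow hd hL hp]
      refine seqNorm_mono fun r => ?_
      rw [id, latticeConv_shellTranslation, latticeKernel_apply, if_pos (by simp),
        ← Complex.ofReal_mul, densityPow_mul, abs_of_pos (by linarith), sub_add_cancel,
        enorm_ofReal_of_nonneg (densityPow_nonneg _ _ _)]

/-! ### Rudin-Shapiro signs -/

/-- Pass from `(p, q)` to `(p + z^{2^m} q, p - z^{2^m} q)`. The coefficients remain signs, and by
the parallelogram law the sum of squares doubles on the unit circle. -/
theorem exists_rudinShapiro_pair (m : ℕ) : ∃ p q : ℕ → ℝ, (∀ r, p r ^ 2 = 1) ∧ (∀ r, q r ^ 2 = 1) ∧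
    ∀ z : ℂ, ‖z‖ = 1 → ‖∑ r ∈ Finset.range (2 ^ m), p r * z ^ r‖ ^ 2 +
      ‖∑ r ∈ Finset.range (2 ^ m), q r * z ^ r‖ ^ 2 = 2 ^ (m + 1) := by
  induction m with
  | zero => exact ⟨fun _ => 1, fun _ => 1, by simp, by simp, fun z _ => by norm_num⟩
  | succ m ih =>
    obtain ⟨p, q, hp, hq, h⟩ := ih
    refine ⟨fun r => if r < 2 ^ m then p r else q (r - 2 ^ m),
      fun r => if r < 2 ^ m then p r else -q (r - 2 ^ m), fun r => ?_, fun r => ?_, fun z hz => ?_⟩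
    · dsimp only
      split_ifs
      exacts [hp r, hq _]
    · dsimp only
      split_ifs
      exacts [hp r, by rw [neg_sq, hq]]
    · set a := ∑ r ∈ Finset.range (2 ^ m), (p r : ℂ) * z ^ r with ha
      set b := ∑ r ∈ Finset.range (2 ^ m), (q r : ℂ) * z ^ r with hb
      have h1 : ∀ g : ℕ → ℝ, ∑ r ∈ Finset.range (2 ^ (m + 1)),
          ((if r < 2 ^ m then p r else g (r - 2 ^ m) : ℝ) : ℂ) * z ^ r =
          a + z ^ 2 ^ m * ∑ r ∈ Finset.range (2 ^ m), (g r : ℂ) * z ^ r := by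
        intro g
        rw [pow_succ, mul_two, Finset.sum_range_add, ha, Finset.mul_sum]
        congr 1
        · exact Finset.sum_congr rfl fun r hr => by rw [if_pos (Finset.mem_range.1 hr)]
        · refine Finset.sum_congr rfl fun r _ => ?_
          rw [if_neg (by lia), Nat.add_sub_cancel_left, pow_add]
          ring
      have h2 := h1 q
      have h3 := h1 fun r => -q r
      simp only [Complex.ofReal_neg, neg_mul, Finset.sum_neg_distrib, mul_neg, ← sub_eq_add_neg,
        ← hb] at h2 h3
      have h4 := parallelogram_law_with_norm ℝ a (z ^ 2 ^ m * b)
      have h5 : ‖z ^ 2 ^ m * b‖ = ‖b‖ := by rw [norm_mul, norm_pow, hz, one_pow, one_mul]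
      rw [h5] at h4
      rw [h2, h3]
      have h6 := h z hz
      rw [pow_succ (2 : ℝ) (m + 1)]
      linarith

/-- Periodic signs with small exponential sums. -/
theorem exists_periodic_signs (μ : ℕ) : ∃ P : ℤ → ℝ, (∀ x, P x ^ 2 = 1) ∧
    (∀ x y : ℤ, x ≡ y [ZMOD (2 ^ (2 * μ) : ℕ)] → P x = P y) ∧ ∀ z : ℂ, ‖z‖ = 1 →
      ‖∑ r ∈ Finset.range (2 ^ (2 * μ)), (P r : ℂ) * z ^ r‖ ≤ 2 * 2 ^ μ := by
  obtain ⟨p, q, hp, -, h⟩ := exists_rudinShapiro_pair (2 * μ)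
  refine ⟨fun x => p (x % (2 ^ (2 * μ) : ℕ)).toNat, fun x => hp _, fun x y hxy => ?_,
    fun z hz => ?_⟩
  · dsimp only
    rw [hxy]
  · have h1 : ∑ r ∈ Finset.range (2 ^ (2 * μ)),
        ((p (((r : ℕ) : ℤ) % (2 ^ (2 * μ) : ℕ)).toNat : ℝ) : ℂ) * z ^ r =
        ∑ r ∈ Finset.range (2 ^ (2 * μ)), (p r : ℂ) * z ^ r := by
      refine Finset.sum_congr rfl fun r hr => ?_
      rw [← Int.natCast_mod, Int.toNat_natCast, Nat.mod_eq_of_lt (Finset.mem_range.1 hr)]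
    rw [h1]
    have h2 := h z hz
    -- Dropping the partner polynomial leaves the square at most `2 · (2^μ)^2`, which is less than
    -- `(2 · 2^μ)^2`.
    refine abs_le_of_sq_le_sq' ?_ (by positivity) |>.2
    have h3 : (2 : ℝ) ^ (2 * μ + 1) = 2 * (2 ^ μ) ^ 2 := by ring
    rw [h3] at h2
    have h4 : (0 : ℝ) ≤ (2 ^ μ) ^ 2 := by positivity
    have := sq_nonneg ‖∑ r ∈ Finset.range (2 ^ (2 * μ)), (q r : ℂ) * z ^ r‖
    rw [mul_pow]
    linarith

/-! ### Sums over lattice cubes -/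

/-- The lattice points with all coordinates in `[a, b)`. -/
noncomputable def cube (d : ℕ) (a b : ℤ) : Finset (Fin d → ℤ) :=
  Fintype.piFinset fun _ => Finset.Ico a b

theorem mem_cube {a b : ℤ} {n : Fin d → ℤ} : n ∈ cube d a b ↔ ∀ i, a ≤ n i ∧ n i < b := by
  simp [cube]

theorem prod_ite_coord {M : Type*} [CommMonoid M] (i₀ : Fin d) (x y : M) :
    ∏ i : Fin d, (if i = i₀ then x else y) = x * y ^ (d - 1) := by
  rw [Fintype.prod_eq_mul_prod_compl i₀, if_pos rfl, Finset.prod_congr rfl fun i hi => by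
    rw [if_neg (by simpa using hi)], Finset.prod_const, Finset.card_compl]
  simp

theorem sum_cube_coord {M : Type*} [CommSemiring M] (i₀ : Fin d) (a b : ℤ) (f : ℤ → M) :
    ∑ n ∈ cube d a b, f (n i₀) = (∑ x ∈ Finset.Ico a b, f x) * ((b - a).toNat : M) ^ (d - 1) := by
  have h : ∀ n : Fin d → ℤ, f (n i₀) = ∏ i, (fun i x => if i = i₀ then f x else 1) i (n i) := by
    intro n
    simp
  rw [Finset.sum_congr rfl fun n _ => h n, cube,
    Finset.sum_prod_piFinset (Finset.Ico a b) fun i x => if i = i₀ then f x else 1,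
    ← prod_ite_coord i₀]
  refine Finset.prod_congr rfl fun i _ => ?_
  split_ifs with hi
  · rfl
  · simp

theorem sum_Ico_mul {M : Type*} [AddCommMonoid M] {Q : ℕ} (hQ : 0 < Q) (A B : ℤ) (f : ℤ → M) :
    ∑ x ∈ Finset.Ico (Q * A) (Q * B), f x =
      ∑ k ∈ Finset.Ico A B, ∑ y ∈ Finset.range Q, f (Q * k + y) := by
  have hQ' : (0 : ℤ) < Q := by exact_mod_cast hQ
  rw [← Finset.sum_product']
  -- Division with remainder by `Q` splits the interval into full periods.
  refine Finset.sum_nbij' (fun x => (x / Q, (x % Q).toNat)) (fun z => Q * z.1 + z.2) ?_ ?_ ?_ ?_ ?_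
  · intro x hx
    rw [Finset.mem_Ico] at hx
    have h1 := Int.emod_nonneg x hQ'.ne'
    have h2 := Int.emod_lt_of_pos x hQ'
    simp only [Finset.mem_product, Finset.mem_Ico, Finset.mem_range]
    refine ⟨⟨?_, ?_⟩, by lia⟩
    · rw [Int.le_ediv_iff_mul_le hQ', mul_comm]
      exact hx.1
    · rw [Int.ediv_lt_iff_lt_mul hQ', mul_comm]
      exact hx.2
  · rintro ⟨k, y⟩ hz
    simp only [Finset.mem_product, Finset.mem_Ico, Finset.mem_range] at hz
    rw [Finset.mem_Ico]
    obtain ⟨⟨h1, h2⟩, h3⟩ := hz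
    have h4 := mul_le_mul_of_nonneg_left h1 hQ'.le
    have h5 := mul_le_mul_of_nonneg_left (Int.add_one_le_iff.2 h2) hQ'.le
    have h6 : (y : ℤ) < Q := by exact_mod_cast h3
    constructor
    · dsimp only
      lia
    · dsimp only
      rw [mul_add] at h5
      lia
  · intro x hx
    dsimp only
    rw [Int.toNat_of_nonneg (Int.emod_nonneg x hQ'.ne')]
    exact Int.mul_ediv_add_emod x Q
  · rintro ⟨k, y⟩ hz
    simp only [Finset.mem_product, Finset.mem_Ico, Finset.mem_range] at hz
    have h6 : (y : ℤ) < Q := by exact_mod_cast hz.2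
    refine Prod.ext ?_ ?_
    · dsimp only
      rw [add_comm, Int.add_mul_ediv_left _ _ hQ'.ne', Int.ediv_eq_zero_of_lt (by positivity) h6,
        zero_add]
    · dsimp only
      rw [add_comm, Int.add_mul_emod_self_left, Int.emod_eq_of_lt (by positivity) h6,
        Int.toNat_natCast]
  · intro x hx
    dsimp only
    rw [Int.toNat_of_nonneg (Int.emod_nonneg x hQ'.ne'), Int.mul_ediv_add_emod x Q]

/-- Sums over lattice cubes of periodic functions of one coordinate. -/
theorem sum_cube_periodic {M : Type*} [CommSemiring M] {Q : ℕ} (hQ : 0 < Q) (i₀ : Fin d) (A : ℤ)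
    (B : ℕ) {f : ℤ → M} (hf : ∀ x y : ℤ, x ≡ y [ZMOD Q] → f x = f y) :
    ∑ n ∈ cube d (Q * A) (Q * (A + B)), f (n i₀) =
      B * (∑ y ∈ Finset.range Q, f y) * ((Q * B : ℕ) : M) ^ (d - 1) := by
  rw [sum_cube_coord, sum_Ico_mul hQ]
  have h1 : ∀ k ∈ Finset.Ico A (A + B), ∑ y ∈ Finset.range Q, f (Q * k + y) =
      ∑ y ∈ Finset.range Q, f y := by
    intro k _
    refine Finset.sum_congr rfl fun y _ => hf _ _ ?_
    simp [Int.ModEq]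
  have h2 : ((Q : ℤ) * (A + B) - Q * A).toNat = Q * B := by
    rw [mul_add, add_sub_cancel_left]
    exact_mod_cast Int.toNat_natCast (Q * B)
  rw [Finset.sum_congr rfl h1, Finset.sum_const, h2]
  simp

theorem card_cube_filter {Q w : ℕ} (hQ : 0 < Q) (hw : w ≤ Q) (i₀ : Fin d) (A : ℤ) (B : ℕ) :
    ((cube d (Q * A) (Q * (A + B))).filter fun n => n i₀ % (Q : ℤ) < w).card * Q = w * (Q * B) ^ d := by
  have hd : d - 1 + 1 = d := Nat.sub_add_cancel (Nat.one_le_of_lt i₀.2)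
  have h := sum_cube_periodic (M := ℕ) hQ i₀ A B (f := fun x => if x % (Q : ℤ) < w then 1 else 0)
    fun x y hxy => by rw [hxy]
  have h1 : ∑ y ∈ Finset.range Q, (if ((y : ℕ) : ℤ) % Q < w then 1 else 0) = w := by
    rw [← Finset.card_filter]
    have : (Finset.range Q).filter (fun y : ℕ => (y : ℤ) % Q < w) = Finset.range w := by
      ext y
      simp only [Finset.mem_filter, Finset.mem_range]
      constructor
      · rintro ⟨h1, h2⟩
        rw [← Int.natCast_mod, Nat.mod_eq_of_lt h1] at h2
        exact_mod_cast h2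
      · intro h1
        have h2 := h1.trans_le hw
        refine ⟨h2, ?_⟩
        rw [← Int.natCast_mod, Nat.mod_eq_of_lt h2]
        exact_mod_cast h1
    rw [this, Finset.card_range]
  rw [h1] at h
  rw [Finset.card_filter, h]
  conv_rhs => rw [← hd]
  rw [pow_succ, Nat.cast_id, Nat.cast_id]
  ring

/-! ### Modulated kernels spread over many shells -/

/-- Starting at level `2μ` makes every shell a union of whole periods modulo `2^{2μ}`, so periodic
sums have no boundary terms. -/
theorem shell_eq_cube (μ l : ℕ) : shell d (2 * μ + l) =
    cube d ((2 ^ (2 * μ) : ℕ) * 2 ^ l) ((2 ^ (2 * μ) : ℕ) * (2 ^ l + (2 ^ l : ℕ))) := by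
  rw [shell, cube]
  congr! 3
  · push_cast
    rw [pow_add]
  · push_cast
    ring

/-- A dyadic shell with signs depending on one coordinate. -/
noncomputable def signedShell (i₀ : Fin d) (P : ℤ → ℝ) (ε : ℝ) (l : ℕ) : (Fin d → ℤ) →₀ ℂ :=
  latticeKernel (shell d l) fun n => (ε * ((2 : ℝ) ^ (l * d))⁻¹ * P (n i₀) : ℝ)

/-- The sum of signed shells over `2 μ ≤ l < 2 μ + L`. -/
noncomputable def signedKernel (i₀ : Fin d) (P : ℤ → ℝ) (ε : ℝ) (μ L : ℕ) : (Fin d → ℤ) →₀ ℂ :=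
  ∑ l ∈ Finset.range L, signedShell i₀ P ε (2 * μ + l)

/-- In the distinguished coordinate the shell contains `2^l` periods of length `Q = 2^{2μ}`.
Averaging over the shell thus gives each residue class weight `1 / Q`. -/
theorem shell_weight (i₀ : Fin d) (μ l : ℕ) : ((2 : ℝ) ^ ((2 * μ + l) * d))⁻¹ *
    ((2 : ℝ) ^ l * ((2 : ℝ) ^ (2 * μ) * 2 ^ l) ^ (d - 1)) = ((2 : ℝ) ^ (2 * μ))⁻¹ := by
  have hd : (2 * μ + l) * d = 2 * μ + (l + (2 * μ + l) * (d - 1)) := by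
    obtain ⟨e, rfl⟩ : ∃ e, d = e + 1 := ⟨d - 1, (Nat.sub_add_cancel (Nat.one_le_of_lt i₀.2)).symm⟩
    rw [Nat.add_sub_cancel]
    ring
  rw [hd, pow_add, pow_add 2 l, ← pow_add 2 (2 * μ) l, ← pow_mul, mul_inv, mul_assoc,
    inv_mul_cancel₀ (by positivity), mul_one]

theorem latticeConv_sum_left {ι : Type} (S : Finset ι) (κ : ι → (Fin d → ℤ) →₀ ℂ)
    (a : (Fin d → ℤ) →₀ ℂ) : latticeConv (∑ i ∈ S, κ i) a = ∑ i ∈ S, latticeConv (κ i) a :=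
  (Finsupp.sum_finsetSum_index (h := fun r (c : ℂ) => c • a.mapDomain (r + ·))
    (fun _ => zero_smul _ _) fun _ _ _ => add_smul _ _ _).symm

/-- When the summand depends only on one coordinate modulo `Q = 2^{2μ}`, every shell contributes the
same period average. The `L` shells then act as one convolution on residues; with `εL = 2^μ` its
entries are `±2^{-μ}`. -/
theorem latticeConv_signedKernel (i₀ : Fin d) (P : ℤ → ℝ) (ε : ℝ) (μ L : ℕ)
    (a : (Fin d → ℤ) →₀ ℂ) (n : Fin d → ℤ) {f : ℤ → ℂ}
    (hf : ∀ x y : ℤ, x ≡ y [ZMOD (2 ^ (2 * μ) : ℕ)] → f x = f y)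
    (h : ∀ l < L, ∀ r ∈ shell d (2 * μ + l), (P (r i₀) : ℂ) * a (n - r) = f (r i₀)) :
    latticeConv (signedKernel i₀ P ε μ L) a n =
      ((ε * L * ((2 : ℝ) ^ (2 * μ))⁻¹ : ℝ) : ℂ) * ∑ y ∈ Finset.range (2 ^ (2 * μ)), f y := by
  rw [signedKernel, latticeConv_sum_left, Finsupp.finsetSum_apply]
  have h1 : ∀ l ∈ Finset.range L, latticeConv (signedShell i₀ P ε (2 * μ + l)) a n =
      ((ε * ((2 : ℝ) ^ (2 * μ))⁻¹ : ℝ) : ℂ) * ∑ y ∈ Finset.range (2 ^ (2 * μ)), f y := by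
    intro l hl
    rw [signedShell, latticeConv_latticeKernel]
    have h2 : ∀ r ∈ shell d (2 * μ + l),
        ((ε * ((2 : ℝ) ^ ((2 * μ + l) * d))⁻¹ * P (r i₀) : ℝ) : ℂ) * a (n - r) =
        ((ε * ((2 : ℝ) ^ ((2 * μ + l) * d))⁻¹ : ℝ) : ℂ) * f (r i₀) := by
      intro r hr
      rw [Complex.ofReal_mul _ (P _), mul_assoc, h l (Finset.mem_range.1 hl) r hr]
    rw [Finset.sum_congr rfl h2, ← Finset.mul_sum, shell_eq_cube,
      sum_cube_periodic (by positivity) i₀ _ _ hf, ← shell_weight i₀ μ l]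
    push_cast
    ring
  rw [Finset.sum_congr rfl h1, Finset.sum_const, Finset.card_range, nsmul_eq_mul]
  push_cast
  ring

theorem fourierChar_neg_inner_latticePoint (n : Fin d → ℤ) (ζ : E d) :
    (Real.fourierChar (-inner ℝ (latticePoint n) ζ) : ℂ) =
      ∏ i, (Real.fourierChar (-ζ i) : ℂ) ^ n i := by
  have h : -inner ℝ (latticePoint n) ζ = ∑ i, n i • (-ζ i) := by
    rw [PiLp.inner_apply, ← Finset.sum_neg_distrib]
    refine Finset.sum_congr rfl fun i _ => ?_
    simp
    ring
  have h1 : ∀ S : Finset (Fin d), (Real.fourierChar (∑ i ∈ S, n i • (-ζ i)) : ℂ) =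
      ∏ i ∈ S, (Real.fourierChar (-ζ i) : ℂ) ^ n i := by
    intro S
    induction S using Finset.cons_induction with
    | empty => simp
    | cons i S hi ih =>
      rw [Finset.sum_cons, Finset.prod_cons, AddChar.map_add_eq_mul, Circle.coe_mul, ih,
        AddChar.map_zsmul_eq_zpow, Circle.coe_zpow]
  rw [h, h1]

/-- The exponential sum factors over coordinates. The signed coordinate contributes at most `2 ·
2^μ` per period in place of `2^{2μ}`, and the others are bounded trivially. -/
theorem norm_trigSum_signedShell_le (i₀ : Fin d) {P : ℤ → ℝ} {μ : ℕ}
    (hP : ∀ x y : ℤ, x ≡ y [ZMOD (2 ^ (2 * μ) : ℕ)] → P x = P y)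
    (hz : ∀ z : ℂ, ‖z‖ = 1 → ‖∑ r ∈ Finset.range (2 ^ (2 * μ)), (P r : ℂ) * z ^ r‖ ≤ 2 * 2 ^ μ)
    {ε : ℝ} (hε : 0 ≤ ε) (l : ℕ) (ζ : E d) :
    ‖trigSum (signedShell i₀ P ε (2 * μ + l)) ζ‖ ≤ 2 * ε * (2 ^ μ)⁻¹ := by
  set z : Fin d → ℂ := fun i => (Real.fourierChar (-ζ i) : ℂ) with hzdef
  have hz1 : ∀ i, ‖z i‖ = 1 := fun i => Circle.norm_coe _
  set c : ℝ := ε * ((2 : ℝ) ^ ((2 * μ + l) * d))⁻¹ with hc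
  set I := Finset.Ico (((2 ^ (2 * μ) : ℕ) : ℤ) * 2 ^ l)
    (((2 ^ (2 * μ) : ℕ) : ℤ) * (2 ^ l + (2 ^ l : ℕ))) with hI
  have hcard : (I.card : ℝ) = 2 ^ (2 * μ) * 2 ^ l := by
    rw [hI, Int.card_Ico, mul_add, add_sub_cancel_left]
    exact_mod_cast congrArg (Nat.cast (R := ℝ)) (Int.toNat_natCast (2 ^ (2 * μ) * 2 ^ l))
  set g : Fin d → ℤ → ℂ := fun i x => (if i = i₀ then (P x : ℂ) else 1) * z i ^ x with hg
  have h1 : trigSum (signedShell i₀ P ε (2 * μ + l)) ζ = c * ∏ i, ∑ x ∈ I, g i x := by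
    rw [← Finset.sum_prod_piFinset I g, signedShell, trigSum_latticeKernel, Finset.mul_sum,
      shell_eq_cube]
    refine Finset.sum_congr rfl fun n _ => ?_
    rw [fourierChar_neg_inner_latticePoint, hg, Finset.prod_mul_distrib]
    simp only [Finset.prod_ite_eq', Finset.mem_univ, if_true]
    rw [← hc, Complex.ofReal_mul]
    ring
  have h2 : ∀ i, ‖∑ x ∈ I, g i x‖ ≤
      if i = i₀ then (2 : ℝ) ^ l * (2 * 2 ^ μ) else 2 ^ (2 * μ) * 2 ^ l := by
    intro i
    split_ifs with hi
    · subst hi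
      rw [hI, sum_Ico_mul (by positivity)]
      refine (norm_sum_le _ _).trans ((Finset.sum_le_card_nsmul _ _ (2 * 2 ^ μ) fun k _ => ?_).trans
        (le_of_eq ?_))
      · have h3 : ∀ y ∈ Finset.range (2 ^ (2 * μ)), g i (((2 ^ (2 * μ) : ℕ) : ℤ) * k + y) =
            z i ^ (((2 ^ (2 * μ) : ℕ) : ℤ) * k) * ((P y : ℂ) * z i ^ y) := by
          intro y _
          have hz0 : z i ≠ 0 := norm_ne_zero_iff.1 (by rw [hz1]; exact one_ne_zero)
          rw [hg]
          dsimp only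
          rw [if_pos rfl, zpow_add₀ hz0, zpow_natCast, hP _ y (by simp [Int.ModEq])]
          ring
        rw [Finset.sum_congr rfl h3, ← Finset.mul_sum, norm_mul, norm_zpow, hz1, one_zpow, one_mul]
        exact hz _ (hz1 i)
      · rw [Int.card_Ico, add_sub_cancel_left, Int.toNat_natCast, nsmul_eq_mul]
        push_cast
        rfl
    · refine (norm_sum_le _ _).trans (le_of_eq ?_)
      rw [← hcard, Finset.card_eq_sum_ones]
      push_cast
      refine Finset.sum_congr rfl fun x _ => ?_
      rw [hg]
      dsimp only
      rw [if_neg hi, one_mul, norm_zpow, hz1, one_zpow]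
  have hc0 : 0 ≤ c := by positivity
  rw [h1, norm_mul, norm_prod, Complex.norm_real, Real.norm_of_nonneg hc0]
  calc c * ∏ i, ‖∑ x ∈ I, g i x‖ ≤
      c * ∏ i, (if i = i₀ then (2 : ℝ) ^ l * (2 * 2 ^ μ) else 2 ^ (2 * μ) * 2 ^ l) := by
        refine mul_le_mul_of_nonneg_left (Finset.prod_le_prod (fun i _ => norm_nonneg _)
          fun i _ => h2 i) hc0
    _ = ε * (2 * 2 ^ μ) * (((2 : ℝ) ^ ((2 * μ + l) * d))⁻¹ *
          ((2 : ℝ) ^ l * ((2 : ℝ) ^ (2 * μ) * 2 ^ l) ^ (d - 1))) := by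
        rw [prod_ite_coord, hc]
        ring
    _ = _ := by
        rw [shell_weight i₀, two_mul μ, pow_add]
        field_simp

theorem norm_trigSum_signedKernel_le (i₀ : Fin d) {P : ℤ → ℝ} {μ : ℕ}
    (hP : ∀ x y : ℤ, x ≡ y [ZMOD (2 ^ (2 * μ) : ℕ)] → P x = P y)
    (hz : ∀ z : ℂ, ‖z‖ = 1 → ‖∑ r ∈ Finset.range (2 ^ (2 * μ)), (P r : ℂ) * z ^ r‖ ≤ 2 * 2 ^ μ)
    {ε : ℝ} (hε : 0 ≤ ε) {L : ℕ} (hL : ε * L = 2 ^ μ) (ζ : E d) :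
    ‖trigSum (signedKernel i₀ P ε μ L) ζ‖ ≤ 2 := by
  rw [signedKernel, trigSum, map_sum]
  refine (norm_sum_le _ _).trans ((Finset.sum_le_card_nsmul _ _ _ fun l _ =>
    norm_trigSum_signedShell_le i₀ hP hz hε l ζ).trans (le_of_eq ?_))
  rw [Finset.card_range, nsmul_eq_mul, mul_comm 2 ε, mul_assoc ε, ← mul_assoc (L : ℝ),
    mul_comm (L : ℝ), hL]
  field_simp

theorem kernelMajorant_eq_sum (κ : (Fin d → ℤ) →₀ ℂ) (k : ℕ) (x : E d) {U : Finset (Fin d → ℤ)}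
    (hU : κ.support ⊆ U) : kernelMajorant κ k x = (2⁻¹ ^ k) ^ d *
      ∑ n ∈ U, ‖κ n‖ * weight (2 * d + 2) ((2⁻¹ : ℝ) ^ k • x - latticePoint n) := by
  rw [kernelMajorant, Finset.sum_subset hU fun n _ hn => by
    rw [Finsupp.notMem_support_iff.1 hn, norm_zero, zero_mul]]

theorem kernelMajorant_sum_le {ι : Type} (S : Finset ι) (κ : ι → (Fin d → ℤ) →₀ ℂ) (k : ℕ) (x : E d) :
    kernelMajorant (∑ i ∈ S, κ i) k x ≤ ∑ i ∈ S, kernelMajorant (κ i) k x := by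
  classical
  set U := S.biUnion fun i => (κ i).support with hU
  have h1 : (∑ i ∈ S, κ i).support ⊆ U := Finsupp.support_finsetSum
  have h2 : ∀ i ∈ S, kernelMajorant (κ i) k x = (2⁻¹ ^ k) ^ d *
      ∑ n ∈ U, ‖κ i n‖ * weight (2 * d + 2) ((2⁻¹ : ℝ) ^ k • x - latticePoint n) := fun i hi =>
    kernelMajorant_eq_sum _ _ _ (Finset.subset_biUnion_of_mem (fun i => (κ i).support) hi)
  rw [kernelMajorant_eq_sum _ _ _ h1, Finset.sum_congr rfl h2, ← Finset.mul_sum, Finset.sum_comm]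
  refine mul_le_mul_of_nonneg_left (Finset.sum_le_sum fun n _ => ?_) (by positivity)
  rw [← Finset.sum_mul, Finsupp.finsetSum_apply]
  exact mul_le_mul_of_nonneg_right (norm_sum_le _ _) (weight_pos _ _).le

theorem continuous_kernelMajorant (κ : (Fin d → ℤ) →₀ ℂ) (k : ℕ) :
    Continuous (kernelMajorant κ k) := by
  have := continuous_weight (d := d) (2 * d + 2)
  unfold kernelMajorant
  fun_prop

theorem herzEntry_sum_le {u : ℝ≥0∞} (hu : 1 ≤ u) (s : ℝ) {ι : Type} (S : Finset ι)
    (κ : ι → (Fin d → ℤ) →₀ ℂ) (k i : ℕ) :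
    herzEntry u s (kernelMajorant (∑ j ∈ S, κ j) k) i ≤
      ∑ j ∈ S, herzEntry u s (kernelMajorant (κ j) k) i := by
  unfold herzEntry
  rw [← Finset.mul_sum]
  refine mul_le_mul_right ?_ _
  refine le_trans (eLpNorm_mono_real (g := ∑ j ∈ S, kernelMajorant (κ j) k) fun x => ?_)
    (eLpNorm_sum_le (fun j _ => (continuous_kernelMajorant (κ j) k).aestronglyMeasurable) hu)
  rw [Real.norm_of_nonneg (kernelMajorant_nonneg _ _ _), Finset.sum_apply]
  exact kernelMajorant_sum_le S κ k x

/-- The `L` shells peak at distinct annuli with geometric tails, so their entries add up to a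
sequence of size `ε` and total mass about `εL`. Interpolation gives an `ℓ^t` norm of order `ε
L^{1/t}`. -/
theorem exists_seqNorm_signedKernel_le (hd : 1 ≤ d) {u t : ℝ≥0∞} (hu : 1 < u) (ht : 1 ≤ t) {s : ℝ}
    (hs : s = d - d * (u⁻¹).toReal) :
    ∃ A : ℝ≥0∞, A ≠ ∞ ∧ ∀ (i₀ : Fin d) (P : ℤ → ℝ) (ε : ℝ) (μ L k : ℕ), (∀ x, P x ^ 2 = 1) →
      0 ≤ ε → ε * (L : ℝ) ^ (t⁻¹).toReal ≤ 1 →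
      seqNorm t (herzEntry u s (kernelMajorant (signedKernel i₀ P ε μ L) k)) ≤ A := by
  obtain ⟨C, hC, h⟩ := exists_herzEntry_le hd hu hs
  have hσ := critical_pos hd hu hs
  set G : ℝ≥0∞ := ∑' r : ℤ, ENNReal.ofReal (geomDecay (min s 1) r) with hG
  have hGt : G ≠ ∞ := tsum_geomDecay_ne_top hσ
  set τ := (t⁻¹).toReal with hτ
  have hτ0 : 0 ≤ τ := ENNReal.toReal_nonneg
  have hτ1 : τ ≤ 1 := by
    rw [hτ]
    exact ENNReal.toReal_le_of_le_ofReal zero_le_one (by simpa using ht)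
  refine ⟨ENNReal.ofReal C * G, ENNReal.mul_ne_top ENNReal.ofReal_ne_top hGt, ?_⟩
  intro i₀ P ε μ L k hP hε hεL
  have habs : ∀ x, |P x| = 1 := fun x => by
    rw [← Real.sqrt_sq_eq_abs, hP, Real.sqrt_one]
  have h1 : ∀ i, herzEntry u s (kernelMajorant (signedKernel i₀ P ε μ L) k) i ≤
      ENNReal.ofReal (C * ε) * ∑ l ∈ Finset.range L,
        ENNReal.ofReal (geomDecay (min s 1) ((i : ℤ) - (k + (2 * μ + l) : ℕ))) := by
    intro i
    refine (herzEntry_sum_le hu.le s _ _ k i).trans ?_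
    rw [Finset.mul_sum]
    refine Finset.sum_le_sum fun l _ => ?_
    set l' := 2 * μ + l
    refine (h l' k i (signedShell i₀ P ε l') (ε * ((2 : ℝ) ^ (l' * d))⁻¹) ((2 : ℝ) ^ (l' * d))
      (support_latticeKernel_subset _ _) (fun n => ?_) ?_).trans (le_of_eq ?_)
    · rw [signedShell, latticeKernel_apply]
      split_ifs
      · rw [Complex.norm_real, norm_mul, Real.norm_eq_abs (P _), habs, mul_one,
          Real.norm_of_nonneg (by positivity)]
      · rw [norm_zero]
        positivity
    · have := Finset.card_le_card (support_latticeKernel_subset (shell d l') fun n =>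
        ((ε * ((2 : ℝ) ^ (l' * d))⁻¹ * P (n i₀) : ℝ) : ℂ))
      rw [card_shell] at this
      unfold signedShell
      exact_mod_cast this
    · rw [← ENNReal.ofReal_mul (by positivity)]
      rw [shell_critical hs]
  have h2 : ∀ l : ℕ, ∑' i : ℕ, ENNReal.ofReal
      (geomDecay (min s 1) ((i : ℤ) - (k + (2 * μ + l) : ℕ))) ≤ G := fun l =>
    ENNReal.tsum_comp_le_tsum_of_injective (f := fun i : ℕ => (i : ℤ) - (k + (2 * μ + l) : ℕ))
      (fun i i' hi => by simpa using hi) fun r => ENNReal.ofReal (geomDecay (min s 1) r)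
  have h3 : ∀ i : ℕ, ∑ l ∈ Finset.range L,
      ENNReal.ofReal (geomDecay (min s 1) ((i : ℤ) - (k + (2 * μ + l) : ℕ))) ≤ G := fun i =>
    (ENNReal.sum_le_tsum _).trans (ENNReal.tsum_comp_le_tsum_of_injective
      (f := fun l : ℕ => (i : ℤ) - (k + (2 * μ + l) : ℕ)) (fun l l' hl => by simpa using hl)
        fun r => ENNReal.ofReal (geomDecay (min s 1) r))
  refine (seqNorm_mono h1).trans ?_
  rw [seqNorm_const_mul (zero_lt_one.trans_le ht).ne']
  refine (mul_le_mul_right (seqNorm_le_interpolate ht h3 hGt) _).trans ?_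
  rw [Summable.tsum_finsetSum fun _ _ => ENNReal.summable]
  calc _ ≤ ENNReal.ofReal (C * ε) * (G ^ (1 - τ) * (L * G) ^ τ) := by
        gcongr
        refine (Finset.sum_le_card_nsmul _ _ G fun l _ => h2 l).trans ?_
        rw [Finset.card_range, nsmul_eq_mul]
    _ = ENNReal.ofReal C * (ENNReal.ofReal ε * (L : ℝ≥0∞) ^ τ) * (G ^ (1 - τ) * G ^ τ) := by
        rw [ENNReal.mul_rpow_of_nonneg _ _ hτ0, ENNReal.ofReal_mul hC.le]
        ring
    _ ≤ ENNReal.ofReal C * 1 * G := by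
        rw [← ENNReal.rpow_add_of_nonneg _ _ (by linarith) hτ0, sub_add_cancel, ENNReal.rpow_one]
        gcongr
        rw [← ENNReal.ofReal_natCast, ENNReal.ofReal_rpow_of_nonneg (by positivity) hτ0,
          ← ENNReal.ofReal_mul hε]
        simpa using hεL
    _ = _ := by rw [mul_one]

/-! ### Test sequences for the modulated kernels -/

theorem natCast_rpow_of_mul_eq {c X a b : ℕ} (h : c * 2 ^ a = 2 ^ b * X) {π : ℝ} (hπ : 0 ≤ π) :
    (c : ℝ≥0∞) ^ π = 2 ^ (((b : ℝ) - a) * π) * (X : ℝ≥0∞) ^ π := by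
  have h1 : (c : ℝ≥0∞) * 2 ^ a = 2 ^ b * X := by exact_mod_cast h
  have h2 : (c : ℝ≥0∞) = 2 ^ ((b : ℝ) - a) * X := by
    rw [ENNReal.rpow_sub _ _ two_ne_zero ENNReal.ofNat_ne_top, ENNReal.rpow_natCast,
      ENNReal.rpow_natCast, div_eq_mul_inv, mul_right_comm, ← h1,
      ENNReal.mul_inv_cancel_right (by positivity) (by finiteness)]
  rw [h2, ENNReal.mul_rpow_of_nonneg _ _ hπ, ← ENNReal.rpow_mul]

theorem seqNorm_indicator {ι : Type} [DecidableEq ι] {q : ℝ≥0∞} (h0 : q ≠ 0) {S : Finset ι} (hS : 0 < S.card)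
    (c : ℝ≥0∞) :
    seqNorm q (fun i => if i ∈ S then c else 0) = c * (S.card : ℝ≥0∞) ^ (q⁻¹).toReal := by
  rw [ENNReal.toReal_inv, ← one_div, ← seqNorm_indicator_const h0 S (Finset.card_pos.1 hS)]
  congr!

theorem card_cube_zero (d m : ℕ) : (cube d 0 (2 ^ m)).card = 2 ^ (m * d) := by
  have h : ((2 : ℤ) ^ m).toNat = 2 ^ m := by exact_mod_cast Int.toNat_natCast (2 ^ m)
  simp [cube, h, pow_mul]

/-- Outputs are evaluated on the shell just beyond all the kernel shells. From there every shift
stays in the box carrying the test sequences, so truncation has no effect. -/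
theorem sub_mem_cube {μ L l : ℕ} (hl : l < L) {n r : Fin d → ℤ} (hn : n ∈ shell d (2 * μ + L))
    (hr : r ∈ shell d (2 * μ + l)) : n - r ∈ cube d 0 (2 ^ (2 * μ + L + 1)) := by
  rw [mem_cube]
  intro i
  obtain ⟨h1, h2⟩ := mem_shell.1 hn i
  obtain ⟨h3, h4⟩ := mem_shell.1 hr i
  have h5 : (2 : ℤ) ^ (2 * μ + l + 1) ≤ 2 ^ (2 * μ + L) := pow_le_pow_right₀ one_le_two (by lia)
  have h6 : (0 : ℤ) < 2 ^ (2 * μ + l) := by positivity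
  rw [Pi.sub_apply]
  constructor <;> lia

theorem card_cube_filter_pow (i₀ : Fin d) {μ ω : ℕ} (hω : ω ≤ 2 * μ) (L : ℕ) :
    ((cube d 0 (2 ^ (2 * μ + L + 1))).filter
      fun n => n i₀ % ((2 ^ (2 * μ) : ℕ) : ℤ) < (2 ^ ω : ℕ)).card * 2 ^ (2 * μ) =
      2 ^ (ω + d) * 2 ^ ((2 * μ + L) * d) := by
  have h := card_cube_filter (Q := 2 ^ (2 * μ)) (w := 2 ^ ω) (by positivity)
    (Nat.pow_le_pow_right two_pos hω) i₀ 0 (2 ^ (L + 1))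
  have e : (((2 ^ (2 * μ) : ℕ) : ℤ) * (0 + (2 ^ (L + 1) : ℕ))) = 2 ^ (2 * μ + L + 1) := by
    push_cast
    ring
  rw [mul_zero, e] at h
  rw [h]
  ring

theorem card_shell_filter_pow (i₀ : Fin d) {μ ω : ℕ} (hω : ω ≤ 2 * μ) (L : ℕ) :
    ((shell d (2 * μ + L)).filter
      fun n => n i₀ % ((2 ^ (2 * μ) : ℕ) : ℤ) < (2 ^ ω : ℕ)).card * 2 ^ (2 * μ) =
      2 ^ ω * 2 ^ ((2 * μ + L) * d) := by
  have h := card_cube_filter (Q := 2 ^ (2 * μ)) (w := 2 ^ ω) (by positivity)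
    (Nat.pow_le_pow_right two_pos hω) i₀ (2 ^ L) (2 ^ L)
  rw [shell_eq_cube, h]
  ring

theorem sub_emod_eq_iff {Q : ℕ} (n : ℤ) {j y : ℕ} (hj : j < Q) (hy : y < Q) :
    (n - y) % Q = j ↔ y = ((n - j) % Q).toNat := by
  have hQ : (0 : ℤ) < Q := by exact_mod_cast (Nat.zero_le j).trans_lt hj
  have hj' : (j : ℤ) < Q := by exact_mod_cast hj
  have hy' : (y : ℤ) < Q := by exact_mod_cast hy
  have key : (n - y) % Q = j ↔ (y : ℤ) = (n - j) % Q := by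
    constructor
    · intro h
      have h1 := Int.mul_ediv_add_emod (n - y) Q
      rw [h] at h1
      rw [show n - j = y + Q * ((n - y) / Q) by lia, Int.add_mul_emod_self_left,
        Int.emod_eq_of_lt (by positivity) hy']
    · intro h
      have h1 := Int.mul_ediv_add_emod (n - j) Q
      rw [← h] at h1
      rw [show n - y = j + Q * ((n - j) / Q) by lia, Int.add_mul_emod_self_left,
        Int.emod_eq_of_lt (by positivity) hj']
  rw [key]
  have := Int.emod_nonneg (n - j) hQ.ne'
  lia

/-- Indicators of residue classes as test sequences. -/
theorem exists_residue_test {p q : ℝ≥0∞} (hp : p ≠ 0) (hq : q ≠ 0) (i₀ : Fin d) {P : ℤ → ℝ}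
    {μ ω : ℕ} (hω : ω ≤ 2 * μ) (hP1 : ∀ x, P x ^ 2 = 1)
    (hP : ∀ x y : ℤ, x ≡ y [ZMOD (2 ^ (2 * μ) : ℕ)] → P x = P y) {ε : ℝ} {L : ℕ}
    (hL : ε * L = 2 ^ μ) :
    ∃ (a : ℕ → (Fin d → ℤ) →₀ ℂ) (S : Finset ℕ), (∀ j ∉ S, a j = 0) ∧
      mixedNorm p q (fun j => a j) ≤ 2 ^ (((ω : ℝ) + d - 2 * μ) * (p⁻¹).toReal) *
        ((2 ^ ((2 * μ + L) * d) : ℕ) : ℝ≥0∞) ^ (p⁻¹).toReal ∧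
      2 ^ (ω * (q⁻¹).toReal - μ) * ((2 ^ ((2 * μ + L) * d) : ℕ) : ℝ≥0∞) ^ (p⁻¹).toReal ≤
        mixedNorm p q fun j => latticeConv (signedKernel i₀ P ε μ L) (a j) := by
  set Q : ℕ := 2 ^ (2 * μ) with hQ
  have hQ0 : 0 < Q := by positivity
  have hwQ : 2 ^ ω ≤ Q := Nat.pow_le_pow_right two_pos hω
  -- The box has `2^d` times as many points as the output shell; this accounts for the fixed loss
  -- `2^{d/p}`.
  set box := cube d 0 (2 ^ (2 * μ + L + 1)) with hbox
  set a : ℕ → (Fin d → ℤ) →₀ ℂ := fun j => if j ∈ Finset.range (2 ^ ω) then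
    latticeKernel (box.filter fun n => n i₀ % (Q : ℤ) = j) fun _ => 1 else 0 with ha
  have ha_apply : ∀ j n, a j n =
      if j < 2 ^ ω ∧ n ∈ box ∧ n i₀ % (Q : ℤ) = j then 1 else 0 := by
    intro j n
    rw [ha]
    dsimp only
    by_cases hj : j < 2 ^ ω
    · rw [if_pos (Finset.mem_range.2 hj), latticeKernel_apply]
      simp [hj]
    · rw [if_neg (by simpa using hj)]
      simp [hj]
  refine ⟨a, Finset.range (2 ^ ω), fun j hj => if_neg hj, ?_, ?_⟩
  · set In := box.filter fun n => n i₀ % (Q : ℤ) < (2 ^ ω : ℕ) with hIn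
    have hcard := card_cube_filter_pow i₀ hω L
    rw [← hQ, ← hbox, ← hIn] at hcard
    have hpos : 0 < In.card := by
      have : 0 < In.card * Q := by
        rw [hcard]
        positivity
      exact Nat.pos_of_mul_pos_right this
    have h1 := natCast_rpow_of_mul_eq hcard (π := (p⁻¹).toReal) ENNReal.toReal_nonneg
    push_cast at h1 ⊢
    rw [← h1, ← one_mul ((In.card : ℝ≥0∞) ^ _), ← seqNorm_indicator hp hpos]
    refine seqNorm_mono fun n => ?_
    have hn0 := Int.emod_nonneg (n i₀) (b := (Q : ℤ)) (by exact_mod_cast hQ0.ne')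
    rw [seqNorm_of_support_singleton (m := (n i₀ % (Q : ℤ)).toNat) hq]
    · beta_reduce
      rw [ha_apply]
      by_cases hn : n ∈ In
      · rw [if_pos hn]
        split_ifs <;> simp
      · rw [if_neg hn, if_neg, enorm_zero]
        rintro ⟨h2, h3, h4⟩
        refine hn (Finset.mem_filter.2 ⟨h3, ?_⟩)
        rw [h4]
        exact_mod_cast h2
    · intro j hj
      dsimp only
      rw [ha_apply, if_neg, enorm_zero]
      rintro ⟨-, -, h4⟩
      exact hj (by rw [h4, Int.toNat_natCast])
  · have hval : ∀ n ∈ shell d (2 * μ + L), ∀ j ∈ Finset.range (2 ^ ω),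
        ‖latticeConv (signedKernel i₀ P ε μ L) (a j) n‖ₑ = 2 ^ (-(μ : ℝ)) := by
      intro n hn j hj
      rw [Finset.mem_range] at hj
      have hjQ : j < Q := hj.trans_le hwQ
      rw [latticeConv_signedKernel i₀ P ε μ L (a j) n
        (f := fun x => (P x : ℂ) * if (n i₀ - x) % (Q : ℤ) = j then 1 else 0)]
      · have h1 : ∀ y ∈ Finset.range Q, ((P y : ℂ) * if (n i₀ - y) % (Q : ℤ) = j then 1 else 0) =
            if y = ((n i₀ - j) % (Q : ℤ)).toNat then (P y : ℂ) else 0 := by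
          intro y hy
          simp only [sub_emod_eq_iff (n i₀) hjQ (Finset.mem_range.1 hy), mul_ite, mul_one, mul_zero]
        rw [Finset.sum_congr rfl h1, Finset.sum_ite_eq', if_pos, ← Complex.ofReal_mul,
          ← ofReal_norm, Complex.norm_real, norm_mul]
        · have habs : ∀ x, ‖P x‖ = 1 := fun x => by
            rw [Real.norm_eq_abs, ← Real.sqrt_sq_eq_abs, hP1, Real.sqrt_one]
          rw [habs, mul_one, hL, two_mul μ, pow_add, mul_inv, mul_inv_cancel_left₀ (by positivity),
            Real.norm_of_nonneg (by positivity), ENNReal.ofReal_inv_of_pos (by positivity),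
            ENNReal.ofReal_pow zero_le_two, ENNReal.rpow_neg, ENNReal.rpow_natCast,
            ENNReal.ofReal_ofNat]
        · have h2 := Int.emod_nonneg (n i₀ - j) (b := (Q : ℤ)) (by exact_mod_cast hQ0.ne')
          have h3 := Int.emod_lt_of_pos (n i₀ - j) (b := (Q : ℤ)) (by exact_mod_cast hQ0)
          rw [Finset.mem_range]
          lia
      · intro x y hxy
        rw [hP x y hxy, (Int.ModEq.rfl.sub hxy : n i₀ - x ≡ n i₀ - y [ZMOD Q])]
      · intro l hl r hr
        rw [ha_apply]
        simp [hj, hbox, sub_mem_cube hl hn hr]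
    have h1 := seqNorm_indicator hq (S := Finset.range (2 ^ ω)) (by simp) (2 ^ (-(μ : ℝ)))
    have h2 := seqNorm_indicator hp (S := shell d (2 * μ + L)) (by rw [card_shell]; positivity)
      (2 ^ (-(μ : ℝ)) * ((Finset.range (2 ^ ω)).card : ℝ≥0∞) ^ (q⁻¹).toReal)
    rw [card_shell] at h2
    have h3 : (2 : ℝ≥0∞) ^ (ω * (q⁻¹).toReal - μ) =
        2 ^ (-(μ : ℝ)) * ((Finset.range (2 ^ ω)).card : ℝ≥0∞) ^ (q⁻¹).toReal := by
      rw [Finset.card_range, Nat.cast_pow, Nat.cast_ofNat, ← ENNReal.rpow_natCast,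
        ← ENNReal.rpow_mul, ← ENNReal.rpow_add _ _ two_ne_zero ENNReal.ofNat_ne_top, sub_eq_neg_add]
    rw [h3, ← h2]
    refine seqNorm_mono fun n => ?_
    split_ifs with hn
    · rw [← h1]
      refine seqNorm_mono fun j => ?_
      split_ifs with hj
      · exact (hval n hn j hj).ge
      · exact zero_le
    · exact zero_le

/-- Modulated indicators as test sequences. -/
theorem exists_modulated_test {p q : ℝ≥0∞} (hp : p ≠ 0) (hq : q ≠ 0) (i₀ : Fin d) {P : ℤ → ℝ}
    {μ ω : ℕ} (hω : ω ≤ 2 * μ) (hP1 : ∀ x, P x ^ 2 = 1)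
    (hP : ∀ x y : ℤ, x ≡ y [ZMOD (2 ^ (2 * μ) : ℕ)] → P x = P y) {ε : ℝ} {L : ℕ}
    (hL : ε * L = 2 ^ μ) :
    ∃ (a : ℕ → (Fin d → ℤ) →₀ ℂ) (S : Finset ℕ), (∀ j ∉ S, a j = 0) ∧
      mixedNorm p q (fun j => a j) ≤ 2 ^ (ω * (q⁻¹).toReal + d * (p⁻¹).toReal) *
        ((2 ^ ((2 * μ + L) * d) : ℕ) : ℝ≥0∞) ^ (p⁻¹).toReal ∧
      2 ^ (μ + ((ω : ℝ) - 2 * μ) * (p⁻¹).toReal) *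
        ((2 ^ ((2 * μ + L) * d) : ℕ) : ℝ≥0∞) ^ (p⁻¹).toReal ≤
        mixedNorm p q fun j => latticeConv (signedKernel i₀ P ε μ L) (a j) := by
  set Q : ℕ := 2 ^ (2 * μ) with hQ
  have hQ0 : 0 < Q := by positivity
  have hwQ : 2 ^ ω ≤ Q := Nat.pow_le_pow_right two_pos hω
  have habs : ∀ x, ‖P x‖ = 1 := fun x => by
    rw [Real.norm_eq_abs, ← Real.sqrt_sq_eq_abs, hP1, Real.sqrt_one]
  set box := cube d 0 (2 ^ (2 * μ + L + 1)) with hbox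
  set a : ℕ → (Fin d → ℤ) →₀ ℂ := fun j => if j ∈ Finset.range (2 ^ ω) then
    latticeKernel box fun n => (P (j - n i₀) : ℂ) else 0 with ha
  have ha_apply : ∀ j ∈ Finset.range (2 ^ ω), ∀ n,
      a j n = if n ∈ box then (P (j - n i₀) : ℂ) else 0 := by
    intro j hj n
    rw [ha]
    dsimp only
    rw [if_pos hj, latticeKernel_apply]
  refine ⟨a, Finset.range (2 ^ ω), fun j hj => if_neg hj, ?_, ?_⟩
  · have h1 := seqNorm_indicator hq (S := Finset.range (2 ^ ω)) (by simp) 1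
    have h2 := seqNorm_indicator hp (S := box) (by rw [hbox, card_cube_zero]; positivity)
      (((Finset.range (2 ^ ω)).card : ℝ≥0∞) ^ (q⁻¹).toReal)
    have hcard : box.card * 2 ^ 0 = 2 ^ d * 2 ^ ((2 * μ + L) * d) := by
      rw [hbox, card_cube_zero]
      ring
    have h3 := natCast_rpow_of_mul_eq hcard (π := (p⁻¹).toReal) ENNReal.toReal_nonneg
    rw [h3, Finset.card_range, Nat.cast_pow, Nat.cast_ofNat, ← ENNReal.rpow_natCast,
      ← ENNReal.rpow_mul, ← mul_assoc, ← ENNReal.rpow_add _ _ two_ne_zero ENNReal.ofNat_ne_top,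
      Nat.cast_zero, sub_zero] at h2
    rw [← h2]
    refine seqNorm_mono fun n => ?_
    split_ifs with hn
    · rw [one_mul, Finset.card_range, Nat.cast_pow, Nat.cast_ofNat, ← ENNReal.rpow_natCast,
        ← ENNReal.rpow_mul] at h1
      rw [← h1]
      refine seqNorm_mono fun j => ?_
      beta_reduce
      split_ifs with hj
      · rw [ha_apply j hj, if_pos hn, ← ofReal_norm, Complex.norm_real, habs, ENNReal.ofReal_one]
      · rw [show a j = 0 from if_neg hj]
        simp
    · rw [← seqNorm_zero (ι := ℕ) hq]
      refine seqNorm_mono fun j => ?_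
      beta_reduce
      by_cases hj : j ∈ Finset.range (2 ^ ω)
      · rw [ha_apply j hj, if_neg hn, enorm_zero]
      · rw [show a j = 0 from if_neg hj]
        simp
  · set In := (shell d (2 * μ + L)).filter fun n => n i₀ % (Q : ℤ) < (2 ^ ω : ℕ) with hIn
    have hcard := card_shell_filter_pow i₀ hω L
    rw [← hQ, ← hIn] at hcard
    have hpos : 0 < In.card := by
      have : 0 < In.card * Q := by
        rw [hcard]
        positivity
      exact Nat.pos_of_mul_pos_right this
    have h1 := natCast_rpow_of_mul_eq hcard (π := (p⁻¹).toReal) ENNReal.toReal_nonneg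
    have h2 := seqNorm_indicator hp hpos (2 ^ (μ : ℝ))
    rw [h1, ← mul_assoc, ← ENNReal.rpow_add _ _ two_ne_zero ENNReal.ofNat_ne_top] at h2
    push_cast at h2 ⊢
    rw [← h2]
    refine seqNorm_mono fun n => ?_
    split_ifs with hn
    · obtain ⟨hn1, hn2⟩ := Finset.mem_filter.1 hn
      have hn0 := Int.emod_nonneg (n i₀) (b := (Q : ℤ)) (by exact_mod_cast hQ0.ne')
      set j := (n i₀ % (Q : ℤ)).toNat with hj
      have hj' : (j : ℤ) = n i₀ % (Q : ℤ) := Int.toNat_of_nonneg hn0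
      have hjr : j ∈ Finset.range (2 ^ ω) := by
        rw [Finset.mem_range]
        rw [← hj'] at hn2
        exact_mod_cast hn2
      refine le_trans (le_of_eq ?_) (le_seqNorm hq _ j)
      beta_reduce
      rw [latticeConv_signedKernel i₀ P ε μ L (a j) n (f := fun x => (P x : ℂ) * P x)]
      · have h4 : ∀ y ∈ Finset.range Q, (P y : ℂ) * P y = 1 := by
          intro y _
          rw [← Complex.ofReal_mul, ← sq, hP1, Complex.ofReal_one]
        rw [Finset.sum_congr rfl h4, Finset.sum_const, Finset.card_range, hL, nsmul_eq_mul,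
          mul_one, ← Complex.ofReal_natCast, ← Complex.ofReal_mul, hQ, Nat.cast_pow, Nat.cast_ofNat,
          inv_mul_cancel_right₀ (by positivity), enorm_ofReal_of_nonneg (by positivity),
          ENNReal.ofReal_pow zero_le_two, ENNReal.rpow_natCast, ENNReal.ofReal_ofNat]
      · intro x y hxy
        rw [hP x y hxy]
      · intro l hl r hr
        rw [ha_apply j hjr, if_pos (sub_mem_cube hl hn1 hr)]
        congr 2
        refine hP _ _ ?_
        rw [Pi.sub_apply, hj']
        have h5 : n i₀ % (Q : ℤ) - (n i₀ - r i₀) ≡ n i₀ - (n i₀ - r i₀) [ZMOD Q] :=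
          (Int.mod_modEq _ _).sub_right _
        rwa [sub_sub_cancel] at h5
    · exact zero_le

theorem exists_nat_two_rpow_lt {δ : ℝ} (hδ : 0 < δ) (c : ℝ) (N : ℕ) :
    ∃ μ : ℕ, ∀ α β : ℝ, β - α = μ * δ - c → (N : ℝ≥0∞) * 2 ^ α < 2 ^ β := by
  obtain ⟨μ, hμ⟩ := exists_nat_ge ((N + c) / δ)
  refine ⟨μ, fun α β h => ?_⟩
  rw [div_le_iff₀ hδ] at hμ
  have h1 : (2 : ℝ≥0∞) ^ β = 2 ^ (β - α) * 2 ^ α := by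
    rw [← ENNReal.rpow_add _ _ two_ne_zero ENNReal.ofNat_ne_top, sub_add_cancel]
  rw [h1]
  have h2 : (2 : ℝ≥0∞) ^ α ≠ 0 := (ENNReal.rpow_pos two_pos ENNReal.ofNat_ne_top).ne'
  have h3 : (2 : ℝ≥0∞) ^ α ≠ ∞ := by
    simp [ENNReal.rpow_eq_top_iff]
  refine (ENNReal.mul_lt_mul_iff_left h2 h3).2 ?_
  calc (N : ℝ≥0∞) < 2 ^ N := by exact_mod_cast Nat.lt_two_pow_self
    _ = 2 ^ (N : ℝ) := (ENNReal.rpow_natCast _ _).symm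
    _ ≤ _ := ENNReal.rpow_le_rpow_of_exponent_le one_le_two (by linarith)

theorem mul_lt_of_two_rpow_bounds {N : ℕ} {α β : ℝ} {x y X : ℝ≥0∞} (hX0 : X ≠ 0) (hX : X ≠ ∞)
    (h : (N : ℝ≥0∞) * 2 ^ α < 2 ^ β) (hx : x ≤ 2 ^ α * X) (hy : 2 ^ β * X ≤ y) : N * x < y := by
  calc N * x ≤ N * (2 ^ α * X) := by gcongr
    _ = N * 2 ^ α * X := (mul_assoc _ _ _).symm
    _ < 2 ^ β * X := (ENNReal.mul_lt_mul_iff_left hX0 hX).2 h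
    _ ≤ y := hy

/-- The point-mass test gains `2^{μ(2/q - 1)}` with all residues and `2^{μ(2/p - 1)}` with one. The
modulated test gains the reciprocals. Up to the fixed factor `2^{d/p}`, one of the four is unbounded
in `μ` unless both exponents are `2`. -/
theorem exists_signedKernel_gap {p q : ℝ≥0∞} (hp : p ≠ 0) (hq : q ≠ 0) (i₀ : Fin d)
    (hpq : ¬ ((p⁻¹).toReal = 1 / 2 ∧ (q⁻¹).toReal = 1 / 2)) (N : ℕ) :
    ∃ μ : ℕ, ∀ (P : ℤ → ℝ) (ε : ℝ) (L : ℕ), (∀ x, P x ^ 2 = 1) →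
      (∀ x y : ℤ, x ≡ y [ZMOD (2 ^ (2 * μ) : ℕ)] → P x = P y) → ε * L = 2 ^ μ →
      ∃ (a : ℕ → (Fin d → ℤ) →₀ ℂ) (S : Finset ℕ), (∀ j ∉ S, a j = 0) ∧
        N * mixedNorm p q (fun j => a j) <
          mixedNorm p q fun j => latticeConv (signedKernel i₀ P ε μ L) (a j) := by
  have hX : ∀ m : ℕ, ((2 ^ m : ℕ) : ℝ≥0∞) ^ (p⁻¹).toReal ≠ 0 ∧
      ((2 ^ m : ℕ) : ℝ≥0∞) ^ (p⁻¹).toReal ≠ ∞ := fun m =>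
    ⟨(ENNReal.rpow_pos (by positivity) (by finiteness)).ne',
      ENNReal.rpow_ne_top_of_nonneg ENNReal.toReal_nonneg (by finiteness)⟩
  set π := (p⁻¹).toReal
  set κ := (q⁻¹).toReal
  rcases lt_trichotomy κ (1 / 2) with h | h | h
  · obtain ⟨μ, hμ⟩ := exists_nat_two_rpow_lt (show 0 < 1 - 2 * κ by linarith) (d * π) N
    refine ⟨μ, fun P ε L hP1 hP hL => ?_⟩
    obtain ⟨a, S, h0, h1, h2⟩ := exists_modulated_test hp hq i₀ (ω := 2 * μ) le_rfl hP1 hP hL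
    exact ⟨a, S, h0, mul_lt_of_two_rpow_bounds (hX _).1 (hX _).2
      (hμ _ _ (by push_cast; ring)) h1 h2⟩
  · rcases lt_trichotomy π (1 / 2) with h' | h' | h'
    · obtain ⟨μ, hμ⟩ := exists_nat_two_rpow_lt (show 0 < 1 - 2 * π by linarith) (d * π) N
      refine ⟨μ, fun P ε L hP1 hP hL => ?_⟩
      obtain ⟨a, S, h0, h1, h2⟩ := exists_modulated_test hp hq i₀ (zero_le (a := 2 * μ)) hP1 hP hL
      exact ⟨a, S, h0, mul_lt_of_two_rpow_bounds (hX _).1 (hX _).2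
        (hμ _ _ (by push_cast; ring)) h1 h2⟩
    · exact absurd ⟨h', h⟩ hpq
    · obtain ⟨μ, hμ⟩ := exists_nat_two_rpow_lt (show 0 < 2 * π - 1 by linarith) (d * π) N
      refine ⟨μ, fun P ε L hP1 hP hL => ?_⟩
      obtain ⟨a, S, h0, h1, h2⟩ := exists_residue_test hp hq i₀ (zero_le (a := 2 * μ)) hP1 hP hL
      exact ⟨a, S, h0, mul_lt_of_two_rpow_bounds (hX _).1 (hX _).2
        (hμ _ _ (by push_cast; ring)) h1 h2⟩
  · obtain ⟨μ, hμ⟩ := exists_nat_two_rpow_lt (show 0 < 2 * κ - 1 by linarith) (d * π) N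
    refine ⟨μ, fun P ε L hP1 hP hL => ?_⟩
    obtain ⟨a, S, h0, h1, h2⟩ := exists_residue_test hp hq i₀ (ω := 2 * μ) le_rfl hP1 hP hL
    exact ⟨a, S, h0, mul_lt_of_two_rpow_bounds (hX _).1 (hX _).2
      (hμ _ _ (by push_cast; ring)) h1 h2⟩

/-! ### Unbounded multipliers -/

theorem eq_two_of_toReal_inv_eq {p : ℝ≥0∞} (hp : 1 ≤ p) (h : (p⁻¹).toReal = 1 / 2) : p = 2 := by
  have h1 : (2⁻¹ : ℝ≥0∞).toReal = 1 / 2 := by simp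
  have h2 : p⁻¹ ≠ ∞ := ENNReal.inv_ne_top.2 (zero_lt_one.trans_le hp).ne'
  exact inv_injective ((ENNReal.toReal_eq_toReal_iff' h2 (by simp)).1 (h.trans h1.symm))

theorem toReal_inv_lt_one {p : ℝ≥0∞} (hp : 1 < p) : (p⁻¹).toReal < 1 := by
  have h : p⁻¹ < 1 := ENNReal.inv_lt_one.2 hp
  simpa using (ENNReal.toReal_lt_toReal h.ne_top ENNReal.one_ne_top).2 h

section

variable {φ : E d → ℝ} {ϕ : 𝓢(E d, ℂ)} {p q u t : ℝ≥0∞} {s : ℝ}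

theorem exists_unbounded_of_one_lt_summability (hd : 1 ≤ d) (hφ : IsAnnularCutoff φ)
    (hϕ : IsLittlewoodPaley ϕ) (hp : 1 ≤ p) (hq : 1 ≤ q) (hu : 1 < u) (ht : 1 < t)
    (hpq : ¬ (p = 2 ∧ q = 2)) (hs : s = d - d * (u⁻¹).toReal) :
    ∃ m : Lp ℂ ∞ (volume : Measure (E d)),
      herzMultiplierNorm φ u s t m < ∞ ∧ ¬ IsBoundedMultiplier ϕ p q m := by
  obtain ⟨A', hA', hH⟩ := exists_seqNorm_signedKernel_le hd hu ht.le hs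
  set i₀ : Fin d := ⟨0, hd⟩
  refine exists_multiplier_of_blocks hd hφ hϕ hp hq (zero_lt_one.trans ht) (J := ℕ)
    zero_le_two hA' fun N => ?_
  obtain ⟨μ, hμ⟩ := exists_signedKernel_gap (zero_lt_one.trans_le hp).ne'
    (zero_lt_one.trans_le hq).ne' i₀
    (fun h => hpq ⟨eq_two_of_toReal_inv_eq hp h.1, eq_two_of_toReal_inv_eq hq h.2⟩) N
  obtain ⟨P, hP1, hP, hz⟩ := exists_periodic_signs μ
  -- As `t > 1`, a large `L` gives `2^μ L^{1/t} < L`. Then `ε = 2^μ / L` satisfies both `ε L = 2^μ`,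
  -- which fixes the action on test sequences, and `ε L^{1/t} ≤ 1`, which bounds the Herz norm.
  obtain ⟨L, hL1, hL⟩ := exists_nat_mul_rpow_lt_real (toReal_inv_lt_one ht) (2 ^ μ)
  have hL0 : (0 : ℝ) < L := by exact_mod_cast hL1
  have hε : (0 : ℝ) ≤ 2 ^ μ / L := by positivity
  have hεL : (2 : ℝ) ^ μ / L * L = 2 ^ μ := div_mul_cancel₀ _ hL0.ne'
  obtain ⟨a, S, ha, hgap⟩ := hμ P _ L hP1 hP hεL
  refine ⟨fun _ => signedKernel i₀ P (2 ^ μ / L) μ L, a, S, ha,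
    fun _ => norm_trigSum_signedKernel_le i₀ hP hz hε hεL,
    fun _ k => hH i₀ P _ μ L k hP1 hε ?_, hgap⟩
  rw [div_mul_eq_mul_div, div_le_one hL0]
  rw [Real.rpow_one] at hL
  exact_mod_cast hL.le

theorem exists_unbounded_of_one_lt (hd : 1 ≤ d) (hφ : IsAnnularCutoff φ)
    (hϕ : IsLittlewoodPaley ϕ) (hq : 1 < q) (hu : 1 < u) (ht : 0 < t)
    (hs : s = d - d * (u⁻¹).toReal) :
    ∃ m : Lp ℂ ∞ (volume : Measure (E d)),
      herzMultiplierNorm φ u s t m < ∞ ∧ ¬ IsBoundedMultiplier ϕ 1 q m := by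
  obtain ⟨A', hA', hH⟩ := exists_seqNorm_shellAverage_le hd hu ht hs
  refine exists_multiplier_of_blocks hd hφ hϕ le_rfl hq.le ht (J := ℕ)
    zero_le_one hA' fun N => ?_
  obtain ⟨a, S, ha, hgap⟩ := exists_shellAverage_gap_one hd hq N
  exact ⟨shellAverage d, a, S, ha, norm_trigSum_shellAverage_le, hH, hgap⟩

theorem exists_unbounded_of_ne_top (hd : 1 ≤ d) (hφ : IsAnnularCutoff φ)
    (hϕ : IsLittlewoodPaley ϕ) (hq : 1 ≤ q) (hqt : q ≠ ∞) (hu : 1 < u) (ht : 0 < t)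
    (hs : s = d - d * (u⁻¹).toReal) :
    ∃ m : Lp ℂ ∞ (volume : Measure (E d)),
      herzMultiplierNorm φ u s t m < ∞ ∧ ¬ IsBoundedMultiplier ϕ ∞ q m := by
  obtain ⟨A', hA', hH⟩ := exists_seqNorm_shellAverage_le hd hu ht hs
  refine exists_multiplier_of_blocks hd hφ hϕ le_top hq ht (J := ℕ)
    zero_le_one hA' fun N => ?_
  obtain ⟨a, S, ha, hgap⟩ := exists_shellAverage_gap_top hd hq hqt N
  exact ⟨shellAverage d, a, S, ha, norm_trigSum_shellAverage_le, hH, hgap⟩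

theorem exists_unbounded_of_le_abs_sub (hd : 1 ≤ d) (hφ : IsAnnularCutoff φ)
    (hϕ : IsLittlewoodPaley ϕ) (hp : 1 ≤ p) (hq : 1 ≤ q) (hu : 1 < u) (ht : 0 < t)
    (hs : s = d - d * (u⁻¹).toReal)
    (hpq : 1 - (u⁻¹).toReal ≤ |(p⁻¹).toReal - (q⁻¹).toReal|) :
    ∃ m : Lp ℂ ∞ (volume : Measure (E d)),
      herzMultiplierNorm φ u s t m < ∞ ∧ ¬ IsBoundedMultiplier ϕ p q m := by
  obtain ⟨A', hA', hH⟩ := exists_seqNorm_shellTranslation_le hd hu ht hs hpq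
  have hne : (p⁻¹).toReal ≠ (q⁻¹).toReal := by
    intro h
    rw [h, sub_self, abs_zero] at hpq
    linarith [toReal_inv_lt_one hu]
  refine exists_multiplier_of_blocks hd hφ hϕ hp hq ht (J := Fin d → ℤ)
    zero_le_one hA' fun N => ?_
  obtain ⟨L, a, S, ha, hgap⟩ := exists_shellTranslation_gap hd (zero_lt_one.trans_le hp).ne'
    (zero_lt_one.trans_le hq).ne' hne N
  exact ⟨_, a, S, ha, norm_trigSum_shellTranslation_le hd L (abs_nonneg _), hH L, hgap⟩

end

end HerzMultiplier

/-! ### Assembly of the five cases -/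

open HerzMultiplier in
theorem mainTheorem7 {d : ℕ} (hd : 1 ≤ d)
    (φ : E d → ℝ) (hφ : IsAnnularCutoff φ)
    (ϕ : 𝓢(E d, ℂ)) (hϕ : IsLittlewoodPaley ϕ)
    (p q u t : ℝ≥0∞) (s : ℝ)
    (hp : 1 ≤ p) (hq : 1 ≤ q) (hu : 1 < u) (ht : 0 < t)
    (hpq : ¬ (p = 2 ∧ q = 2))
    (hcase :
      s < d - d * (u⁻¹).toReal ∨
      (s = d - d * (u⁻¹).toReal ∧ p = 1 ∧ 1 < q) ∨
      (s = d - d * (u⁻¹).toReal ∧ q < p ∧ p = ∞) ∨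
      (s = d - d * (u⁻¹).toReal ∧ 1 < p ∧ p < ∞ ∧
        1 - (u⁻¹).toReal ≤ |(p⁻¹).toReal - (q⁻¹).toReal|) ∨
      (s = d - d * (u⁻¹).toReal ∧ 1 < t)) :
    ∃ m : Lp ℂ ∞ (volume : Measure (E d)),
      herzMultiplierNorm φ u s t m < ∞ ∧ ¬ IsBoundedMultiplier ϕ p q m := by
  rcases hcase with hs | ⟨hs, rfl, hq'⟩ | ⟨hs, hqp, rfl⟩ | ⟨hs, -, -, hγ⟩ | ⟨hs, ht'⟩
  -- Below the critical smoothness, a counterexample at the critical exponent with `t = ∞` serves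
  -- for every `t`: the strict gap in `s` makes the weights summable to any power.
  · obtain ⟨m, hm, hunb⟩ := exists_unbounded_of_one_lt_summability hd hφ hϕ hp hq hu
      ENNReal.one_lt_top hpq rfl
    exact ⟨m, herzMultiplierNorm_lt_top_of_lt ht hs hm, hunb⟩
  · exact exists_unbounded_of_one_lt hd hφ hϕ hq' hu ht hs
  · exact exists_unbounded_of_ne_top hd hφ hϕ hq hqp.ne hu ht hs
  · exact exists_unbounded_of_le_abs_sub hd hφ hϕ hp hq hu ht hs hγ
  · exact exists_unbounded_of_one_lt_summability hd hφ hϕ hp hq hu ht' hpq hs
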